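/- **Setting.** Let $d\ge 2$, and let $W^*\in\mathbb R^{d\times d}$ be an invertible matrix whose rows $w_1^*,\dots,w_d^*$ are unit vectors. Let $u_t(a)=\frac{1}{1+e^{-(a-t)}}$ be the sigmoid with threshold $t$, let $$P(X_1,\dots,X_d)=c_0+\sum_{i\in[d]}c_iX_i+\sum_{S\subseteq[d],\,|S|>1}c_S\prod_{j\in S}X_j ,\qquad f(x)=P\big(u_t(\langle w_1^*,x\rangle),\dots,u_t(\langle w_d^*,x\rangle)\big),$$ and let $T$ be the diagonal matrix with $T_{ii}=\sqrt{c_i}$. Assume that, for constants $c_{\max}\ge c_{\min}>0$ and $K$, we have $c_{\min}\le c_i\le c_{\max}$ for all $i\in[d]$, $|c_S|\le c_{\max}$ for all $|S|>1$, $\kappa(W^*)=\sigma_{\max}(W^*)/\sigma_{\min}(W^*)\le K$, and $f\ge 0$ on $\mathbb R^d$. The learner knows $d$ and $t$ and has access to an oracle which returns independent noiseless samples $(x,f(x))$, where $x$ is drawn from $N(0,I_d)$ and retained with probability proportional to $f(x)$; that is, $x$ has density $f/\mathbb E_{g\sim N(0,I_d)}[f(g)]$ with respect to $N(0,I_d)$.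 **Theorem.** For all constants $c_{\min},c_{\max},K$ as above and every $k\in\mathbb N$ there are a constant $C>0$ and a randomized algorithm such that, for all $d\ge2$, all $t\ge C\log d$, and all $W^*$ and $P$ as above, the algorithm always halts after at most $\mathrm{poly}(d)$ steps (oracle calls included), with a polynomial that depends only on $c_{\min},c_{\max},K,k$, and with probability at least $1-d^{-k}$ it outputs vectors $z_1,\dots,z_d\in\mathbb R^d$ that are, up to a permutation, within Euclidean distance $d^{-k}$ of the $d$ columns of $(TW^*)^{-1}$. Here an algorithm is a single program, independent of $d$, for a random access machine over the reals with unit-cost operations $+,-,\times,/,\sqrt{\ },\exp,\log$ and comparisons on real numbers, addition and subtraction of integers, indirect addressing, rational constants, and internal standard Gaussian random numbers; an oracle call costs $d+1$ steps. -/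

import Mathlib

open MeasureTheory ProbabilityTheory

noncomputable section

/-! ## The network -/

/-- The network `f(x) = P(u_t(w₁ᵀx), …, u_t(w_dᵀx))`. Here `wᵢ` is the `i`-th row of `W`,
`u_t(a) = 1 / (1 + e^{-(a - t)})` is the sigmoid with threshold `t`, and `P` is the polynomial
`P(X₁, …, X_d) = ∑_{S ⊆ [d]} c_S ∏_{j ∈ S} X_j` of degree at most one in every variable.
The constant term of `P` is `c ∅` and the coefficient of `Xᵢ` is `c {i}`. -/
def network {d : ℕ} (t : ℝ) (W : Matrix (Fin d) (Fin d) ℝ) (c : Finset (Fin d) → ℝ)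
    (x : EuclideanSpace ℝ (Fin d)) : ℝ :=
  ∑ S : Finset (Fin d), c S * ∏ j ∈ S, Real.sigmoid ((W.mulVec x.ofLp) j - t)

/-- The condition number `κ(W) = σ₁(W) / σ_d(W)`, the ratio of the largest to the smallest
singular value (meaningful for invertible `W`; Mathlib numbers singular values from zero). -/
def condNumber {d : ℕ} (W : Matrix (Fin d) (Fin d) ℝ) : ℝ :=
  W.toEuclideanLin.singularValues 0 / W.toEuclideanLin.singularValues (d - 1)

/-- The matrix `(T W)⁻¹`, where `T` is diagonal with `Tᵢᵢ = √cᵢ`. -/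
def targetMatrix {d : ℕ} (W : Matrix (Fin d) (Fin d) ℝ) (c : Finset (Fin d) → ℝ) :
    Matrix (Fin d) (Fin d) ℝ :=
  (Matrix.diagonal (fun i => √(c {i})) * W)⁻¹

/-- The law of an input that is drawn from `N(0, I_d)` and retained with probability proportional
to `f x`: it has density `f / 𝔼[f]` with respect to the standard Gaussian measure. -/
def biasedLaw {d : ℕ} (f : EuclideanSpace ℝ (Fin d) → ℝ) :
    Measure (EuclideanSpace ℝ (Fin d)) :=
  (∫⁻ x, ENNReal.ofReal (f x) ∂stdGaussian (EuclideanSpace ℝ (Fin d)))⁻¹ •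
    (stdGaussian (EuclideanSpace ℝ (Fin d))).withDensity (fun x => ENNReal.ofReal (f x))

/-! ## Randomized algorithms with a sample oracle

A random access machine over the reals, programmed in a small imperative language. A program is a
finite object that contains no real constants besides rationals and that does not depend on the
dimension. The machine has integer registers `0, 1, 2, …` and real cells, whose addresses are
finite tuples of integers (so that `[a]`, `[a, i]`, `[a, i, j]` address scalars, vectors, matrices).
There is no rounding of reals to integers, and integers can only be added and subtracted. -/

namespace RealRAM

/-- A state of the machine: its integer registers, its real cells, and the number of random draws
(oracle samples and internal random numbers) made so far. -/
structure State where
  nat : ℕ → ℕ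
  real : List ℕ → ℝ
  draws : ℕ

/-- Integer expressions (`sub` is truncated at zero). -/
inductive NExpr where
  | lit (n : ℕ)
  | reg (i : ℕ)
  | add (a b : NExpr)
  | sub (a b : NExpr)

def NExpr.eval (s : State) : NExpr → ℕ
  | .lit n => n
  | .reg i => s.nat i
  | .add a b => a.eval s + b.eval s
  | .sub a b => a.eval s - b.eval s

/-- The value of an address. -/
def evalAddr (s : State) (a : List NExpr) : List ℕ := a.map (NExpr.eval s)

/-- Real expressions. -/
inductive RExpr where
  | lit (q : ℚ)
  | cell (a : List NExpr)
  | ofNat (e : NExpr)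
  | add (a b : RExpr)
  | sub (a b : RExpr)
  | mul (a b : RExpr)
  | div (a b : RExpr)
  | sqrt (a : RExpr)
  | exp (a : RExpr)
  | log (a : RExpr)

def RExpr.eval (s : State) : RExpr → ℝ
  | .lit q => (q : ℝ)
  | .cell a => s.real (evalAddr s a)
  | .ofNat e => (e.eval s : ℝ)
  | .add a b => a.eval s + b.eval s
  | .sub a b => a.eval s - b.eval s
  | .mul a b => a.eval s * b.eval s
  | .div a b => a.eval s / b.eval s
  | .sqrt a => √(a.eval s)
  | .exp a => Real.exp (a.eval s)
  | .log a => Real.log (a.eval s)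

/-- Tests. -/
inductive BExpr where
  | natLt (a b : NExpr)
  | realLt (a b : RExpr)
  | not (b : BExpr)
  | and (b b' : BExpr)

def BExpr.Holds (s : State) : BExpr → Prop
  | .natLt a b => a.eval s < b.eval s
  | .realLt a b => a.eval s < b.eval s
  | .not b => ¬ b.Holds s
  | .and b b' => b.Holds s ∧ b'.Holds s

/-- Programs. `sample a` asks the oracle for a labelled sample `(x, y)`, and stores `y` in the cell
`a` and the coordinate `x_j` in the cell `a ++ [j]`, for `j < d`; `gauss a` stores a fresh internal
random number with law `N(0, 1)` in the cell `a`. -/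
inductive Program where
  | skip
  | setNat (i : ℕ) (e : NExpr)
  | setReal (a : List NExpr) (e : RExpr)
  | sample (a : List NExpr)
  | gauss (a : List NExpr)
  | seq (p q : Program)
  | ite (b : BExpr) (p q : Program)
  | loop (b : BExpr) (p : Program)

/-- Store a labelled sample `(x, y)` at the address `a`. -/
def State.storeSample {d : ℕ} (s : State) (a : List ℕ) (x : EuclideanSpace ℝ (Fin d)) (y : ℝ) :
    State where
  nat := s.nat
  real := (List.finRange d).foldl (fun r (j : Fin d) => Function.update r (a ++ [(j : ℕ)]) (x j))
    (Function.update s.real a y)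
  draws := s.draws + 1

/-- `Exec f ω p s n s'`: the program `p`, started in the state `s`, halts after `n` steps in the
state `s'`. The function `f` gives the labels, and `ω i = (x, g)` holds the outcome of the `i`-th
random draw: if that draw is an oracle call then the answer is `(x, f x)`, and if it is an internal
random number then the result is `g`. An oracle call takes `d + 1` steps, every other assignment and
every test takes one step (expressions have a size that is bounded for a given program). -/
inductive Exec {d : ℕ} (f : EuclideanSpace ℝ (Fin d) → ℝ)
    (ω : ℕ → EuclideanSpace ℝ (Fin d) × ℝ) : Program → State → ℕ → State → Prop
  | skip (s : State) : Exec f ω .skip s 1 s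
  | setNat (i : ℕ) (e : NExpr) (s : State) :
      Exec f ω (.setNat i e) s 1 ⟨Function.update s.nat i (e.eval s), s.real, s.draws⟩
  | setReal (a : List NExpr) (e : RExpr) (s : State) :
      Exec f ω (.setReal a e) s 1
        ⟨s.nat, Function.update s.real (evalAddr s a) (e.eval s), s.draws⟩
  | sample (a : List NExpr) (s : State) :
      Exec f ω (.sample a) s (d + 1)
        (s.storeSample (evalAddr s a) (ω s.draws).1 (f (ω s.draws).1))
  | gauss (a : List NExpr) (s : State) :
      Exec f ω (.gauss a) s 1
        ⟨s.nat, Function.update s.real (evalAddr s a) (ω s.draws).2, s.draws + 1⟩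
  | seq {p q : Program} {s s' s'' : State} {m n : ℕ} :
      Exec f ω p s m s' → Exec f ω q s' n s'' → Exec f ω (.seq p q) s (m + n) s''
  | iteTrue {b : BExpr} {p q : Program} {s s' : State} {n : ℕ} :
      b.Holds s → Exec f ω p s n s' → Exec f ω (.ite b p q) s (n + 1) s'
  | iteFalse {b : BExpr} {p q : Program} {s s' : State} {n : ℕ} :
      ¬ b.Holds s → Exec f ω q s n s' → Exec f ω (.ite b p q) s (n + 1) s'
  | loopTrue {b : BExpr} {p : Program} {s s' s'' : State} {m n : ℕ} :
      b.Holds s → Exec f ω p s m s' → Exec f ω (.loop b p) s' n s'' →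
        Exec f ω (.loop b p) s (m + n + 1) s''
  | loopFalse {b : BExpr} {p : Program} {s : State} :
      ¬ b.Holds s → Exec f ω (.loop b p) s 1 s

/-- The machine is deterministic once the outcomes of the random draws are fixed: the running time
and the final state are unique. -/
theorem Exec.unique {d : ℕ} {f : EuclideanSpace ℝ (Fin d) → ℝ}
    {ω : ℕ → EuclideanSpace ℝ (Fin d) × ℝ} {p : Program} {s : State} {n₁ n₂ : ℕ} {s₁ s₂ : State}
    (h₁ : Exec f ω p s n₁ s₁) (h₂ : Exec f ω p s n₂ s₂) : n₁ = n₂ ∧ s₁ = s₂ := by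
  induction h₁ generalizing n₂ s₂ with
  | skip | setNat | setReal | sample | gauss => cases h₂; exact ⟨rfl, rfl⟩
  | seq _ _ ih ih' =>
    cases h₂ with
    | seq k k' =>
      obtain ⟨rfl, rfl⟩ := ih k
      obtain ⟨rfl, rfl⟩ := ih' k'
      exact ⟨rfl, rfl⟩
  | iteTrue hb _ ih =>
    cases h₂ with
    | iteTrue _ k => obtain ⟨rfl, rfl⟩ := ih k; exact ⟨rfl, rfl⟩
    | iteFalse hb' _ => exact absurd hb hb'
  | iteFalse hb _ ih =>
    cases h₂ with
    | iteTrue hb' _ => exact absurd hb' hb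
    | iteFalse _ k => obtain ⟨rfl, rfl⟩ := ih k; exact ⟨rfl, rfl⟩
  | loopTrue hb _ _ ih ih' =>
    cases h₂ with
    | loopTrue _ k k' =>
      obtain ⟨rfl, rfl⟩ := ih k
      obtain ⟨rfl, rfl⟩ := ih' k'
      exact ⟨rfl, rfl⟩
    | loopFalse hb' => exact absurd hb hb'
  | loopFalse hb =>
    cases h₂ with
    | loopTrue hb' _ _ => exact absurd hb' hb
    | loopFalse _ => exact ⟨rfl, rfl⟩

/-- The initial state: the dimension `d` is in the integer register `0`, the threshold `t` is in the
real cell with the empty address, and everything else is zero. -/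
def init (d : ℕ) (t : ℝ) : State where
  nat := fun i => if i = 0 then d else 0
  real := fun a => if a = [] then t else 0
  draws := 0

/-- The `i`-th output vector of a halted machine is stored in the cells `[i, 0], …, [i, d - 1]`. -/
def State.output (s : State) (d : ℕ) (i : Fin d) : EuclideanSpace ℝ (Fin d) :=
  WithLp.toLp 2 (fun j : Fin d => s.real [(i : ℕ), (j : ℕ)])

end RealRAM

/-- The vectors `z₁, …, z_d` are the columns of `A` up to an error `ε` in the Euclidean norm, after
a renumbering of the columns. -/
def RecoversColumns {d : ℕ} (z : Fin d → EuclideanSpace ℝ (Fin d))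
    (A : Matrix (Fin d) (Fin d) ℝ) (ε : ℝ) : Prop :=
  ∃ π : Equiv.Perm (Fin d), ∀ i, ‖z i - WithLp.toLp 2 (fun j => A j (π i))‖ ≤ ε

end

/-!
The network is, up to an exponentially small error, a sum of exponentials: since
`e^t u_t(a) ≈ e^a` and products of two or more sigmoids are of order `e^{-2t}`,
`G(x) := e^t f(x) = C₀ + ∑ cᵢ exp ⟨wᵢ, x⟩ + O(remainder)` with `C₀ = e^t c_∅ ≥ 0`
(`abs_exp_mul_network_sub_le`). The Gaussian moments of the remainder are `poly(d) e^{-t}`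
(`integral_tilt_mul_remainder_le`), which is smaller than any prescribed inverse power of `d` if
`t ≥ C log d` with a large `C`. By the Cameron–Martin formula,
`𝔼[exp(⟨u, x⟩ - ‖u‖² / 2) G(x)] ≈ C₀ + √e Φ(u)` with `Φ(u) = ∑ cᵢ exp ⟨u, wᵢ⟩`
(`integral_tilt_mul_rowLaplace`), so `Φ`, the Laplace transform of the measure `∑ cᵢ δ_{wᵢ}`, is
accessible up to an additive constant.

*Estimating `Φ`.* Weighting a sample by the inverse of its label turns means for the biased law into
Gaussian means. There are two difficulties. The inverse of the label is unbounded, so small labels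
have to be rejected. And `C₀` may be exponentially large, which would spoil the accuracy, so the
label `a` of the first sample is subtracted from all labels; then only the bounded number `C₀ - a`
is left of the constant term, and labels that are far from `a` are rejected too. The first label is
a good reference with high probability (`IsPerturbation.biasedLaw_reference_le`), a rejection has a
small influence on the means because it forces the remainder or the sum of exponentials to be
exceptional (`IsPerturbation.le_rejectionBound`), and Chebyshev's inequality gives the concentration
(`IsPerturbation.measure_empirical_le`). The samples are independent of the reference label and of
the random direction `v` below, so it suffices to argue for fixed values of these
(`measure_learnedLaplace_le`).

*Recovering the columns.* Finite differences of `Φ` at `0` and at a random direction `v`, in which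
the additive constant cancels, yield `∑ cᵢ wᵢ`, `A = ∑ cᵢ wᵢ wᵢᵀ` and `A' = ∑ cᵢ lᵢ wᵢ wᵢᵀ` with
`lᵢ = exp ⟨v, wᵢ⟩`. Then `A⁻¹ A' = W⁻¹ diag(l) W`, whose spectral projections are `Pᵢ = uᵢ wᵢᵀ` for
the columns `uᵢ` of `W⁻¹`. The numbers `lᵢ` are separated, because the rows are separated and `v` is
random (`measure_gap_le`). A machine without a routine for inverses or eigenvalues can
compute all this: the inverse by a Richardson iteration (`norm_richardson_sub_inv_le`), and the
projections as normalized values of the filter `(1 - (A⁻¹ A' - μ)² / 64) ^ N`, which suppresses all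
eigenvalues away from `μ`, where `μ` runs through a fine mesh and the hits are detected by the trace
(`exists_spectralProj_of_trace`, `trace_spectralFilter_ge`, `exists_perm_scan`). Finally
`Pᵢᵀ ∑ cⱼ wⱼ = cᵢ wᵢ` has the length `cᵢ`, so that `Pᵢ Pᵢᵀ ∑ cⱼ wⱼ / cᵢ^{3/2} = uᵢ / √cᵢ` is a
column of `(T W)⁻¹` (`norm_extract_sub_le`).

All parameters are powers of a number `L = d ^ q` that dominates the constants of the problem, so
that a program which does not depend on `d` can compute them. The program is `RealRAM.learner`; it
computes the function `learnedVectors` of the random draws (`RealRAM.learner_poly`), and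
`measure_learnedVectors_le` is the statement about that function.
-/

/-! ### Reasoning about programs -/

namespace RealRAM

/-- The class of an address: output cells (addresses of length two) form class `1`, and any other
cell belongs to the class named by the first entry of its address. Every table of numbers in the
program has a class of its own, so that a frame condition is a finite set of classes. -/
def cls (l : List ℕ) : ℕ := if l.length = 2 then 1 else l.headD 0

/-- `Frame M R s s'`: the states `s` and `s'` agree on all real cells whose class is not in `M` and
on all integer registers that are not in `R`. -/
structure Frame (M R : Finset ℕ) (s s' : State) : Prop where
  real : ∀ l, cls l ∉ M → s'.real l = s.real l
  nat : ∀ r, r ∉ R → s'.nat r = s.nat r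

theorem Frame.refl (M R : Finset ℕ) (s : State) : Frame M R s s := ⟨fun _ _ => rfl, fun _ _ => rfl⟩

theorem Frame.trans {M R : Finset ℕ} {s s' s'' : State} (h : Frame M R s s')
    (h' : Frame M R s' s'') : Frame M R s s'' :=
  ⟨fun l hl => (h'.real l hl).trans (h.real l hl), fun r hr => (h'.nat r hr).trans (h.nat r hr)⟩

theorem Frame.mono {M R M' R' : Finset ℕ} {s s' : State} (h : Frame M R s s')
    (hM : M ⊆ M') (hR : R ⊆ R') : Frame M' R' s s' :=
  ⟨fun l hl => h.real l fun hh => hl (hM hh), fun r hr => h.nat r fun hh => hr (hR hh)⟩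

theorem Frame.setReal {M R : Finset ℕ} {s s' : State} (h : Frame M R s s') {l : List ℕ}
    (hl : cls l ∈ M) (x : ℝ) (n : ℕ) : Frame M R s ⟨s'.nat, Function.update s'.real l x, n⟩ := by
  refine ⟨fun l' hl' => ?_, h.nat⟩
  have : l' ≠ l := by rintro rfl; exact hl' hl
  simpa [Function.update_of_ne this] using h.real l' hl'

theorem Frame.setNat {M R : Finset ℕ} {s s' : State} (h : Frame M R s s') {r : ℕ}
    (hr : r ∈ R) (x : ℕ) : Frame M R s ⟨Function.update s'.nat r x, s'.real, s'.draws⟩ := by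
  refine ⟨h.real, fun r' hr' => ?_⟩
  have : r' ≠ r := by rintro rfl; exact hr' hr
  simpa [Function.update_of_ne this] using h.nat r' hr'

section

variable {d : ℕ} {f : EuclideanSpace ℝ (Fin d) → ℝ} {ω : ℕ → EuclideanSpace ℝ (Fin d) × ℝ}

/-- The program `p` takes the state `s` to the state `s'` in at most `c` steps. -/
def Runs (f : EuclideanSpace ℝ (Fin d) → ℝ) (ω : ℕ → EuclideanSpace ℝ (Fin d) × ℝ)
    (p : Program) (s : State) (c : ℕ) (s' : State) : Prop :=
  ∃ n ≤ c, Exec f ω p s n s'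

theorem Runs.seq {p q : Program} {s s' s'' : State} {c c' : ℕ} (h : Runs f ω p s c s')
    (h' : Runs f ω q s' c' s'') : Runs f ω (.seq p q) s (c + c') s'' := by
  obtain ⟨n, hn, h⟩ := h
  obtain ⟨n', hn', h'⟩ := h'
  exact ⟨n + n', by omega, h.seq h'⟩

theorem Runs.mono {p : Program} {s s' : State} {c c' : ℕ} (h : Runs f ω p s c s') (hc : c ≤ c') :
    Runs f ω p s c' s' := by
  obtain ⟨n, hn, h⟩ := h
  exact ⟨n, hn.trans hc, h⟩

theorem Runs.setReal (a : List NExpr) (e : RExpr) (s : State) :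
    Runs f ω (.setReal a e) s 1
      ⟨s.nat, Function.update s.real (evalAddr s a) (e.eval s), s.draws⟩ :=
  ⟨1, le_rfl, .setReal a e s⟩

theorem Runs.setNat (i : ℕ) (e : NExpr) (s : State) :
    Runs f ω (.setNat i e) s 1 ⟨Function.update s.nat i (e.eval s), s.real, s.draws⟩ :=
  ⟨1, le_rfl, .setNat i e s⟩

/-- A loop whose test holds exactly before the first `N` rounds. -/
theorem loop_runs {b : BExpr} {p : Program} (N c : ℕ) (I : ℕ → State → Prop)
    (hb : ∀ j s, j ≤ N → I j s → (b.Holds s ↔ j < N))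
    (hp : ∀ j s, j < N → I j s → ∃ s', Runs f ω p s c s' ∧ I (j + 1) s') {s : State} (h0 : I 0 s) :
    ∃ s', Runs f ω (.loop b p) s (N * (c + 1) + 1) s' ∧ I N s' := by
  have key : ∀ m j s, j + m = N → I j s →
      ∃ s', Runs f ω (.loop b p) s (m * (c + 1) + 1) s' ∧ I N s' := by
    intro m
    induction m with
    | zero =>
      intro j s hj hI
      obtain rfl : j = N := by omega
      exact ⟨s, ⟨1, by omega, .loopFalse (by rw [hb j s le_rfl hI]; omega)⟩, hI⟩
    | succ m ih =>
      intro j s hj hI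
      obtain ⟨s', ⟨n, hn, hr⟩, hI'⟩ := hp j s (by omega) hI
      obtain ⟨s'', ⟨n', hn', hr'⟩, hI''⟩ := ih (j + 1) s' (by omega) hI'
      exact ⟨s'', ⟨n + n' + 1, by rw [Nat.succ_mul]; omega,
        .loopTrue ((hb j s (by omega) hI).2 (by omega)) hr hr'⟩, hI''⟩
  exact key N 0 s (by omega) h0

/-- `for r < b do p`. -/
def forLoop (r : ℕ) (b : NExpr) (p : Program) : Program :=
  .seq (.setNat r (.lit 0))
    (.loop (.natLt (.reg r) b) (.seq p (.setNat r (.add (.reg r) (.lit 1)))))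

theorem forLoop_runs {r : ℕ} {b : NExpr} {p : Program} (N c : ℕ) (I : ℕ → State → Prop)
    (hb : ∀ j s, I j s → s.nat r = j ∧ b.eval s = N)
    (hp : ∀ j s, j < N → I j s → ∃ s', Runs f ω p s c s' ∧ s'.nat r = j ∧
      I (j + 1) ⟨Function.update s'.nat r (j + 1), s'.real, s'.draws⟩)
    {s : State} (h0 : I 0 ⟨Function.update s.nat r 0, s.real, s.draws⟩) :
    ∃ s', Runs f ω (forLoop r b p) s (N * (c + 2) + 2) s' ∧ I N s' := by
  obtain ⟨s', hr, hI⟩ := loop_runs (f := f) (ω := ω) (b := .natLt (.reg r) b)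
    (p := .seq p (.setNat r (.add (.reg r) (.lit 1)))) N (c + 1) I
    (by
      intro j s _ hI
      obtain ⟨h1, h2⟩ := hb j s hI
      simp [BExpr.Holds, NExpr.eval, h1, h2])
    (by
      intro j s hj hI
      obtain ⟨s', h1, h2, h3⟩ := hp j s hj hI
      refine ⟨_, h1.seq (Runs.setNat _ _ _), ?_⟩
      simpa [NExpr.eval, h2] using h3) h0
  exact ⟨s', ((Runs.setNat r (.lit 0) s).seq hr).mono (by ring_nf; omega), hI⟩

/-- The address `[n, 0, 0]`. -/
def sc (n : ℕ) : List NExpr := [.lit n, .lit 0, .lit 0]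

/-- Tabulation: for all `i < n₁` and `j < n₂` (in the registers `1` and `2`), accumulate the sum of
the expression `e` over `r < d` (in the register `3`) in the cell `[2, 0, 0]`, and then store the
value of the expression `g` in the cell `[dst, i, j]`. -/
def tab (dst : ℕ) (n₁ n₂ : NExpr) (e g : RExpr) : Program :=
  forLoop 1 n₁ (forLoop 2 n₂
    (.seq (.seq (.setReal (sc 2) (.lit 0))
        (forLoop 3 (.reg 0) (.setReal (sc 2) (.add (.cell (sc 2)) e))))
      (.setReal [.lit dst, .reg 1, .reg 2] g)))

/-- A bound for the running time of a tabulation. -/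
def tabCost (d m₁ m₂ : ℕ) : ℕ := m₁ * (m₂ * (d * 3 + 4 + 2) + 2 + 2) + 2

/-- The expressions `e` and `g` of a tabulation may use everything but the destination: they are
given by functions of the initial state. -/
theorem tab_runs {dst : ℕ} (hdst : dst ≠ 2) {n₁ n₂ : NExpr} {e g : RExpr} (m₁ m₂ : ℕ) {s : State}
    (F : ℕ → ℕ → ℕ → ℝ) (G : ℕ → ℕ → ℝ → ℝ) (hd : s.nat 0 = d)
    (hn₁ : ∀ s' : State, s'.nat 0 = d → n₁.eval s' = m₁)
    (hn₂ : ∀ s' : State, s'.nat 0 = d → n₂.eval s' = m₂)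
    (he : ∀ s', Frame {2, dst} {1, 2, 3} s s' → e.eval s' = F (s'.nat 1) (s'.nat 2) (s'.nat 3))
    (hg : ∀ s', Frame {2, dst} {1, 2, 3} s s' →
      g.eval s' = G (s'.nat 1) (s'.nat 2) (s'.real [2, 0, 0])) :
    ∃ s', Runs f ω (tab dst n₁ n₂ e g) s (tabCost d m₁ m₂) s' ∧
      Frame {2, dst} {1, 2, 3} s s' ∧ s'.draws = s.draws ∧
      ∀ i < m₁, ∀ j < m₂, s'.real [dst, i, j] = G i j (∑ r ∈ Finset.range d, F i j r) := by
  have hcls : ∀ i j, cls [dst, i, j] ∈ ({2, dst} : Finset ℕ) := by simp [cls]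
  have hcls2 : cls [2, 0, 0] ∈ ({2, dst} : Finset ℕ) := by simp [cls]
  have h0 : ∀ s', Frame {2, dst} {1, 2, 3} s s' → s'.nat 0 = d := fun s' h =>
    (h.nat 0 (by decide)).trans hd
  -- the innermost sum
  have inner : ∀ s₁, Frame {2, dst} {1, 2, 3} s s₁ → ∃ s₂, Runs f ω
      (.seq (.seq (.setReal (sc 2) (.lit 0))
        (forLoop 3 (.reg 0) (.setReal (sc 2) (.add (.cell (sc 2)) e))))
      (.setReal [.lit dst, .reg 1, .reg 2] g)) s₁ (d * 3 + 4) s₂ ∧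
      Frame {2, dst} {1, 2, 3} s s₂ ∧ s₂.draws = s₁.draws ∧ s₂.nat 1 = s₁.nat 1 ∧
      s₂.nat 2 = s₁.nat 2 ∧
      s₂.real [dst, s₁.nat 1, s₁.nat 2] =
        G (s₁.nat 1) (s₁.nat 2) (∑ r ∈ Finset.range d, F (s₁.nat 1) (s₁.nat 2) r) ∧
      ∀ l, l ≠ [dst, s₁.nat 1, s₁.nat 2] → l ≠ [2, 0, 0] → s₂.real l = s₁.real l := by
    intro s₁ hF
    obtain ⟨s₂, hr, hF₂, hdr, hn1, hn2, hn3, hs, hl⟩ := forLoop_runs (f := f) (ω := ω) (r := 3)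
      (b := .reg 0) (p := .setReal (sc 2) (.add (.cell (sc 2)) e)) d 1
      (fun j s' => Frame {2, dst} {1, 2, 3} s s' ∧ s'.draws = s₁.draws ∧ s'.nat 1 = s₁.nat 1 ∧
        s'.nat 2 = s₁.nat 2 ∧ s'.nat 3 = j ∧
        s'.real [2, 0, 0] = ∑ r ∈ Finset.range j, F (s₁.nat 1) (s₁.nat 2) r ∧
        ∀ l, l ≠ [2, 0, 0] → s'.real l = s₁.real l)
      (fun j s' h => ⟨h.2.2.2.2.1, h0 s' h.1⟩)
      (by
        rintro j s' hj ⟨hF', hdr, hn1, hn2, hn3, hs, hl⟩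
        refine ⟨_, Runs.setReal _ _ _, hn3, (hF'.setReal (l := [2, 0, 0]) hcls2 _ _).setNat
          (by decide) _, hdr, by simpa using hn1, by simpa using hn2, by simp, ?_, ?_⟩
        · simp [evalAddr, sc, NExpr.eval, RExpr.eval, he s' hF', hs, hn1, hn2, hn3,
            Finset.sum_range_succ]
        · intro l hl'
          simp [evalAddr, sc, NExpr.eval, Function.update_of_ne hl', hl l hl'])
      (s := ⟨s₁.nat, Function.update s₁.real [2, 0, 0] 0, s₁.draws⟩)
      ⟨(hF.setReal hcls2 _ _).setNat (by decide) _, rfl, by simp, by simp, by simp, by simp,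
        fun l hl => by simp [Function.update_of_ne hl]⟩
    have hr0 := Runs.setReal (f := f) (ω := ω) (sc 2) (.lit 0) s₁
    simp only [evalAddr, sc, List.map_cons, NExpr.eval, List.map_nil, RExpr.eval,
      Rat.cast_zero] at hr0
    refine ⟨_, ((hr0.seq hr).seq (Runs.setReal _ _ _)).mono (by omega), ?_, hdr, hn1, hn2, ?_, ?_⟩
    · exact hF₂.setReal (by simp [evalAddr, NExpr.eval, cls]) _ _
    · simp [evalAddr, NExpr.eval, hn1, hn2, hg s₂ hF₂, hs]
    · intro l h1 h2
      simp only [evalAddr, NExpr.eval, List.map_cons, List.map_nil, hn1, hn2]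
      rw [Function.update_of_ne h1, hl l h2]
  -- the middle loop
  have middle : ∀ s₁, Frame {2, dst} {1, 2, 3} s s₁ → ∃ s₂, Runs f ω
      (forLoop 2 n₂ (.seq (.seq (.setReal (sc 2) (.lit 0))
        (forLoop 3 (.reg 0) (.setReal (sc 2) (.add (.cell (sc 2)) e))))
      (.setReal [.lit dst, .reg 1, .reg 2] g))) s₁ (m₂ * (d * 3 + 4 + 2) + 2) s₂ ∧
      Frame {2, dst} {1, 2, 3} s s₂ ∧ s₂.draws = s₁.draws ∧ s₂.nat 1 = s₁.nat 1 ∧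
      (∀ j < m₂, s₂.real [dst, s₁.nat 1, j] =
        G (s₁.nat 1) j (∑ r ∈ Finset.range d, F (s₁.nat 1) j r)) ∧
      ∀ i j, i < s₁.nat 1 → s₂.real [dst, i, j] = s₁.real [dst, i, j] := by
    intro s₁ hF
    obtain ⟨s₂, hr, hF₂, hdr, hn1, hn2, hs, hl⟩ := forLoop_runs (f := f) (ω := ω) (r := 2)
      (b := n₂) (p := (.seq (.seq (.setReal (sc 2) (.lit 0))
        (forLoop 3 (.reg 0) (.setReal (sc 2) (.add (.cell (sc 2)) e))))
      (.setReal [.lit dst, .reg 1, .reg 2] g))) m₂ (d * 3 + 4)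
      (fun k s' => Frame {2, dst} {1, 2, 3} s s' ∧ s'.draws = s₁.draws ∧ s'.nat 1 = s₁.nat 1 ∧
        s'.nat 2 = k ∧
        (∀ j < k, s'.real [dst, s₁.nat 1, j] =
          G (s₁.nat 1) j (∑ r ∈ Finset.range d, F (s₁.nat 1) j r)) ∧
        ∀ i j, i < s₁.nat 1 →
          s'.real [dst, i, j] = s₁.real [dst, i, j])
      (fun j s' h => ⟨h.2.2.2.1, hn₂ s' (h0 s' h.1)⟩)
      (by
        rintro k s' hk ⟨hF', hdr, hn1, hn2, hs, hl⟩
        obtain ⟨s₃, hr, hF₃, hdr₃, h1, h2, hs₃, hl₃⟩ := inner s' hF'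
        refine ⟨s₃, hr, by omega, hF₃.setNat (by decide) _, hdr₃.trans hdr,
          by simpa [h1] using hn1, by simp, ?_, ?_⟩
        · intro j hj
          rcases Nat.lt_succ_iff_lt_or_eq.1 hj with hj | rfl
          · have := hl₃ [dst, s₁.nat 1, j] (by simp [hn1, hn2, hj.ne]) (by simp [hdst])
            simpa [this] using hs j hj
          · simpa [hn1, hn2] using hs₃
        · intro i j hi
          have := hl₃ [dst, i, j] (by simp [hn1, hi.ne]) (by simp [hdst])
          simpa [this] using hl i j hi)
      ⟨hF.setNat (by decide) _, rfl, by simp, by simp, by simp, by simp⟩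
    exact ⟨s₂, hr, hF₂, hdr, hn1, hs, hl⟩
  obtain ⟨s₂, hr, hF₂, hdr, hn1, hs⟩ := forLoop_runs (f := f) (ω := ω) (r := 1)
    (b := n₁) (p := forLoop 2 n₂ (.seq (.seq (.setReal (sc 2) (.lit 0))
        (forLoop 3 (.reg 0) (.setReal (sc 2) (.add (.cell (sc 2)) e))))
      (.setReal [.lit dst, .reg 1, .reg 2] g))) m₁ (m₂ * (d * 3 + 4 + 2) + 2)
    (fun k s' => Frame {2, dst} {1, 2, 3} s s' ∧ s'.draws = s.draws ∧ s'.nat 1 = k ∧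
      ∀ i < k, ∀ j < m₂, s'.real [dst, i, j] = G i j (∑ r ∈ Finset.range d, F i j r))
    (fun j s' h => ⟨h.2.2.1, hn₁ s' (h0 s' h.1)⟩)
    (by
      rintro k s' hk ⟨hF', hdr, hn1, hs⟩
      obtain ⟨s₃, hr, hF₃, hdr₃, h1, hs₃, hl₃⟩ := middle s' hF'
      refine ⟨s₃, hr, by omega, hF₃.setNat (by decide) _, hdr₃.trans hdr, by simp, ?_⟩
      intro i hi j hj
      rcases Nat.lt_succ_iff_lt_or_eq.1 hi with hi | rfl
      · simpa [hl₃ i j (by omega)] using hs i hi j hj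
      · simpa [hn1] using hs₃ j hj)
    (s := s) ⟨(Frame.refl _ _ s).setNat (by decide) _, rfl, by simp, by simp⟩
  exact ⟨s₂, hr, hF₂, hdr, hs⟩

/-- Tabulation of a single number, in the cell `[dst, 0, 0]`. -/
def setScalar (dst : ℕ) (g : RExpr) : Program := .setReal (sc dst) g

theorem setScalar_runs {dst : ℕ} {g : RExpr} {s : State} :
    ∃ s', Runs f ω (setScalar dst g) s 1 s' ∧ Frame {dst} ∅ s s' ∧ s'.draws = s.draws ∧
      s'.real [dst, 0, 0] = g.eval s := by
  refine ⟨_, Runs.setReal _ _ s, (Frame.refl _ _ s).setReal ?_ _ _, rfl, ?_⟩ <;>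
    simp [evalAddr, sc, NExpr.eval, cls]

/-- The expression `d ^ n`. -/
def dpow : ℕ → RExpr
  | 0 => .lit 1
  | n + 1 => .mul (dpow n) (.ofNat (.reg 0))

theorem dpow_eval {s : State} {d : ℕ} (hd : s.nat 0 = d) (n : ℕ) :
    (dpow n).eval s = (d : ℝ) ^ n := by
  induction n with
  | zero => simp [dpow, RExpr.eval]
  | succ n ih => simp [dpow, RExpr.eval, NExpr.eval, ih, hd, pow_succ]

/-- Repeat `p` for `a * d ^ n` rounds, counted in the real cell `[ctr, 0, 0]`. -/
def rep (ctr a n : ℕ) (p : Program) : Program :=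
  .seq (setScalar ctr (.lit 0))
    (.loop (.realLt (.cell (sc ctr)) (.mul (.lit a) (dpow n)))
      (.seq p (setScalar ctr (.add (.cell (sc ctr)) (.lit 1)))))

theorem rep_runs {ctr a n : ℕ} {p : Program} (c : ℕ) (I : ℕ → State → Prop)
    (hI : ∀ j s x, I j s → I j ⟨s.nat, Function.update s.real [ctr, 0, 0] x, s.draws⟩)
    (hd : ∀ j s, I j s → s.nat 0 = d)
    (hp : ∀ j s, j < a * d ^ n → I j s →
      ∃ s', Runs f ω p s c s' ∧ s'.real [ctr, 0, 0] = s.real [ctr, 0, 0] ∧ I (j + 1) s')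
    {s : State} (h0 : I 0 s) :
    ∃ s', Runs f ω (rep ctr a n p) s (a * d ^ n * (c + 2) + 2) s' ∧ I (a * d ^ n) s' := by
  have hset : ∀ (e : RExpr) (s : State), Runs f ω (setScalar ctr e) s 1
      ⟨s.nat, Function.update s.real [ctr, 0, 0] (e.eval s), s.draws⟩ := by
    intro e s
    exact Runs.setReal (f := f) (ω := ω) (sc ctr) e s
  obtain ⟨s', hr, h1, h2⟩ := loop_runs (f := f) (ω := ω)
    (b := .realLt (.cell (sc ctr)) (.mul (.lit a) (dpow n)))
    (p := .seq p (setScalar ctr (.add (.cell (sc ctr)) (.lit 1)))) (a * d ^ n) (c + 1)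
    (fun j s => s.real [ctr, 0, 0] = (j : ℝ) ∧ I j s)
    (by
      rintro j s _ ⟨hc, h⟩
      have : s.real [ctr, 0, 0] < (a : ℝ) * (d : ℝ) ^ n ↔ j < a * d ^ n := by
        rw [hc]; exact_mod_cast Iff.rfl
      simpa [BExpr.Holds, RExpr.eval, dpow_eval (hd j s h), sc, evalAddr, NExpr.eval] using this)
    (by
      rintro j s hj ⟨hc, h⟩
      obtain ⟨s', hr, hc', h'⟩ := hp j s hj h
      refine ⟨_, hr.seq (hset _ _), ?_, hI _ _ _ h'⟩
      simp [RExpr.eval, sc, evalAddr, NExpr.eval, hc', hc])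
    (s := ⟨s.nat, Function.update s.real [ctr, 0, 0] 0, s.draws⟩) ⟨by simp, hI _ _ _ h0⟩
  have hr0 := hset (.lit 0) s
  simp only [RExpr.eval, Rat.cast_zero] at hr0
  exact ⟨s', (hr0.seq hr).mono (by ring_nf; omega), h2⟩

theorem foldl_update_of_notMem {r : List ℕ → ℝ} {x : EuclideanSpace ℝ (Fin d)} {a l : List ℕ}
    (L : List (Fin d)) (h : ∀ j ∈ L, l ≠ a ++ [(j : ℕ)]) :
    L.foldl (fun r (j : Fin d) => Function.update r (a ++ [(j : ℕ)]) (x j)) r l = r l := by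
  induction L generalizing r with
  | nil => rfl
  | cons i L ih =>
    rw [List.foldl_cons, ih fun j hj => h j (List.mem_cons_of_mem _ hj),
      Function.update_of_ne (h i List.mem_cons_self)]

theorem foldl_update_of_mem {r : List ℕ → ℝ} {x : EuclideanSpace ℝ (Fin d)} {a : List ℕ}
    (L : List (Fin d)) {j : Fin d} (hj : j ∈ L) :
    L.foldl (fun r (j : Fin d) => Function.update r (a ++ [(j : ℕ)]) (x j)) r (a ++ [(j : ℕ)])
      = x j := by
  induction L generalizing r with
  | nil => simp at hj
  | cons i L ih =>
    rw [List.foldl_cons]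
    by_cases h : j ∈ L
    · exact ih h
    · obtain rfl : j = i := by simpa [h] using hj
      rw [foldl_update_of_notMem, Function.update_self]
      intro i hi hji
      obtain rfl : j = i := by simpa [Fin.ext_iff] using hji
      exact h hi

/-- An oracle call that stores the label in `[dst, 0, 0]` and the point in `[dst, 0, 0, j]`. -/
theorem sample_runs (dst : ℕ) (s : State) :
    ∃ s', Runs f ω (.sample (sc dst)) s (d + 1) s' ∧ Frame {dst} ∅ s s' ∧
      s'.draws = s.draws + 1 ∧ s'.real [dst, 0, 0] = f (ω s.draws).1 ∧
      ∀ j : Fin d, s'.real [dst, 0, 0, j] = (ω s.draws).1 j := by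
  have ha : evalAddr s (sc dst) = [dst, 0, 0] := by simp [evalAddr, sc, NExpr.eval]
  refine ⟨_, ⟨_, le_rfl, .sample (sc dst) s⟩, ⟨fun l hl => ?_, fun _ _ => rfl⟩, rfl, ?_, ?_⟩
  · simp only [State.storeSample, ha]
    rw [foldl_update_of_notMem, Function.update_of_ne]
    · rintro rfl; simp [cls] at hl
    · rintro j - rfl; simp [cls] at hl
  · simp only [State.storeSample, ha]
    rw [foldl_update_of_notMem, Function.update_self]
    intro j _; simp
  · intro j
    simp only [State.storeSample, ha]
    exact foldl_update_of_mem (a := [dst, 0, 0]) _ (List.mem_finRange j)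

/-- Draw `d` internal random numbers into the cells `[dst, j, 0]`. -/
def gaussLoop (dst : ℕ) : Program := forLoop 1 (.reg 0) (.gauss [.lit dst, .reg 1, .lit 0])

theorem gaussLoop_runs (dst : ℕ) {s : State} (hd : s.nat 0 = d) :
    ∃ s', Runs f ω (gaussLoop dst) s (d * 3 + 2) s' ∧ Frame {dst} {1} s s' ∧
      s'.draws = s.draws + d ∧ ∀ j < d, s'.real [dst, j, 0] = (ω (s.draws + j)).2 := by
  obtain ⟨s', hr, hF, hdr, -, hs⟩ := forLoop_runs (f := f) (ω := ω) (r := 1) (b := .reg 0)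
    (p := .gauss [.lit dst, .reg 1, .lit 0]) d 1
    (fun k s' => Frame {dst} {1} s s' ∧ s'.draws = s.draws + k ∧ s'.nat 1 = k ∧
      ∀ j < k, s'.real [dst, j, 0] = (ω (s.draws + j)).2)
    (fun j s' h => ⟨h.2.2.1, (h.1.nat 0 (by decide)).trans hd⟩)
    (by
      rintro k s' hk ⟨hF, hdr, hn, hs⟩
      refine ⟨_, ⟨_, le_rfl, .gauss _ s'⟩, hn, ?_, by simp [hdr, add_assoc], by simp, ?_⟩
      · exact (hF.setReal (by simp [evalAddr, NExpr.eval, cls]) _ _).setNat (by decide) _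
      · intro j hj
        rcases Nat.lt_succ_iff_lt_or_eq.1 hj with hj | rfl
        · simpa [evalAddr, NExpr.eval, hn, hj.ne] using hs j hj
        · simp [evalAddr, NExpr.eval, hn, hdr])
    (s := s) ⟨(Frame.refl _ _ s).setNat (by decide) _, rfl, by simp, by simp⟩
  exact ⟨s', hr, hF, hdr, hs⟩

end
end RealRAM

noncomputable section

/-! ### The learning algorithm as a function of the random draws -/

/-- The exponents of the dimension that fix the parameters of the learning algorithm. -/
structure Exponents where
  /-- The random direction is a Gaussian vector divided by `d ^ dir`. -/
  dir : ℕ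
  /-- The step of the finite differences is `1 / d ^ step`. -/
  step : ℕ
  /-- A label is rejected if it differs from the reference label by more than `d ^ clip`. -/
  clip : ℕ
  /-- A label is rejected if it is smaller than the reference label divided by `d ^ low`. -/
  low : ℕ
  /-- The number of samples is `d ^ samples`. -/
  samples : ℕ
  /-- The relaxation parameter of the Richardson iteration is `1 / d ^ relax`. -/
  relax : ℕ
  /-- The number of rounds of the Richardson iteration is `d ^ rounds`. -/
  rounds : ℕ
  /-- The spectrum is scanned with mesh `1 / d ^ mesh`. -/
  mesh : ℕ
  /-- After an output, the scan skips an interval of length `1 / d ^ skip`. -/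
  skip : ℕ
  /-- The spectral filter is a power with exponent `d ^ power`. -/
  power : ℕ

section Model

variable {d : ℕ}

/-- The vector `σ v + h (e_a + e_b)`, where `e_a` is a standard basis vector for `a < d` and is zero
for `a = d`. -/
def testPoint (h σ : ℝ) (v : EuclideanSpace ℝ (Fin d)) (a b : ℕ) : EuclideanSpace ℝ (Fin d) :=
  WithLp.toLp 2 fun j : Fin d =>
    σ * v j + (if a = j then 1 else 0) * h + (if b = j then 1 else 0) * h

/-- The Cameron–Martin density `exp (⟨u, x⟩ - ‖u‖² / 2)`. -/
def tilt (u x : EuclideanSpace ℝ (Fin d)) : ℝ :=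
  Real.exp (∑ j, (u j * x j - u j * u j / 2))

/-- The weight of a sample with label `y` relative to a reference label `a`: it is `1 / y`, but
labels that are too small or too far from the reference are rejected. -/
def weight (δ A a y : ℝ) : ℝ := if y < δ * a ∨ a + A < y ∨ y < a - A then 0 else 1 / y

/-- The empirical Laplace transform at the point `u`, from labelled samples and a reference label
`a`: a ratio of weighted sums, in which the unknown normalization of the biased law cancels. The
label `a` is subtracted from all labels because their constant term may be huge. -/
def empirical (δ A a : ℝ) (N : ℕ) (x : ℕ → EuclideanSpace ℝ (Fin d)) (y : ℕ → ℝ)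
    (u : EuclideanSpace ℝ (Fin d)) : ℝ :=
  (∑ n ∈ Finset.range N, weight δ A a (y n) * (y n - a) * tilt u (x n)) /
    ∑ n ∈ Finset.range N, weight δ A a (y n)

/-- First differences at zero of a function `Φ` of the test points. The division by `√e` removes the
factor `exp (‖wᵢ‖² / 2)` of the Gaussian moments. -/
def firstDiff (h : ℝ) (Φ : EuclideanSpace ℝ (Fin d) → ℝ) : Fin d → ℝ := fun a =>
  (Φ (testPoint h 0 0 a d) - Φ (testPoint h 0 0 d d)) / h / Real.exp (1 / 2)

/-- Second differences at `v` of a function `Φ` of the test points. -/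
def secondDiff (h : ℝ) (v : EuclideanSpace ℝ (Fin d)) (Φ : EuclideanSpace ℝ (Fin d) → ℝ) :
    Matrix (Fin d) (Fin d) ℝ := fun a b =>
  (Φ (testPoint h 1 v a b) - Φ (testPoint h 1 v a d) - Φ (testPoint h 1 v d b) +
    Φ (testPoint h 1 v d d)) / h ^ 2 / Real.exp (1 / 2)

/-- The iterates of the Richardson iteration for the inverse of `A`. -/
def richardson (α : ℝ) (A : Matrix (Fin d) (Fin d) ℝ) : ℕ → Matrix (Fin d) (Fin d) ℝ
  | 0 => 0
  | n + 1 => richardson α A n + α • (1 - A * richardson α A n)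

/-- A power of a polynomial in `B` that suppresses the eigenvalues of `B` away from `μ`. The factor
`1 / 64` keeps the eigenvalues of the base in `[0, 1]`, as long as those of `B` have distance at
most `8` from `μ`. -/
def spectralFilter (N : ℕ) (B : Matrix (Fin d) (Fin d) ℝ) (μ : ℝ) : Matrix (Fin d) (Fin d) ℝ :=
  (1 - (1 / 64 : ℝ) • ((B - μ • 1) * (B - μ • 1))) ^ N

/-- For an approximate multiple `Q` of a rank-one projection `P`: the vector `P Pᵀ m` divided by the
`3/2`-th power of the length of `Pᵀ m`. The multiple is determined by the trace, as `P` has trace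
one. -/
def extract (Q : Matrix (Fin d) (Fin d) ℝ) (m : Fin d → ℝ) : Fin d → ℝ :=
  let p : Fin d → ℝ := fun a => (∑ b, Q b a * m b) / Q.trace
  let r : ℝ := √(∑ a, p a * p a)
  fun a => (∑ b, Q a b * p b) / Q.trace / (r * √r)

/-- The state of a scan: the number of outputs so far, the end of the skipped interval, and the
outputs. -/
structure Scan (d : ℕ) where
  count : ℕ
  next : ℝ
  out : ℕ → Fin d → ℝ

/-- A scan of the points `j * mesh`: whenever the trace of `Q (j * mesh)` is at least `1/4` and the
point is not skipped, output `z (Q (j * mesh))` and skip an interval of length `skip`. -/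
def scan (mesh skip : ℝ) (Q : ℝ → Matrix (Fin d) (Fin d) ℝ)
    (z : Matrix (Fin d) (Fin d) ℝ → Fin d → ℝ) : ℕ → Scan d
  | 0 => ⟨0, 0, 0⟩
  | j + 1 =>
    let S := scan mesh skip Q z j
    if 1 / 4 ≤ (Q (j * mesh)).trace ∧ S.next ≤ j * mesh then
      ⟨S.count + 1, j * mesh + skip, Function.update S.out S.count (z (Q (j * mesh)))⟩
    else S

variable (p : Exponents) (f : EuclideanSpace ℝ (Fin d) → ℝ) (t : ℝ)
  (ω : ℕ → EuclideanSpace ℝ (Fin d) × ℝ)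

/-- The reference label. -/
def refLabel : ℝ := Real.exp t * f (ω 0).1

/-- The random direction. -/
def direction : EuclideanSpace ℝ (Fin d) :=
  WithLp.toLp 2 fun j : Fin d => (ω (1 + j)).2 / (d : ℝ) ^ p.dir

/-- The empirical Laplace transform that the algorithm computes. -/
def learnedLaplace : EuclideanSpace ℝ (Fin d) → ℝ :=
  empirical (1 / (d : ℝ) ^ p.low) ((d : ℝ) ^ p.clip) (refLabel f t ω) (d ^ p.samples)
    (fun n => (ω (1 + d + n)).1) fun n => Real.exp t * f (ω (1 + d + n)).1

/-- The scan of the algorithm, as a function of the estimated moments. -/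
def recoverScan (m : Fin d → ℝ) (A A' : Matrix (Fin d) (Fin d) ℝ) : Scan d :=
  scan (1 / (d : ℝ) ^ p.mesh) (1 / (d : ℝ) ^ p.skip)
    (spectralFilter (d ^ p.power) (richardson (1 / (d : ℝ) ^ p.relax) A (d ^ p.rounds) * A'))
    (fun Q => extract Q m) (8 * d ^ p.mesh)

/-- The outputs of the algorithm. -/
def learnedVectors : ℕ → Fin d → ℝ :=
  (recoverScan p (firstDiff (1 / (d : ℝ) ^ p.step) (learnedLaplace p f t ω))
    (secondDiff (1 / (d : ℝ) ^ p.step) 0 (learnedLaplace p f t ω))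
    (secondDiff (1 / (d : ℝ) ^ p.step) (direction p ω) (learnedLaplace p f t ω))).out

end Model

namespace RealRAM

/-! ### The program -/

-- Register `0` holds `d`, the registers `1`, `2`, `3` are loop indices, and register `4` counts the
-- outputs. The real cells are tables with the following numbers:
-- `2` running sum; `3` current sample; `4` Gaussian numbers; `5` direction; `6` `e^t`;
-- `7` reference label; `8` current label; `9` its weight; `10` sum of the weights;
-- `11`, `12` numerators of the empirical transform at the test points near `0` and near `v`;
-- `14` first differences; `15`, `16` second differences at `0` and at `v`;
-- `17` Richardson iterate; `19` the matrix to be diagonalized; `20`, `21` base of the filter;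
-- `22` filter; `24` its trace; `25` current point of the scan; `26` end of the skipped interval;
-- `27`, `28`, `29` the vectors and the length in the extraction; `30`, …, `33` loop counters;
-- `13`, `18`, `23` buffers, since a tabulation must not read the table that it writes.

/-- The cell `[n, i, j]` for the contents `i`, `j` of two registers. -/
def mat (n i j : ℕ) : RExpr := .cell [.lit n, .reg i, .reg j]

/-- The number in the cell `[n, 0, 0]`. -/
def num (n : ℕ) : RExpr := .cell (sc n)

/-- The indicator of the equality of two integers. -/
def ind (a b : NExpr) : RExpr := .ofNat (.sub (.lit 1) (.add (.sub a b) (.sub b a)))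

theorem ind_eval (s : State) (a b : ℕ) :
    (ind (.reg a) (.reg b)).eval s = if s.nat a = s.nat b then 1 else 0 := by
  simp only [ind, RExpr.eval, NExpr.eval]
  split_ifs with h
  · simp [h]
  · rw [Nat.sub_eq_zero_of_le (by omega)]; simp

/-- The coordinate with number in register `3` of a test point. -/
def pointExpr (p : Exponents) (σ : ℕ) : RExpr :=
  .add (.add (.mul (.lit σ) (.cell [.lit 5, .reg 3, .lit 0]))
    (.mul (ind (.reg 1) (.reg 3)) (.div (.lit 1) (dpow p.step))))
    (.mul (ind (.reg 2) (.reg 3)) (.div (.lit 1) (dpow p.step)))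

/-- The summand of the exponent of a tilt. -/
def tiltExpr (p : Exponents) (σ : ℕ) : RExpr :=
  .sub (.mul (pointExpr p σ) (.cell [.lit 3, .lit 0, .lit 0, .reg 3]))
    (.div (.mul (pointExpr p σ) (pointExpr p σ)) (.lit 2))

/-- Draw the reference label and the random direction. -/
def setupProg (p : Exponents) : Program :=
  .seq (setScalar 6 (.exp (.cell [])))
  (.seq (.sample (sc 3))
  (.seq (setScalar 7 (.mul (num 6) (num 3)))
  (.seq (gaussLoop 4)
    (tab 5 (.reg 0) (.lit 1) (.lit 0) (.div (mat 4 1 2) (dpow p.dir))))))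

/-- Add the contribution of the current sample to the numerators with base point `σ v`. -/
def accumulate (p : Exponents) (dst σ : ℕ) : Program :=
  .seq (tab 13 (.add (.reg 0) (.lit 1)) (.add (.reg 0) (.lit 1)) (tiltExpr p σ)
      (.add (mat dst 1 2) (.mul (.mul (num 9) (.sub (num 8) (num 7))) (.exp (num 2)))))
    (tab dst (.add (.reg 0) (.lit 1)) (.add (.reg 0) (.lit 1)) (.lit 0) (mat 13 1 2))

/-- The test whether a label is rejected; a disjunction, written by means of negations. -/
def rejectTest (p : Exponents) : BExpr :=
  .not (.and (.not (.realLt (num 8) (.mul (.div (.lit 1) (dpow p.low)) (num 7))))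
    (.and (.not (.realLt (.add (num 7) (dpow p.clip)) (num 8)))
      (.not (.realLt (num 8) (.sub (num 7) (dpow p.clip))))))

/-- Process one sample. -/
def sampleProg (p : Exponents) : Program :=
  .seq (.sample (sc 3))
  (.seq (setScalar 8 (.mul (num 6) (num 3)))
  (.seq (.ite (rejectTest p) (setScalar 9 (.lit 0)) (setScalar 9 (.div (.lit 1) (num 8))))
  (.seq (setScalar 10 (.add (num 10) (num 9)))
  (.seq (accumulate p 11 0) (accumulate p 12 1)))))

/-- The value of the empirical transform at the test point with the numbers `a`, `b`. The number
`d`, which is in register `0`, stands for the absence of a shift. -/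
def phiExpr (tag : ℕ) (a b : NExpr) : RExpr := .div (.cell [.lit tag, a, b]) (num 10)

/-- A second difference. -/
def diffExpr (p : Exponents) (tag : ℕ) : RExpr :=
  .div (.div (.add (.sub (.sub (phiExpr tag (.reg 1) (.reg 2)) (phiExpr tag (.reg 1) (.reg 0)))
      (phiExpr tag (.reg 0) (.reg 2))) (phiExpr tag (.reg 0) (.reg 0)))
    (.mul (.div (.lit 1) (dpow p.step)) (.div (.lit 1) (dpow p.step))))
    (.exp (.div (.lit 1) (.lit 2)))

/-- Compute the finite differences. -/
def diffProg (p : Exponents) : Program :=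
  .seq (tab 14 (.reg 0) (.lit 1) (.lit 0)
    (.div (.div (.sub (phiExpr 11 (.reg 1) (.reg 0)) (phiExpr 11 (.reg 0) (.reg 0)))
      (.div (.lit 1) (dpow p.step))) (.exp (.div (.lit 1) (.lit 2)))))
  (.seq (tab 15 (.reg 0) (.reg 0) (.lit 0) (diffExpr p 11))
    (tab 16 (.reg 0) (.reg 0) (.lit 0) (diffExpr p 12)))

/-- The Richardson iteration, followed by a multiplication. -/
def richardsonProg (p : Exponents) : Program :=
  .seq (rep 31 1 p.rounds
    (.seq (tab 18 (.reg 0) (.reg 0) (.mul (mat 15 1 3) (mat 17 3 2))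
        (.add (mat 17 1 2) (.mul (.div (.lit 1) (dpow p.relax))
          (.sub (ind (.reg 1) (.reg 2)) (num 2)))))
      (tab 17 (.reg 0) (.reg 0) (.lit 0) (mat 18 1 2))))
  (tab 19 (.reg 0) (.reg 0) (.mul (mat 17 1 3) (mat 16 3 2)) (num 2))

/-- Compute the spectral filter at the point in cell `[25, 0, 0]`, and its trace. -/
def filterProg (p : Exponents) : Program :=
  .seq (tab 20 (.reg 0) (.reg 0) (.lit 0)
    (.sub (mat 19 1 2) (.mul (num 25) (ind (.reg 1) (.reg 2)))))
  (.seq (tab 21 (.reg 0) (.reg 0) (.mul (mat 20 1 3) (mat 20 3 2))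
    (.sub (ind (.reg 1) (.reg 2)) (.mul (.div (.lit 1) (.lit 64)) (num 2))))
  (.seq (tab 22 (.reg 0) (.reg 0) (.lit 0) (ind (.reg 1) (.reg 2)))
  (.seq (rep 33 1 p.power
    (.seq (tab 23 (.reg 0) (.reg 0) (.mul (mat 22 1 3) (mat 21 3 2)) (num 2))
      (tab 22 (.reg 0) (.reg 0) (.lit 0) (mat 23 1 2))))
    (tab 24 (.lit 1) (.lit 1) (mat 22 3 3) (num 2)))))

/-- Extract an output vector from the filter. -/
def extractProg : Program :=
  .seq (tab 27 (.reg 0) (.lit 1) (.mul (mat 22 3 1) (mat 14 3 2)) (.div (num 2) (num 24)))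
  (.seq (tab 28 (.lit 1) (.lit 1) (.mul (mat 27 3 2) (mat 27 3 2)) (.sqrt (num 2)))
  (.seq (tab 29 (.reg 0) (.lit 1) (.mul (mat 22 1 3) (mat 27 3 2))
    (.div (.div (num 2) (num 24)) (.mul (num 28) (.sqrt (num 28)))))
    (forLoop 1 (.reg 0) (.setReal [.reg 4, .reg 1] (.cell [.lit 29, .reg 1, .lit 0])))))

/-- One step of the scan. -/
def scanProg (p : Exponents) : Program :=
  .seq (filterProg p)
  (.seq (.ite (.and (.not (.realLt (num 24) (.div (.lit 1) (.lit 4))))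
      (.not (.realLt (num 25) (num 26))))
    (.seq extractProg
      (.seq (.setNat 4 (.add (.reg 4) (.lit 1)))
        (setScalar 26 (.add (num 25) (.div (.lit 1) (dpow p.skip))))))
    .skip)
  (setScalar 25 (.add (num 25) (.div (.lit 1) (dpow p.mesh)))))

/-- The learning algorithm. -/
def learner (p : Exponents) : Program :=
  .seq (setupProg p)
  (.seq (rep 30 1 p.samples (sampleProg p))
  (.seq (diffProg p)
  (.seq (richardsonProg p) (rep 32 8 p.mesh (scanProg p)))))

/-! ### Correctness of the program -/

section

variable {d : ℕ} {p : Exponents} {f : EuclideanSpace ℝ (Fin d) → ℝ} {t : ℝ}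
  {ω : ℕ → EuclideanSpace ℝ (Fin d) × ℝ}

theorem setupProg_runs : ∃ s, Runs f ω (setupProg p) (init d t) (tabCost d d 1 + 4 * d + 10) s ∧
    Frame {2, 3, 4, 5, 6, 7} {1, 2, 3} (init d t) s ∧ s.draws = 1 + d ∧
    s.real [6, 0, 0] = Real.exp t ∧ s.real [7, 0, 0] = refLabel f t ω ∧
    ∀ j : Fin d, s.real [5, j, 0] = direction p ω j := by
  obtain ⟨s₁, r₁, F₁, d₁, h₁⟩ := setScalar_runs (f := f) (ω := ω) (dst := 6) (g := .exp (.cell []))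
    (s := init d t)
  obtain ⟨s₂, r₂, F₂, d₂, h₂, -⟩ := sample_runs (f := f) (ω := ω) 3 s₁
  obtain ⟨s₃, r₃, F₃, d₃, h₃⟩ := setScalar_runs (f := f) (ω := ω) (dst := 7)
    (g := .mul (num 6) (num 3)) (s := s₂)
  have hn₃ : s₃.nat 0 = d := by
    rw [F₃.nat 0 (by decide), F₂.nat 0 (by decide), F₁.nat 0 (by decide)]; simp [init]
  obtain ⟨s₄, r₄, F₄, d₄, h₄⟩ := gaussLoop_runs (f := f) (ω := ω) 4 hn₃
  have hn₄ : s₄.nat 0 = d := (F₄.nat 0 (by decide)).trans hn₃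
  obtain ⟨s₅, r₅, F₅, d₅, h₅⟩ := tab_runs (f := f) (ω := ω) (dst := 5) (by decide)
    (n₁ := .reg 0) (n₂ := .lit 1) (e := .lit 0) (g := .div (mat 4 1 2) (dpow p.dir)) d 1
    (fun _ _ _ => 0) (fun i j _ => s₄.real [4, i, j] / (d : ℝ) ^ p.dir) hn₄
    (fun s' h => h) (fun _ _ => rfl) (fun _ _ => by simp [RExpr.eval])
    (fun s' hF => by
      simp [RExpr.eval, dpow_eval ((hF.nat 0 (by decide)).trans hn₄), mat, evalAddr, NExpr.eval,
        hF.real, cls])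
  have hi : (init d t).draws = 0 := rfl
  refine ⟨s₅, (r₁.seq (r₂.seq (r₃.seq (r₄.seq r₅)))).mono (by omega), ?_, by omega, ?_, ?_, ?_⟩
  · exact ((((F₁.mono (by decide) (by decide)).trans (F₂.mono (by decide) (by decide))).trans
      (F₃.mono (by decide) (by decide))).trans (F₄.mono (by decide) (by decide))).trans
      (F₅.mono (by decide) (by decide))
  · simp [F₅.real, F₄.real, F₃.real, F₂.real, h₁, cls, RExpr.eval, evalAddr, init]
  · simp [F₅.real, F₄.real, h₃, cls, RExpr.eval, evalAddr, num, sc, NExpr.eval, h₂, F₂.real, h₁,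
      init, refLabel, d₁]
  · intro j
    rw [h₅ j j.2 0 one_pos, h₄ j j.2]
    simp [direction, d₃, d₂, d₁, hi]

/-- The contribution of a sample `(x, y)` to a numerator. -/
theorem accumulate_runs (dst σ : ℕ) (hdst : dst ∉ ({2, 3, 5, 7, 8, 9, 13} : Finset ℕ)) {s : State}
    (hd : s.nat 0 = d) {x v : EuclideanSpace ℝ (Fin d)}
    (hx : ∀ j : Fin d, s.real [3, 0, 0, j] = x j)
    (hv : ∀ j : Fin d, s.real [5, j, 0] = v j) :
    ∃ s', Runs f ω (accumulate p dst σ) s (2 * tabCost d (d + 1) (d + 1)) s' ∧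
      Frame {2, 13, dst} {1, 2, 3} s s' ∧ s'.draws = s.draws ∧
      ∀ a ≤ d, ∀ b ≤ d, s'.real [dst, a, b] = s.real [dst, a, b] +
        s.real [9, 0, 0] * (s.real [8, 0, 0] - s.real [7, 0, 0]) *
          tilt (testPoint (1 / (d : ℝ) ^ p.step) σ v a b) x := by
  simp only [Finset.mem_insert, Finset.mem_singleton, not_or] at hdst
  obtain ⟨g2, g3, g5, g7, g8, g9, g13⟩ := hdst
  have hn : ∀ s' : State, s'.nat 0 = d → (NExpr.add (.reg 0) (.lit 1)).eval s' = d + 1 := by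
    intro s' h; simp [NExpr.eval, h]
  obtain ⟨s₁, r₁, F₁, d₁, h₁⟩ := tab_runs (f := f) (ω := ω) (dst := 13) (by decide)
    (n₁ := .add (.reg 0) (.lit 1)) (n₂ := .add (.reg 0) (.lit 1)) (e := tiltExpr p σ)
    (g := .add (mat dst 1 2) (.mul (.mul (num 9) (.sub (num 8) (num 7))) (.exp (num 2))))
    (d + 1) (d + 1)
    (fun a b j => (σ * s.real [5, j, 0] + (if a = j then 1 else 0) * (1 / (d : ℝ) ^ p.step) +
        (if b = j then 1 else 0) * (1 / (d : ℝ) ^ p.step)) * s.real [3, 0, 0, j] -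
      (σ * s.real [5, j, 0] + (if a = j then 1 else 0) * (1 / (d : ℝ) ^ p.step) +
        (if b = j then 1 else 0) * (1 / (d : ℝ) ^ p.step)) *
      (σ * s.real [5, j, 0] + (if a = j then 1 else 0) * (1 / (d : ℝ) ^ p.step) +
        (if b = j then 1 else 0) * (1 / (d : ℝ) ^ p.step)) / 2)
    (fun a b y => s.real [dst, a, b] +
        s.real [9, 0, 0] * (s.real [8, 0, 0] - s.real [7, 0, 0]) * Real.exp y) hd
    hn hn
    (fun s' hF => by
      simp only [tiltExpr, pointExpr, RExpr.eval, dpow_eval ((hF.nat 0 (by decide)).trans hd),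
        ind_eval, evalAddr, NExpr.eval, List.map_cons, List.map_nil]
      simp [hF.real, cls, -ite_mul])
    (fun s' hF => by
      simp [RExpr.eval, mat, num, sc, evalAddr, NExpr.eval, hF.real, cls, g2, g13])
  have hd₁ : s₁.nat 0 = d := (F₁.nat 0 (by decide)).trans hd
  obtain ⟨s₂, r₂, F₂, d₂, h₂⟩ := tab_runs (f := f) (ω := ω) (dst := dst) g2
    (n₁ := .add (.reg 0) (.lit 1)) (n₂ := .add (.reg 0) (.lit 1)) (e := .lit 0)
    (g := mat 13 1 2) (d + 1) (d + 1) (fun _ _ _ => 0) (fun i j _ => s₁.real [13, i, j]) hd₁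
    hn hn (fun _ _ => by simp [RExpr.eval])
    (fun s' hF => by simp [RExpr.eval, mat, evalAddr, NExpr.eval, hF.real, cls, Ne.symm g13])
  refine ⟨s₂, (r₁.seq r₂).mono (by omega), ?_, d₂.trans d₁, ?_⟩
  · refine (F₁.mono ?_ (by decide)).trans (F₂.mono ?_ (by decide)) <;> intro k <;> simp <;> tauto
  · intro a ha b hb
    rw [h₂ a (by omega) b (by omega), h₁ a (by omega) b (by omega), tilt, Finset.sum_range]
    simp [testPoint, hx, hv]

theorem rejectTest_holds {s : State} (hd : s.nat 0 = d) : (rejectTest p).Holds s ↔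
    (s.real [8, 0, 0] < 1 / (d : ℝ) ^ p.low * s.real [7, 0, 0] ∨
      s.real [7, 0, 0] + (d : ℝ) ^ p.clip < s.real [8, 0, 0] ∨
      s.real [8, 0, 0] < s.real [7, 0, 0] - (d : ℝ) ^ p.clip) := by
  simp only [rejectTest, BExpr.Holds, RExpr.eval, dpow_eval hd, num, sc, evalAddr, NExpr.eval,
    List.map_cons, List.map_nil, Rat.cast_one]
  tauto

theorem sampleProg_runs {s : State} (hd : s.nat 0 = d) (h6 : s.real [6, 0, 0] = Real.exp t)
    {v : EuclideanSpace ℝ (Fin d)} (hv : ∀ j : Fin d, s.real [5, j, 0] = v j) :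
    ∃ s', Runs f ω (sampleProg p) s (4 * tabCost d (d + 1) (d + 1) + d + 10) s' ∧
      Frame {2, 3, 8, 9, 10, 11, 12, 13} {1, 2, 3} s s' ∧ s'.draws = s.draws + 1 ∧
      s'.real [10, 0, 0] = s.real [10, 0, 0] + weight (1 / (d : ℝ) ^ p.low) ((d : ℝ) ^ p.clip)
        (s.real [7, 0, 0]) (Real.exp t * f (ω s.draws).1) ∧
      ∀ σ : Fin 2, ∀ a ≤ d, ∀ b ≤ d, s'.real [11 + σ, a, b] = s.real [11 + σ, a, b] +
        weight (1 / (d : ℝ) ^ p.low) ((d : ℝ) ^ p.clip)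
          (s.real [7, 0, 0]) (Real.exp t * f (ω s.draws).1) *
          (Real.exp t * f (ω s.draws).1 - s.real [7, 0, 0]) *
          tilt (testPoint (1 / (d : ℝ) ^ p.step) (σ : ℕ) v a b) (ω s.draws).1 := by
  obtain ⟨s₁, r₁, F₁, d₁, h₁, hx₁⟩ := sample_runs (f := f) (ω := ω) 3 s
  obtain ⟨s₂, r₂, F₂, d₂, h₂⟩ := setScalar_runs (f := f) (ω := ω) (dst := 8)
    (g := .mul (num 6) (num 3)) (s := s₁)
  have h8 : s₂.real [8, 0, 0] = Real.exp t * f (ω s.draws).1 := by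
    simp [h₂, RExpr.eval, num, sc, evalAddr, NExpr.eval, h₁, F₁.real, cls, h6]
  have h7 : s₂.real [7, 0, 0] = s.real [7, 0, 0] := by simp [F₂.real, F₁.real, cls]
  have hd₂ : s₂.nat 0 = d := by rw [F₂.nat 0 (by decide), F₁.nat 0 (by decide), hd]
  obtain ⟨s₃, r₃, F₃, d₃, h₃⟩ : ∃ s₃, Runs f ω (.ite (rejectTest p) (setScalar 9 (.lit 0))
      (setScalar 9 (.div (.lit 1) (num 8)))) s₂ 2 s₃ ∧ Frame {9} ∅ s₂ s₃ ∧
      s₃.draws = s₂.draws ∧ s₃.real [9, 0, 0] = weight (1 / (d : ℝ) ^ p.low) ((d : ℝ) ^ p.clip)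
        (s.real [7, 0, 0]) (Real.exp t * f (ω s.draws).1) := by
    by_cases hb : (rejectTest p).Holds s₂
    · obtain ⟨s₃, ⟨n, hn, r⟩, F, hdr, h⟩ := setScalar_runs (f := f) (ω := ω) (dst := 9)
        (g := .lit 0) (s := s₂)
      refine ⟨s₃, ⟨n + 1, by omega, .iteTrue hb r⟩, F, hdr, ?_⟩
      rw [rejectTest_holds hd₂, h7, h8] at hb
      simp only [h, weight, if_pos hb, RExpr.eval, Rat.cast_zero]
    · obtain ⟨s₃, ⟨n, hn, r⟩, F, hdr, h⟩ := setScalar_runs (f := f) (ω := ω) (dst := 9)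
        (g := .div (.lit 1) (num 8)) (s := s₂)
      refine ⟨s₃, ⟨n + 1, by omega, .iteFalse hb r⟩, F, hdr, ?_⟩
      rw [rejectTest_holds hd₂, h7, h8] at hb
      simp only [h, weight, if_neg hb]
      simp [RExpr.eval, num, sc, evalAddr, NExpr.eval, h8]
  obtain ⟨s₄, r₄, F₄, d₄, h₄⟩ := setScalar_runs (f := f) (ω := ω) (dst := 10)
    (g := .add (num 10) (num 9)) (s := s₃)
  have hd₄ : s₄.nat 0 = d := by rw [F₄.nat 0 (by decide), F₃.nat 0 (by decide), hd₂]
  obtain ⟨s₅, r₅, F₅, d₅, h₅⟩ := accumulate_runs (f := f) (ω := ω) (p := p) 11 0 (by decide) hd₄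
    (x := (ω s.draws).1) (v := v) (fun j => by simp [F₄.real, F₃.real, F₂.real, cls, hx₁])
    (fun j => by simp [F₄.real, F₃.real, F₂.real, F₁.real, cls, hv])
  have hd₅ : s₅.nat 0 = d := by rw [F₅.nat 0 (by decide), hd₄]
  obtain ⟨s₆, r₆, F₆, d₆, h₆⟩ := accumulate_runs (f := f) (ω := ω) (p := p) 12 1 (by decide) hd₅
    (x := (ω s.draws).1) (v := v) (fun j => by simp [F₅.real, F₄.real, F₃.real, F₂.real, cls, hx₁])
    (fun j => by simp [F₅.real, F₄.real, F₃.real, F₂.real, F₁.real, cls, hv])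
  refine ⟨s₆, (r₁.seq (r₂.seq (r₃.seq (r₄.seq (r₅.seq r₆))))).mono (by omega), ?_, by omega,
    ?_, ?_⟩
  · exact (((((F₁.mono (by decide) (by decide)).trans (F₂.mono (by decide) (by decide))).trans
      (F₃.mono (by decide) (by decide))).trans (F₄.mono (by decide) (by decide))).trans
      (F₅.mono (by decide) (by decide))).trans (F₆.mono (by decide) (by decide))
  · simp [F₆.real, F₅.real, cls, h₄, RExpr.eval, num, sc, evalAddr, NExpr.eval, h₃, F₃.real,
      F₂.real, F₁.real]
  · intro σ a ha b hb
    fin_cases σ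
    · simp [F₆.real, cls, h₅ a ha b hb, F₄.real, h₃, F₃.real, h8, h7, F₂.real, F₁.real]
    · simp [h₆ a ha b hb, F₅.real, cls, F₄.real, h₃, F₃.real, h8, h7, F₂.real, F₁.real]

theorem samplesProg_runs {s : State} (hd : s.nat 0 = d) (h6 : s.real [6, 0, 0] = Real.exp t)
    {v : EuclideanSpace ℝ (Fin d)} (hv : ∀ j : Fin d, s.real [5, j, 0] = v j)
    (h0 : ∀ l, cls l ∈ ({10, 11, 12} : Finset ℕ) → s.real l = 0) (hdr : s.draws = 1 + d) :
    ∃ s', Runs f ω (rep 30 1 p.samples (sampleProg p)) s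
        (d ^ p.samples * (4 * tabCost d (d + 1) (d + 1) + d + 12) + 2) s' ∧
      Frame {2, 3, 8, 9, 10, 11, 12, 13, 30} {1, 2, 3} s s' ∧
      ∀ σ : Fin 2, ∀ a ≤ d, ∀ b ≤ d, s'.real [11 + σ, a, b] / s'.real [10, 0, 0] =
        empirical (1 / (d : ℝ) ^ p.low) ((d : ℝ) ^ p.clip) (s.real [7, 0, 0]) (d ^ p.samples)
          (fun n => (ω (1 + d + n)).1) (fun n => Real.exp t * f (ω (1 + d + n)).1)
          (testPoint (1 / (d : ℝ) ^ p.step) (σ : ℕ) v a b) := by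
  obtain ⟨s', hr, hF, -, h10, hnum⟩ := rep_runs (f := f) (ω := ω) (ctr := 30) (a := 1)
    (n := p.samples) (p := sampleProg p) (4 * tabCost d (d + 1) (d + 1) + d + 10)
    (fun k s' => Frame {2, 3, 8, 9, 10, 11, 12, 13, 30} {1, 2, 3} s s' ∧ s'.draws = 1 + d + k ∧
      s'.real [10, 0, 0] = ∑ n ∈ Finset.range k, weight (1 / (d : ℝ) ^ p.low) ((d : ℝ) ^ p.clip)
        (s.real [7, 0, 0]) (Real.exp t * f (ω (1 + d + n)).1) ∧
      ∀ σ : Fin 2, ∀ a ≤ d, ∀ b ≤ d, s'.real [11 + σ, a, b] = ∑ n ∈ Finset.range k,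
        weight (1 / (d : ℝ) ^ p.low) ((d : ℝ) ^ p.clip)
          (s.real [7, 0, 0]) (Real.exp t * f (ω (1 + d + n)).1) *
          (Real.exp t * f (ω (1 + d + n)).1 - s.real [7, 0, 0]) *
          tilt (testPoint (1 / (d : ℝ) ^ p.step) (σ : ℕ) v a b) (ω (1 + d + n)).1)
    (by
      rintro k s' x ⟨hF, h1, h2, h3⟩
      refine ⟨hF.setReal (by simp [cls]) _ _, h1, by simpa using h2, fun σ a ha b hb => ?_⟩
      rw [← h3 σ a ha b hb]
      apply Function.update_of_ne
      have := σ.2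
      simp; omega)
    (fun k s' h => (h.1.nat 0 (by decide)).trans hd)
    (by
      rintro k s' hk ⟨hF, h1, h2, h3⟩
      obtain ⟨s₂, r₂, F₂, hd₂, h10, hnum⟩ := sampleProg_runs (f := f) (ω := ω) (p := p) (s := s')
        (t := t) (v := v) ((hF.nat 0 (by decide)).trans hd)
        (by rw [hF.real _ (by simp [cls]), h6]) (fun j => by rw [hF.real _ (by simp [cls]), hv])
      have h7 : s'.real [7, 0, 0] = s.real [7, 0, 0] := hF.real _ (by simp [cls])
      refine ⟨s₂, r₂, F₂.real _ (by simp [cls]), hF.trans (F₂.mono (by decide) (by decide)),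
        by omega, ?_, ?_⟩
      · rw [h10, h2, h1, h7, Finset.sum_range_succ]
      · intro σ a ha b hb
        rw [hnum σ a ha b hb, h3 σ a ha b hb, h1, h7, Finset.sum_range_succ])
    (s := s) ⟨Frame.refl _ _ s, by simpa using hdr, by simpa using h0 [10, 0, 0] (by simp [cls]),
      fun σ a _ b _ => by
        simpa using h0 [11 + σ, a, b] (by fin_cases σ <;> simp [cls])⟩
  rw [one_mul] at h10 hnum hr
  refine ⟨s', hr, hF, fun σ a ha b hb => ?_⟩
  rw [h10, hnum σ a ha b hb, empirical]

theorem testPoint_zero (h : ℝ) (v : EuclideanSpace ℝ (Fin d)) (a b : ℕ) :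
    testPoint h 0 v a b = testPoint h 1 0 a b := by
  ext j; simp [testPoint]

theorem diffProg_runs {s : State} (hd : s.nat 0 = d) {v : EuclideanSpace ℝ (Fin d)}
    {Φ : EuclideanSpace ℝ (Fin d) → ℝ}
    (hΦ : ∀ σ : Fin 2, ∀ a ≤ d, ∀ b ≤ d, s.real [11 + σ, a, b] / s.real [10, 0, 0] =
      Φ (testPoint (1 / (d : ℝ) ^ p.step) (σ : ℕ) v a b)) :
    ∃ s', Runs f ω (diffProg p) s (tabCost d d 1 + 2 * tabCost d d d) s' ∧
      Frame {2, 14, 15, 16} {1, 2, 3} s s' ∧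
      (∀ i : Fin d, s'.real [14, i, 0] = firstDiff (1 / (d : ℝ) ^ p.step) Φ i) ∧
      (∀ i j : Fin d, s'.real [15, i, j] = secondDiff (1 / (d : ℝ) ^ p.step) 0 Φ i j) ∧
      ∀ i j : Fin d, s'.real [16, i, j] = secondDiff (1 / (d : ℝ) ^ p.step) v Φ i j := by
  have hp : ∀ s' : State, s'.nat 0 = d → (dpow p.step).eval s' = (d : ℝ) ^ p.step :=
    fun s' h => dpow_eval h _
  obtain ⟨s₁, r₁, F₁, d₁, h₁⟩ := tab_runs (f := f) (ω := ω) (dst := 14) (by decide)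
    (n₁ := .reg 0) (n₂ := .lit 1) (e := .lit 0)
    (g := .div (.div (.sub (phiExpr 11 (.reg 1) (.reg 0)) (phiExpr 11 (.reg 0) (.reg 0)))
      (.div (.lit 1) (dpow p.step))) (.exp (.div (.lit 1) (.lit 2)))) d 1 (fun _ _ _ => 0)
    (fun i _ _ => (s.real [11, i, d] / s.real [10, 0, 0] - s.real [11, d, d] / s.real [10, 0, 0]) /
      (1 / (d : ℝ) ^ p.step) / Real.exp (1 / 2)) hd
    (fun s' h => h) (fun _ _ => rfl) (fun _ _ => by simp [RExpr.eval])
    (fun s' hF => by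
      have h0 := (hF.nat 0 (by decide)).trans hd
      simp only [RExpr.eval, dpow_eval h0, phiExpr, num, sc, evalAddr, NExpr.eval, h0,
        List.map_cons, List.map_nil, Rat.cast_one, Rat.cast_ofNat]
      rw [hF.real _ (by simp [cls]), hF.real _ (by simp [cls]), hF.real _ (by simp [cls])])
  have hd₁ : s₁.nat 0 = d := (F₁.nat 0 (by decide)).trans hd
  have key : ∀ dst : ℕ, dst ∉ ({2, 10, 11, 12} : Finset ℕ) → ∀ σ : Fin 2, ∀ s₁ : State,
      s₁.nat 0 = d → ∃ s₂, Runs f ω (tab dst (.reg 0) (.reg 0) (.lit 0) (diffExpr p (11 + σ))) s₁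
        (tabCost d d d) s₂ ∧ Frame {2, dst} {1, 2, 3} s₁ s₂ ∧ ∀ i < d, ∀ j < d,
        s₂.real [dst, i, j] = (s₁.real [11 + σ, i, j] / s₁.real [10, 0, 0] -
          s₁.real [11 + σ, i, d] / s₁.real [10, 0, 0] - s₁.real [11 + σ, d, j] / s₁.real [10, 0, 0]
          + s₁.real [11 + σ, d, d] / s₁.real [10, 0, 0]) /
          (1 / (d : ℝ) ^ p.step) ^ 2 / Real.exp (1 / 2) := by
    intro dst hdst σ s₁ hd₁
    simp only [Finset.mem_insert, Finset.mem_singleton, not_or] at hdst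
    obtain ⟨g2, g10, g11, g12⟩ := hdst
    have gσ : ¬ 11 + (σ : ℕ) = dst := by have := σ.2; omega
    obtain ⟨s₂, r₂, F₂, -, h₂⟩ := tab_runs (f := f) (ω := ω) (s := s₁) (dst := dst) g2
      (n₁ := .reg 0) (n₂ := .reg 0) (e := .lit 0) (g := diffExpr p (11 + σ)) d d (fun _ _ _ => 0)
      (fun i j _ => (s₁.real [11 + σ, i, j] / s₁.real [10, 0, 0] -
          s₁.real [11 + σ, i, d] / s₁.real [10, 0, 0] - s₁.real [11 + σ, d, j] / s₁.real [10, 0, 0]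
          + s₁.real [11 + σ, d, d] / s₁.real [10, 0, 0]) /
          (1 / (d : ℝ) ^ p.step) ^ 2 / Real.exp (1 / 2)) hd₁
      (fun s' h => h) (fun s' h => h) (fun _ _ => by simp [RExpr.eval])
      (fun s' hF => by
        have h0 := (hF.nat 0 (by decide)).trans hd₁
        have hc : ∀ i j, s'.real [11 + σ, i, j] = s₁.real [11 + σ, i, j] := fun i j =>
          hF.real _ (by simp [cls, gσ]; omega)
        simp only [diffExpr, RExpr.eval, dpow_eval h0, phiExpr, num, sc, evalAddr, NExpr.eval, h0,
          List.map_cons, List.map_nil, Rat.cast_one, Rat.cast_ofNat, hc]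
        rw [hF.real [10, 0, 0] (by simp [cls]; omega), sq])
    exact ⟨s₂, r₂, F₂, h₂⟩
  obtain ⟨s₂, r₂, F₂, h₂⟩ := key 15 (by decide) 0 s₁ hd₁
  obtain ⟨s₃, r₃, F₃, h₃⟩ := key 16 (by decide) 1 s₂ ((F₂.nat 0 (by decide)).trans hd₁)
  refine ⟨s₃, (r₁.seq (r₂.seq r₃)).mono (by omega), ((F₁.mono (by decide) (by decide)).trans
    (F₂.mono (by decide) (by decide))).trans (F₃.mono (by decide) (by decide)), ?_, ?_, ?_⟩
  · intro i
    have e1 := hΦ 0 i i.2.le d le_rfl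
    have e2 := hΦ 0 d le_rfl d le_rfl
    simp only [Fin.val_zero, Nat.cast_zero, add_zero, testPoint_zero _ v] at e1 e2
    rw [F₃.real _ (by simp [cls]), F₂.real _ (by simp [cls]), h₁ i i.2 0 one_pos, e1, e2,
      firstDiff, testPoint_zero, testPoint_zero]
  · intro i j
    rw [F₃.real _ (by simp [cls]), h₂ i i.2 j j.2]
    have e1 := hΦ 0 i i.2.le j j.2.le
    have e2 := hΦ 0 i i.2.le d le_rfl
    have e3 := hΦ 0 d le_rfl j j.2.le
    have e4 := hΦ 0 d le_rfl d le_rfl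
    simp only [Fin.val_zero, Nat.cast_zero, add_zero, testPoint_zero _ v] at e1 e2 e3 e4
    have hc : ∀ a b, s₁.real [11 + (0 : Fin 2), a, b] = s.real [11, a, b] := fun a b =>
      F₁.real _ (by simp [cls])
    rw [hc, hc, hc, hc, F₁.real [10, 0, 0] (by simp [cls]), e1, e2, e3, e4, secondDiff]
  · intro i j
    rw [h₃ i i.2 j j.2]
    have e1 := hΦ 1 i i.2.le j j.2.le
    have e2 := hΦ 1 i i.2.le d le_rfl
    have e3 := hΦ 1 d le_rfl j j.2.le
    have e4 := hΦ 1 d le_rfl d le_rfl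
    simp only [Fin.val_one, Nat.cast_one] at e1 e2 e3 e4
    have hc : ∀ a b, s₂.real [11 + (1 : Fin 2), a, b] = s.real [11 + 1, a, b] := fun a b => by
      rw [F₂.real _ (by simp [cls]), F₁.real _ (by simp [cls])]; rfl
    rw [hc, hc, hc, hc, F₂.real [10, 0, 0] (by simp [cls]), F₁.real [10, 0, 0] (by simp [cls]),
      e1, e2, e3, e4, secondDiff]

/-- Copying a matrix. -/
theorem copy_runs {dst src : ℕ} (h2 : dst ≠ 2) (hs : src ∉ ({2, dst} : Finset ℕ)) {s : State}
    (hd : s.nat 0 = d) :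
    ∃ s', Runs f ω (tab dst (.reg 0) (.reg 0) (.lit 0) (mat src 1 2)) s (tabCost d d d) s' ∧
      Frame {2, dst} {1, 2, 3} s s' ∧
      ∀ i j : Fin d, s'.real [dst, i, j] = s.real [src, i, j] := by
  obtain ⟨s', r, F, -, h⟩ := tab_runs (f := f) (ω := ω) (dst := dst) h2
    (n₁ := .reg 0) (n₂ := .reg 0) (e := .lit 0) (g := mat src 1 2) d d (fun _ _ _ => 0)
    (fun i j _ => s.real [src, i, j]) hd (fun s' h => h) (fun s' h => h)
    (fun _ _ => by simp [RExpr.eval])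
    (fun s' hF => by
      simp only [mat, RExpr.eval, evalAddr, NExpr.eval, List.map_cons, List.map_nil]
      exact hF.real _ (by simpa [cls] using hs))
  exact ⟨s', r, F, fun i j => h i i.2 j j.2⟩

/-- Matrix multiplication, followed by an entrywise operation. -/
theorem mul_runs {dst a b : ℕ} {g : RExpr} (h2 : dst ≠ 2) (ha : a ∉ ({2, dst} : Finset ℕ))
    (hb : b ∉ ({2, dst} : Finset ℕ)) {s : State} (hd : s.nat 0 = d)
    {A B : Matrix (Fin d) (Fin d) ℝ} (hA : ∀ i j : Fin d, s.real [a, i, j] = A i j)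
    (hB : ∀ i j : Fin d, s.real [b, i, j] = B i j) (G : ℕ → ℕ → ℝ → ℝ)
    (hg : ∀ s', Frame {2, dst} {1, 2, 3} s s' →
      g.eval s' = G (s'.nat 1) (s'.nat 2) (s'.real [2, 0, 0])) :
    ∃ s', Runs f ω (tab dst (.reg 0) (.reg 0) (.mul (mat a 1 3) (mat b 3 2)) g) s
        (tabCost d d d) s' ∧ Frame {2, dst} {1, 2, 3} s s' ∧
      ∀ i j : Fin d, s'.real [dst, i, j] = G i j ((A * B) i j) := by
  obtain ⟨s', r, F, -, h⟩ := tab_runs (f := f) (ω := ω) (dst := dst) h2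
    (n₁ := .reg 0) (n₂ := .reg 0) (e := .mul (mat a 1 3) (mat b 3 2)) (g := g) d d
    (fun i j r => s.real [a, i, r] * s.real [b, r, j]) G hd (fun s' h => h) (fun s' h => h)
    (fun s' hF => by
      simp only [mat, RExpr.eval, evalAddr, NExpr.eval, List.map_cons, List.map_nil]
      rw [hF.real _ (by simpa [cls] using ha), hF.real _ (by simpa [cls] using hb)]) hg
  refine ⟨s', r, F, fun i j => ?_⟩
  rw [h i i.2 j j.2, Finset.sum_range, Matrix.mul_apply]
  simp [hA, hB]

theorem richardsonProg_runs {s : State} (hd : s.nat 0 = d) {A A' : Matrix (Fin d) (Fin d) ℝ}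
    (hA : ∀ i j : Fin d, s.real [15, i, j] = A i j)
    (hA' : ∀ i j : Fin d, s.real [16, i, j] = A' i j)
    (h0 : ∀ l, cls l = 17 → s.real l = 0) :
    ∃ s', Runs f ω (richardsonProg p) s
        (d ^ p.rounds * (2 * tabCost d d d + 2) + 2 + tabCost d d d) s' ∧
      Frame {2, 17, 18, 19, 31} {1, 2, 3} s s' ∧
      ∀ i j : Fin d, s'.real [19, i, j] =
        (richardson (1 / (d : ℝ) ^ p.relax) A (d ^ p.rounds) * A') i j := by
  obtain ⟨s₁, r₁, F₁, h₁⟩ := rep_runs (f := f) (ω := ω) (ctr := 31) (a := 1) (n := p.rounds)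
    (p := .seq (tab 18 (.reg 0) (.reg 0) (.mul (mat 15 1 3) (mat 17 3 2))
        (.add (mat 17 1 2) (.mul (.div (.lit 1) (dpow p.relax))
          (.sub (ind (.reg 1) (.reg 2)) (num 2)))))
      (tab 17 (.reg 0) (.reg 0) (.lit 0) (mat 18 1 2))) (2 * tabCost d d d)
    (fun k s' => Frame {2, 17, 18, 31} {1, 2, 3} s s' ∧
      ∀ i j : Fin d, s'.real [17, i, j] = richardson (1 / (d : ℝ) ^ p.relax) A k i j)
    (by
      rintro k s' x ⟨hF, h⟩
      exact ⟨hF.setReal (by simp [cls]) _ _, fun i j => by simpa using h i j⟩)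
    (fun k s' h => (h.1.nat 0 (by decide)).trans hd)
    (by
      rintro k s' hk ⟨hF, h⟩
      have hd' := (hF.nat 0 (by decide)).trans hd
      obtain ⟨s₂, r₂, F₂, h₂⟩ := mul_runs (f := f) (ω := ω) (dst := 18) (a := 15) (b := 17)
        (g := .add (mat 17 1 2) (.mul (.div (.lit 1) (dpow p.relax))
          (.sub (ind (.reg 1) (.reg 2)) (num 2)))) (by decide) (by decide) (by decide) hd'
        (A := A) (fun i j => by rw [hF.real _ (by simp [cls]), hA]) h
        (fun i j y => s'.real [17, i, j] + 1 / (d : ℝ) ^ p.relax * ((if i = j then 1 else 0) - y))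
        (fun s'' hF' => by
          simp only [RExpr.eval, ind_eval, dpow_eval ((hF'.nat 0 (by decide)).trans hd'), mat, num,
            sc, evalAddr, NExpr.eval, List.map_cons, List.map_nil, Rat.cast_one]
          rw [hF'.real _ (by simp [cls])])
      obtain ⟨s₃, r₃, F₃, h₃⟩ := copy_runs (f := f) (ω := ω) (dst := 17) (src := 18) (by decide)
        (by decide) ((F₂.nat 0 (by decide)).trans hd')
      refine ⟨s₃, (r₂.seq r₃).mono (by omega), ?_, (hF.trans
        (F₂.mono (by decide) (by decide))).trans (F₃.mono (by decide) (by decide)), fun i j => ?_⟩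
      · rw [F₃.real _ (by simp [cls]), F₂.real _ (by simp [cls])]
      · rw [h₃, h₂, h]
        simp [richardson, Matrix.one_apply, Fin.ext_iff])
    (s := s) ⟨Frame.refl _ _ s, fun i j => by simpa [richardson] using h0 _ (by simp [cls])⟩
  have hd₁ := (F₁.nat 0 (by decide)).trans hd
  obtain ⟨s₂, r₂, F₂, h₂⟩ := mul_runs (f := f) (ω := ω) (dst := 19) (a := 17) (b := 16)
    (g := num 2) (by decide) (by decide) (by decide) hd₁
    h₁ (fun i j => by rw [F₁.real _ (by simp [cls]), hA']) (fun i j y => y)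
    (fun s' hF => by simp [RExpr.eval, num, sc, evalAddr, NExpr.eval])
  rw [one_mul] at h₂ r₁
  exact ⟨s₂, (r₁.seq r₂).mono (by omega), (F₁.mono (by decide) (by decide)).trans
    (F₂.mono (by decide) (by decide)), h₂⟩

theorem filterProg_runs {s : State} (hd : s.nat 0 = d) {B : Matrix (Fin d) (Fin d) ℝ} {μ : ℝ}
    (hB : ∀ i j : Fin d, s.real [19, i, j] = B i j) (hμ : s.real [25, 0, 0] = μ) :
    ∃ s', Runs f ω (filterProg p) s
        (3 * tabCost d d d + (d ^ p.power * (2 * tabCost d d d + 2) + 2) + tabCost d 1 1) s' ∧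
      Frame {2, 20, 21, 22, 23, 24, 33} {1, 2, 3} s s' ∧
      (∀ i j : Fin d, s'.real [22, i, j] = spectralFilter (d ^ p.power) B μ i j) ∧
      s'.real [24, 0, 0] = (spectralFilter (d ^ p.power) B μ).trace := by
  obtain ⟨s₁, r₁, F₁, -, h₁⟩ := tab_runs (f := f) (ω := ω) (dst := 20) (by decide)
    (n₁ := .reg 0) (n₂ := .reg 0) (e := .lit 0)
    (g := .sub (mat 19 1 2) (.mul (num 25) (ind (.reg 1) (.reg 2)))) d d (fun _ _ _ => 0)
    (fun i j _ => s.real [19, i, j] - s.real [25, 0, 0] * if i = j then 1 else 0) hd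
    (fun s' h => h) (fun s' h => h) (fun _ _ => by simp [RExpr.eval])
    (fun s' hF => by
      simp only [RExpr.eval, ind_eval, mat, num, sc, evalAddr, NExpr.eval, List.map_cons,
        List.map_nil]
      rw [hF.real _ (by simp [cls]), hF.real _ (by simp [cls])])
  have h₁' : ∀ i j : Fin d, s₁.real [20, i, j] = (B - μ • 1) i j := fun i j => by
    simp [h₁ i i.2 j j.2, hB, hμ, Matrix.one_apply, Fin.ext_iff]
  have hd₁ := (F₁.nat 0 (by decide)).trans hd
  obtain ⟨s₂, r₂, F₂, h₂⟩ := mul_runs (f := f) (ω := ω) (dst := 21) (a := 20) (b := 20)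
    (g := .sub (ind (.reg 1) (.reg 2)) (.mul (.div (.lit 1) (.lit 64)) (num 2)))
    (by decide) (by decide) (by decide) hd₁ h₁' h₁'
    (fun i j y => (if i = j then 1 else 0) - 1 / 64 * y)
    (fun s' hF => by
      simp only [RExpr.eval, ind_eval, num, sc, evalAddr, NExpr.eval, List.map_cons,
        List.map_nil, Rat.cast_one, Rat.cast_ofNat])
  have hd₂ := (F₂.nat 0 (by decide)).trans hd₁
  have h₂' : ∀ i j : Fin d, s₂.real [21, i, j] =
      (1 - (1 / 64 : ℝ) • ((B - μ • 1) * (B - μ • 1))) i j := fun i j => by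
    rw [h₂, Matrix.sub_apply, Matrix.one_apply, Matrix.smul_apply, smul_eq_mul]
    simp only [Fin.ext_iff]
  obtain ⟨s₃, r₃, F₃, -, h₃⟩ := tab_runs (f := f) (ω := ω) (dst := 22) (by decide)
    (n₁ := .reg 0) (n₂ := .reg 0) (e := .lit 0) (g := ind (.reg 1) (.reg 2)) d d (fun _ _ _ => 0)
    (fun i j _ => if i = j then 1 else 0) hd₂
    (fun s' h => h) (fun s' h => h) (fun _ _ => by simp [RExpr.eval])
    (fun s' hF => by simp only [ind_eval])
  have hd₃ := (F₃.nat 0 (by decide)).trans hd₂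
  obtain ⟨s₄, r₄, F₄, h₄⟩ := rep_runs (f := f) (ω := ω) (ctr := 33) (a := 1) (n := p.power)
    (p := .seq (tab 23 (.reg 0) (.reg 0) (.mul (mat 22 1 3) (mat 21 3 2)) (num 2))
      (tab 22 (.reg 0) (.reg 0) (.lit 0) (mat 23 1 2))) (2 * tabCost d d d)
    (fun k s' => Frame {2, 22, 23, 33} {1, 2, 3} s₃ s' ∧
      ∀ i j : Fin d, s'.real [22, i, j] = spectralFilter k B μ i j)
    (by
      rintro k s' x ⟨hF, h⟩
      exact ⟨hF.setReal (by simp [cls]) _ _, fun i j => by simpa using h i j⟩)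
    (fun k s' h => (h.1.nat 0 (by decide)).trans hd₃)
    (by
      rintro k s' hk ⟨hF, h⟩
      have hd' := (hF.nat 0 (by decide)).trans hd₃
      obtain ⟨s₅, r₅, F₅, h₅⟩ := mul_runs (f := f) (ω := ω) (dst := 23) (a := 22) (b := 21)
        (g := num 2) (by decide) (by decide) (by decide) hd' h
        (fun i j => by rw [hF.real _ (by simp [cls]), F₃.real _ (by simp [cls]), h₂'])
        (fun i j y => y) (fun s' hF => by simp [RExpr.eval, num, sc, evalAddr, NExpr.eval])
      obtain ⟨s₆, r₆, F₆, h₆⟩ := copy_runs (f := f) (ω := ω) (dst := 22) (src := 23) (by decide)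
        (by decide) ((F₅.nat 0 (by decide)).trans hd')
      refine ⟨s₆, (r₅.seq r₆).mono (by omega), ?_, (hF.trans
        (F₅.mono (by decide) (by decide))).trans (F₆.mono (by decide) (by decide)), fun i j => ?_⟩
      · rw [F₆.real _ (by simp [cls]), F₅.real _ (by simp [cls])]
      · rw [h₆, h₅, spectralFilter, spectralFilter, pow_succ])
    (s := s₃) ⟨Frame.refl _ _ _, fun i j => by
      simp [h₃ i i.2 j j.2, spectralFilter, Matrix.one_apply, Fin.ext_iff]⟩
  rw [one_mul] at h₄ r₄
  have hd₄ := (F₄.nat 0 (by decide)).trans hd₃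
  obtain ⟨s₅, r₅, F₅, -, h₅⟩ := tab_runs (f := f) (ω := ω) (dst := 24) (by decide)
    (n₁ := .lit 1) (n₂ := .lit 1) (e := mat 22 3 3) (g := num 2) 1 1
    (fun _ _ r => s₄.real [22, r, r]) (fun _ _ y => y) hd₄ (fun _ _ => rfl) (fun _ _ => rfl)
    (fun s' hF => by
      simp only [RExpr.eval, mat, evalAddr, NExpr.eval, List.map_cons, List.map_nil]
      rw [hF.real _ (by simp [cls])])
    (fun s' hF => by simp [RExpr.eval, num, sc, evalAddr, NExpr.eval])
  refine ⟨s₅, (r₁.seq (r₂.seq (r₃.seq (r₄.seq r₅)))).mono (by omega), ?_, ?_, ?_⟩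
  · exact ((((F₁.mono (by decide) (by decide)).trans (F₂.mono (by decide) (by decide))).trans
      (F₃.mono (by decide) (by decide))).trans (F₄.mono (by decide) (by decide))).trans
      (F₅.mono (by decide) (by decide))
  · intro i j
    rw [F₅.real _ (by simp [cls]), h₄]
  · rw [h₅ 0 one_pos 0 one_pos, Finset.sum_range, Matrix.trace]
    simp [h₄]

theorem extractProg_runs {s : State} (hd : s.nat 0 = d) {Q : Matrix (Fin d) (Fin d) ℝ}
    {m : Fin d → ℝ} (hQ : ∀ i j : Fin d, s.real [22, i, j] = Q i j)
    (hm : ∀ i : Fin d, s.real [14, i, 0] = m i) (ht : s.real [24, 0, 0] = Q.trace) :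
    ∃ s', Runs f ω extractProg s (2 * tabCost d d 1 + tabCost d 1 1 + d * 3 + 2) s' ∧
      Frame {1, 2, 27, 28, 29} {1, 2, 3} s s' ∧
      (∀ j : Fin d, s'.real [s.nat 4, j] = extract Q m j) ∧
      ∀ k j, k ≠ s.nat 4 → s'.real [k, j] = s.real [k, j] := by
  obtain ⟨s₁, r₁, F₁, -, h₁⟩ := tab_runs (f := f) (ω := ω) (dst := 27) (by decide)
    (n₁ := .reg 0) (n₂ := .lit 1) (e := .mul (mat 22 3 1) (mat 14 3 2))
    (g := .div (num 2) (num 24)) d 1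
    (fun i j r => s.real [22, r, i] * s.real [14, r, j]) (fun _ _ y => y / s.real [24, 0, 0]) hd
    (fun s' h => h) (fun _ _ => rfl)
    (fun s' hF => by
      simp only [RExpr.eval, mat, evalAddr, NExpr.eval, List.map_cons, List.map_nil]
      rw [hF.real _ (by simp [cls]), hF.real _ (by simp [cls])])
    (fun s' hF => by
      simp only [RExpr.eval, num, sc, evalAddr, NExpr.eval, List.map_cons, List.map_nil]
      rw [hF.real [24, 0, 0] (by simp [cls])])
  have hd₁ := (F₁.nat 0 (by decide)).trans hd
  obtain ⟨s₂, r₂, F₂, -, h₂⟩ := tab_runs (f := f) (ω := ω) (dst := 28) (by decide)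
    (n₁ := .lit 1) (n₂ := .lit 1) (e := .mul (mat 27 3 2) (mat 27 3 2))
    (g := .sqrt (num 2)) 1 1
    (fun _ j r => s₁.real [27, r, j] * s₁.real [27, r, j]) (fun _ _ y => √y) hd₁
    (fun _ _ => rfl) (fun _ _ => rfl)
    (fun s' hF => by
      simp only [RExpr.eval, mat, evalAddr, NExpr.eval, List.map_cons, List.map_nil]
      rw [hF.real _ (by simp [cls])])
    (fun s' hF => by
      simp only [RExpr.eval, num, sc, evalAddr, NExpr.eval, List.map_cons, List.map_nil])
  have hd₂ := (F₂.nat 0 (by decide)).trans hd₁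
  obtain ⟨s₃, r₃, F₃, -, h₃⟩ := tab_runs (f := f) (ω := ω) (dst := 29) (by decide)
    (n₁ := .reg 0) (n₂ := .lit 1) (e := .mul (mat 22 1 3) (mat 27 3 2))
    (g := .div (.div (num 2) (num 24)) (.mul (num 28) (.sqrt (num 28)))) d 1
    (fun i j r => s₂.real [22, i, r] * s₂.real [27, r, j])
    (fun _ _ y => y / s₂.real [24, 0, 0] / (s₂.real [28, 0, 0] * √(s₂.real [28, 0, 0]))) hd₂
    (fun s' h => h) (fun _ _ => rfl)
    (fun s' hF => by
      simp only [RExpr.eval, mat, evalAddr, NExpr.eval, List.map_cons, List.map_nil]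
      rw [hF.real _ (by simp [cls]), hF.real _ (by simp [cls])])
    (fun s' hF => by
      simp only [RExpr.eval, num, sc, evalAddr, NExpr.eval, List.map_cons, List.map_nil]
      rw [hF.real [24, 0, 0] (by simp [cls]), hF.real [28, 0, 0] (by simp [cls])])
  have hd₃ := (F₃.nat 0 (by decide)).trans hd₂
  have F₁₃ : Frame {1, 2, 27, 28, 29} {1, 2, 3} s s₃ :=
    ((F₁.mono (by decide) (by decide)).trans (F₂.mono (by decide) (by decide))).trans
      (F₃.mono (by decide) (by decide))
  have hz : ∀ j : Fin d, s₃.real [29, j, 0] = extract Q m j := by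
    intro j
    have h27 : ∀ r : Fin d, s₁.real [27, r, 0] = (∑ b, Q b r * m b) / Q.trace := by
      intro r
      rw [h₁ r r.2 0 one_pos, Finset.sum_range]
      simp [hQ, hm, ht]
    have h28 : s₂.real [28, 0, 0] = √(∑ a, (∑ b, Q b a * m b) / Q.trace *
        ((∑ b, Q b a * m b) / Q.trace)) := by
      rw [h₂ 0 one_pos 0 one_pos, Finset.sum_range]
      simp [h27]
    have h22 : ∀ i r : Fin d, s₂.real [22, i, r] = Q i r := fun i r => by
      rw [F₂.real _ (by simp [cls]), F₁.real _ (by simp [cls]), hQ]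
    have h24 : s₂.real [24, 0, 0] = Q.trace := by
      rw [F₂.real _ (by simp [cls]), F₁.real _ (by simp [cls]), ht]
    have h27' : ∀ r : Fin d, s₂.real [27, r, 0] = (∑ b, Q b r * m b) / Q.trace := fun r => by
      rw [F₂.real _ (by simp [cls]), h27]
    rw [h₃ j j.2 0 one_pos, Finset.sum_range, h28, h24]
    simp only [h22, h27', extract]
  obtain ⟨s₄, r₄, F₄, -, hn₄, ho, hk⟩ := forLoop_runs (f := f) (ω := ω) (r := 1) (b := .reg 0)
    (p := .setReal [.reg 4, .reg 1] (.cell [.lit 29, .reg 1, .lit 0])) d 1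
    (fun k s' => Frame {1, 2, 27, 28, 29} {1, 2, 3} s s' ∧ s'.nat 1 = k ∧
      (∀ j : Fin d, s'.real [29, j, 0] = extract Q m j) ∧
      (∀ j : Fin d, (j : ℕ) < k → s'.real [s.nat 4, j] = extract Q m j) ∧
      ∀ k j, k ≠ s.nat 4 → s'.real [k, j] = s.real [k, j])
    (fun j s' h => ⟨h.2.1, (h.1.nat 0 (by decide)).trans hd⟩)
    (by
      rintro k s' hk ⟨hF, h1, h2, h3, h4⟩
      have hn4 : s'.nat 4 = s.nat 4 := hF.nat 4 (by decide)
      refine ⟨_, Runs.setReal _ _ _, h1, (hF.setReal (by simp [evalAddr, cls]) _ _).setNat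
        (by decide) _, by simp, fun j => ?_, fun j hj => ?_, fun k' j hk' => ?_⟩
      · simpa [evalAddr] using h2 j
      · simp only [evalAddr, NExpr.eval, List.map_cons, List.map_nil, hn4, h1, RExpr.eval]
        rcases Nat.lt_succ_iff_lt_or_eq.1 hj with hj | rfl
        · rw [Function.update_of_ne (by simp [hj.ne]), h3 j hj]
        · rw [Function.update_self, h2]
      · simp only [evalAddr, NExpr.eval, List.map_cons, List.map_nil, hn4]
        rw [Function.update_of_ne (by simp [hk']), h4 k' j hk'])
    (s := s₃) ⟨F₁₃.setNat (by decide) _, by simp, hz, by simp, fun k j _ => by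
      change s₃.real [k, j] = s.real [k, j]
      rw [F₃.real _ (by simp [cls]), F₂.real _ (by simp [cls]), F₁.real _ (by simp [cls])]⟩
  exact ⟨s₄, (r₁.seq (r₂.seq (r₃.seq r₄))).mono (by omega), F₄, fun j => ho j j.2, hk⟩

/-- A bound for the running time of one step of the scan. -/
def scanCost (p : Exponents) (d : ℕ) : ℕ :=
  (3 * tabCost d d d + (d ^ p.power * (2 * tabCost d d d + 2) + 2) + tabCost d 1 1) +
    (2 * tabCost d d 1 + tabCost d 1 1 + d * 3 + 10)

theorem scan_runs {s : State} (hd : s.nat 0 = d) {B : Matrix (Fin d) (Fin d) ℝ} {m : Fin d → ℝ}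
    (hB : ∀ i j : Fin d, s.real [19, i, j] = B i j)
    (hm : ∀ i : Fin d, s.real [14, i, 0] = m i) (h4 : s.nat 4 = 0)
    (h0 : ∀ l, cls l ∈ ({1, 25, 26} : Finset ℕ) → s.real l = 0) :
    ∃ s', Runs f ω (rep 32 8 p.mesh (scanProg p)) s (8 * d ^ p.mesh * (scanCost p d + 2) + 2) s' ∧
      ∀ i j : Fin d, s'.real [i, j] =
        (scan (1 / (d : ℝ) ^ p.mesh) (1 / (d : ℝ) ^ p.skip) (spectralFilter (d ^ p.power) B)
          (fun Q => extract Q m) (8 * d ^ p.mesh)).out i j := by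
  set S := scan (1 / (d : ℝ) ^ p.mesh) (1 / (d : ℝ) ^ p.skip) (spectralFilter (d ^ p.power) B)
          (fun Q => extract Q m) with hS
  obtain ⟨s', r, -, -, -, -, -, -, h⟩ := rep_runs (f := f) (ω := ω) (ctr := 32) (a := 8)
    (n := p.mesh) (p := scanProg p) (scanCost p d)
    (fun k s' => s'.nat 0 = d ∧ (∀ i j : Fin d, s'.real [19, i, j] = B i j) ∧
      (∀ i : Fin d, s'.real [14, i, 0] = m i) ∧ s'.nat 4 = (S k).count ∧
      s'.real [25, 0, 0] = k * (1 / (d : ℝ) ^ p.mesh) ∧ s'.real [26, 0, 0] = (S k).next ∧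
      ∀ i : ℕ, ∀ j : Fin d, s'.real [i, j] = (S k).out i j)
    (by
      rintro k s' x ⟨h1, h2, h3, h4, h5, h6, h7⟩
      exact ⟨h1, fun i j => by simpa using h2 i j, fun i => by simpa using h3 i, h4,
        by simpa using h5, by simpa using h6, fun i j => by simpa using h7 i j⟩)
    (fun k s' h => h.1)
    (by
      rintro k s' hk ⟨h1, h2, h3, h4, h5, h6, h7⟩
      obtain ⟨s₁, r₁, F₁, hQ, ht⟩ := filterProg_runs (f := f) (ω := ω) (p := p) h1 h2 h5
      have hd₁ := (F₁.nat 0 (by decide)).trans h1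
      have h25₁ : s₁.real [25, 0, 0] = k * (1 / (d : ℝ) ^ p.mesh) := by
        rw [F₁.real _ (by simp [cls]), h5]
      have h26₁ : s₁.real [26, 0, 0] = (S k).next := by rw [F₁.real _ (by simp [cls]), h6]
      have hm₁ : ∀ i : Fin d, s₁.real [14, i, 0] = m i := fun i => by
        rw [F₁.real _ (by simp [cls]), h3]
      have h19₁ : ∀ i j : Fin d, s₁.real [19, i, j] = B i j := fun i j => by
        rw [F₁.real _ (by simp [cls]), h2]
      have h4₁ : s₁.nat 4 = (S k).count := by rw [F₁.nat 4 (by decide), h4]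
      have ho₁ : ∀ i : ℕ, ∀ j : Fin d, s₁.real [i, j] = (S k).out i j := fun i j => by
        rw [F₁.real _ (by simp [cls]), h7]
      have htest : (BExpr.and (.not (.realLt (num 24) (.div (.lit 1) (.lit 4))))
          (.not (.realLt (num 25) (num 26)))).Holds s₁ ↔
          (1 / 4 ≤ (spectralFilter (d ^ p.power) B (k * (1 / (d : ℝ) ^ p.mesh))).trace ∧
            (S k).next ≤ k * (1 / (d : ℝ) ^ p.mesh)) := by
        simp only [BExpr.Holds, RExpr.eval, num, sc, evalAddr, NExpr.eval, List.map_cons,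
          List.map_nil, ht, h25₁, h26₁, not_lt, Rat.cast_one, Rat.cast_ofNat]
      have hstep : S (k + 1) =
          if 1 / 4 ≤ (spectralFilter (d ^ p.power) B (k * (1 / (d : ℝ) ^ p.mesh))).trace ∧
            (S k).next ≤ k * (1 / (d : ℝ) ^ p.mesh)
          then ⟨(S k).count + 1, k * (1 / (d : ℝ) ^ p.mesh) + 1 / (d : ℝ) ^ p.skip,
            Function.update (S k).out (S k).count
              (extract (spectralFilter (d ^ p.power) B (k * (1 / (d : ℝ) ^ p.mesh))) m)⟩
          else S k := rfl
      obtain ⟨s₂, r₂, hd₂, h19, h14, h4', h25, h26, h32, ho⟩ : ∃ s₂, Runs f ω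
          (.ite (.and (.not (.realLt (num 24) (.div (.lit 1) (.lit 4))))
              (.not (.realLt (num 25) (num 26))))
            (.seq extractProg
              (.seq (.setNat 4 (.add (.reg 4) (.lit 1)))
                (setScalar 26 (.add (num 25) (.div (.lit 1) (dpow p.skip))))))
            .skip) s₁ (2 * tabCost d d 1 + tabCost d 1 1 + d * 3 + 9) s₂ ∧ s₂.nat 0 = d ∧
          (∀ i j : Fin d, s₂.real [19, i, j] = B i j) ∧
          (∀ i : Fin d, s₂.real [14, i, 0] = m i) ∧ s₂.nat 4 = (S (k + 1)).count ∧
          s₂.real [25, 0, 0] = k * (1 / (d : ℝ) ^ p.mesh) ∧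
          s₂.real [26, 0, 0] = (S (k + 1)).next ∧ s₂.real [32, 0, 0] = s₁.real [32, 0, 0] ∧
          ∀ i : ℕ, ∀ j : Fin d, s₂.real [i, j] = (S (k + 1)).out i j := by
        by_cases hb : (BExpr.and (.not (.realLt (num 24) (.div (.lit 1) (.lit 4))))
          (.not (.realLt (num 25) (num 26)))).Holds s₁
        · obtain ⟨s₂, r₂, F₂, ho₂, hk₂⟩ := extractProg_runs (f := f) (ω := ω) hd₁ hQ hm₁ ht
          have hd₂ := (F₂.nat 0 (by decide)).trans hd₁
          obtain ⟨n, hn, r⟩ := r₂.seq ((Runs.setNat 4 (.add (.reg 4) (.lit 1)) s₂).seq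
            (Runs.setReal (sc 26) (.add (num 25) (.div (.lit 1) (dpow p.skip))) _))
          refine ⟨_, ⟨n + 1, by omega, .iteTrue hb r⟩, ?_, ?_, ?_, ?_, ?_, ?_, ?_, ?_⟩
          · simpa using hd₂
          · intro i j; simp [sc, evalAddr, NExpr.eval, F₂.real, cls, h19₁]
          · intro i; simp [sc, evalAddr, NExpr.eval, F₂.real, cls, hm₁]
          · rw [hstep, if_pos (htest.1 hb)]
            simp [NExpr.eval, F₂.nat, h4₁]
          · simp [sc, evalAddr, NExpr.eval, F₂.real, cls, h25₁]
          · rw [hstep, if_pos (htest.1 hb)]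
            simp only [RExpr.eval]
            rw [dpow_eval (d := d) (by simpa using hd₂)]
            simp [sc, num, evalAddr, NExpr.eval, RExpr.eval, F₂.real, cls, h25₁]
          · simp [sc, evalAddr, NExpr.eval, F₂.real, cls]
          · intro i j
            rw [hstep, if_pos (htest.1 hb)]
            simp only [sc, evalAddr, NExpr.eval, List.map_cons, List.map_nil]
            rw [Function.update_of_ne (by simp)]
            by_cases hi : i = s₁.nat 4
            · rw [hi, ho₂ j, h4₁, Function.update_self]
            · rw [hk₂ i j hi, Function.update_of_ne (by rwa [← h4₁]), ho₁]
        · refine ⟨s₁, ⟨1 + 1, by omega, .iteFalse hb (.skip s₁)⟩, hd₁, h19₁, hm₁, ?_, h25₁, ?_, rfl,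
            ?_⟩ <;> rw [hstep, if_neg (htest.not.1 hb)] <;> assumption
      obtain ⟨s₃, r₃, F₃, -, h₃⟩ := setScalar_runs (f := f) (ω := ω) (dst := 25)
        (g := .add (num 25) (.div (.lit 1) (dpow p.mesh))) (s := s₂)
      refine ⟨s₃, (r₁.seq (r₂.seq r₃)).mono (by unfold scanCost; omega), ?_, ?_, ?_, ?_, ?_, ?_, ?_,
        ?_⟩
      · rw [F₃.real _ (by simp [cls]), h32, F₁.real _ (by simp [cls])]
      · rw [F₃.nat 0 (by decide), hd₂]
      · intro i j; rw [F₃.real _ (by simp [cls]), h19]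
      · intro i; rw [F₃.real _ (by simp [cls]), h14]
      · rw [F₃.nat 4 (by decide), h4']
      · rw [h₃]
        simp only [RExpr.eval, dpow_eval hd₂]
        simp [num, sc, RExpr.eval, evalAddr, NExpr.eval, h25]
        ring
      · rw [F₃.real _ (by simp [cls]), h26]
      · intro i j; rw [F₃.real _ (by simp [cls]), ho])
    (s := s) ⟨hd, hB, hm, h4, by simpa using h0 _ (by simp [cls]),
      by simpa [hS, scan] using h0 [26, 0, 0] (by simp [cls]),
      fun i j => by simpa [hS, scan] using h0 [i, j] (by simp [cls])⟩
  exact ⟨s', r, fun i j => h i j⟩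

/-- The program computes the learned vectors. -/
theorem learner_runs : ∃ s, Runs f ω (learner p) (init d t)
    ((tabCost d d 1 + 4 * d + 10) +
      (d ^ p.samples * (4 * tabCost d (d + 1) (d + 1) + d + 12) + 2) +
      (tabCost d d 1 + 2 * tabCost d d d) +
      (d ^ p.rounds * (2 * tabCost d d d + 2) + 2 + tabCost d d d) +
      (8 * d ^ p.mesh * (scanCost p d + 2) + 2)) s ∧
    ∀ i : Fin d, s.output d i = WithLp.toLp 2 (learnedVectors p f t ω i) := by
  have hi : ∀ l, l ≠ [] → (init d t).real l = 0 := fun l hl => by simp [init, hl]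
  have hi' : ∀ n, n ≠ 0 → ∀ l, cls l = n → (init d t).real l = 0 := by
    intro n hn l hl
    apply hi
    rintro rfl
    exact hn (by simpa [cls] using hl.symm)
  obtain ⟨s₁, r₁, F₁, d₁, h6, h7, hv⟩ := setupProg_runs (p := p) (f := f) (t := t) (ω := ω)
  have hd₁ : s₁.nat 0 = d := (F₁.nat 0 (by decide)).trans (by simp [init])
  obtain ⟨s₂, r₂, F₂, h₂⟩ := samplesProg_runs (p := p) (f := f) (ω := ω) hd₁ h6 hv
    (fun l hl => by
      rw [F₁.real l (by revert hl; generalize cls l = n; revert n; simp)]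
      exact hi' _ (by intro h; rw [h] at hl; exact absurd hl (by decide)) l rfl) d₁
  have hd₂ : s₂.nat 0 = d := (F₂.nat 0 (by decide)).trans hd₁
  obtain ⟨s₃, r₃, F₃, h14, h15, h16⟩ := diffProg_runs (p := p) (f := f) (ω := ω) hd₂
    (Φ := learnedLaplace p f t ω) (v := direction p ω)
    (fun σ a ha b hb => by rw [h₂ σ a ha b hb, h7, learnedLaplace])
  have hd₃ : s₃.nat 0 = d := (F₃.nat 0 (by decide)).trans hd₂
  obtain ⟨s₄, r₄, F₄, h19⟩ := richardsonProg_runs (p := p) (f := f) (ω := ω) hd₃ h15 h16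
    (fun l hl => by
      rw [F₃.real l (by rw [hl]; decide), F₂.real l (by rw [hl]; decide),
        F₁.real l (by rw [hl]; decide)]
      exact hi' 17 (by decide) l hl)
  have hd₄ : s₄.nat 0 = d := (F₄.nat 0 (by decide)).trans hd₃
  obtain ⟨s₅, r₅, h₅⟩ := scan_runs (p := p) (f := f) (ω := ω) hd₄ h19
    (fun i => by rw [F₄.real _ (by simp [cls]), h14])
    (by rw [F₄.nat 4 (by decide), F₃.nat 4 (by decide), F₂.nat 4 (by decide),
      F₁.nat 4 (by decide)]; simp [init])
    (fun l hl => by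
      simp only [Finset.mem_insert, Finset.mem_singleton] at hl
      rw [F₄.real l (by rcases hl with h | h | h <;> rw [h] <;> decide),
        F₃.real l (by rcases hl with h | h | h <;> rw [h] <;> decide),
        F₂.real l (by rcases hl with h | h | h <;> rw [h] <;> decide),
        F₁.real l (by rcases hl with h | h | h <;> rw [h] <;> decide)]
      exact hi' _ (by rcases hl with h | h | h <;> rw [h] <;> decide) l rfl)
  refine ⟨s₅, (r₁.seq (r₂.seq (r₃.seq (r₄.seq r₅)))).mono (by omega), fun i => ?_⟩
  ext j
  exact h₅ i j

/-- A function of the dimension that is bounded by a monomial. -/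
def PolyBound (c : ℕ → ℕ) : Prop := ∃ A B : ℕ, ∀ d, 1 ≤ d → c d ≤ A * d ^ B

theorem PolyBound.const (a : ℕ) : PolyBound fun _ => a := ⟨a, 0, fun d _ => by simp⟩

theorem PolyBound.id : PolyBound fun d => d := ⟨1, 1, fun d _ => by simp⟩

theorem PolyBound.add {c c' : ℕ → ℕ} (h : PolyBound c) (h' : PolyBound c') :
    PolyBound fun d => c d + c' d := by
  obtain ⟨A, B, h⟩ := h
  obtain ⟨A', B', h'⟩ := h'
  refine ⟨A + A', B + B', fun d hd => ?_⟩
  have h1 : d ^ B ≤ d ^ (B + B') := Nat.pow_le_pow_right hd (by omega)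
  have h2 : d ^ B' ≤ d ^ (B + B') := Nat.pow_le_pow_right hd (by omega)
  calc c d + c' d ≤ A * d ^ B + A' * d ^ B' := add_le_add (h d hd) (h' d hd)
    _ ≤ A * d ^ (B + B') + A' * d ^ (B + B') := by gcongr
    _ = _ := by ring

theorem PolyBound.mul {c c' : ℕ → ℕ} (h : PolyBound c) (h' : PolyBound c') :
    PolyBound fun d => c d * c' d := by
  obtain ⟨A, B, h⟩ := h
  obtain ⟨A', B', h'⟩ := h'
  exact ⟨A * A', B + B', fun d hd => (Nat.mul_le_mul (h d hd) (h' d hd)).trans_eq (by ring)⟩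

theorem PolyBound.pow (n : ℕ) : PolyBound fun d => d ^ n := ⟨1, n, fun d _ => by simp⟩

theorem PolyBound.tabCost {m₁ m₂ : ℕ → ℕ} (h₁ : PolyBound m₁) (h₂ : PolyBound m₂) :
    PolyBound fun d => RealRAM.tabCost d (m₁ d) (m₂ d) :=
  (h₁.mul ((((h₂.mul (((PolyBound.id.mul (.const 3)).add (.const 4)).add (.const 2))).add
    (.const 2)).add (.const 2)))).add (.const 2)

theorem PolyBound.scanCost (p : Exponents) : PolyBound fun d => RealRAM.scanCost p d := by
  have i := PolyBound.id
  have c := PolyBound.const 1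
  unfold RealRAM.scanCost
  exact (((((PolyBound.const 3).mul (i.tabCost i)).add (((PolyBound.pow _).mul
    (((PolyBound.const 2).mul (i.tabCost i)).add (.const 2))).add (.const 2))).add
    (c.tabCost c)).add (((((PolyBound.const 2).mul (i.tabCost c)).add (c.tabCost c)).add
    (i.mul (.const 3))).add (.const 10)))

/-- The program halts after polynomially many steps, and its outputs are the learned vectors. -/
theorem learner_poly (p : Exponents) : ∃ A B : ℕ, ∀ d : ℕ, 1 ≤ d →
    ∀ (f : EuclideanSpace ℝ (Fin d) → ℝ) (t : ℝ) (ω : ℕ → EuclideanSpace ℝ (Fin d) × ℝ),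
    ∃ (n : ℕ) (s : State), n ≤ A * d ^ B ∧ Exec f ω (learner p) (init d t) n s ∧
      ∀ i : Fin d, s.output d i = WithLp.toLp 2 (learnedVectors p f t ω i) := by
  have i := PolyBound.id
  have i' := PolyBound.id.add (.const 1)
  have c := PolyBound.const 1
  have key : PolyBound fun d => (tabCost d d 1 + 4 * d + 10) +
      (d ^ p.samples * (4 * tabCost d (d + 1) (d + 1) + d + 12) + 2) +
      (tabCost d d 1 + 2 * tabCost d d d) +
      (d ^ p.rounds * (2 * tabCost d d d + 2) + 2 + tabCost d d d) +
      (8 * d ^ p.mesh * (scanCost p d + 2) + 2) :=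
    ((((((i.tabCost c).add ((PolyBound.const 4).mul i)).add (.const 10)).add
      (((PolyBound.pow _).mul ((((PolyBound.const 4).mul (i'.tabCost i')).add i).add
        (.const 12))).add (.const 2))).add
      ((i.tabCost c).add ((PolyBound.const 2).mul (i.tabCost i)))).add
      ((((PolyBound.pow _).mul (((PolyBound.const 2).mul (i.tabCost i)).add (.const 2))).add
        (.const 2)).add (i.tabCost i))).add
      ((((PolyBound.const 8).mul (.pow _)).mul ((PolyBound.scanCost p).add (.const 2))).add
        (.const 2))
  obtain ⟨A, B, h⟩ := key
  refine ⟨A, B, fun d hd f t ω => ?_⟩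
  obtain ⟨s, ⟨n, hn, hs⟩, ho⟩ := learner_runs (p := p) (f := f) (t := t) (ω := ω)
  exact ⟨n, s, hn.trans (h d hd), hs, ho⟩

end
end RealRAM

/-! ### Well-conditioned matrices -/

section Conditioning

open scoped Matrix.Norms.L2Operator

theorem LinearMap.norm_sq_eq_sum_singularValues {n : ℕ} {E F : Type*} [NormedAddCommGroup E]
    [InnerProductSpace ℝ E] [FiniteDimensional ℝ E] [NormedAddCommGroup F] [InnerProductSpace ℝ F]
    [FiniteDimensional ℝ F] (T : E →ₗ[ℝ] F) (hn : Module.finrank ℝ E = n) (x : E) :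
    ‖T x‖ ^ 2 = ∑ i : Fin n, T.singularValues i ^ 2 *
      (inner ℝ (T.isSymmetric_adjoint_comp_self.eigenvectorBasis hn i) x) ^ 2 := by
  set b := T.isSymmetric_adjoint_comp_self.eigenvectorBasis hn with hb
  have h1 : ‖T x‖ ^ 2 = inner ℝ ((LinearMap.adjoint T ∘ₗ T) x) x := by
    rw [LinearMap.comp_apply, LinearMap.adjoint_inner_left, real_inner_self_eq_norm_sq]
  rw [h1, ← b.sum_inner_mul_inner]
  refine Finset.sum_congr rfl fun i _ => ?_
  rw [T.isSymmetric_adjoint_comp_self, hb, LinearMap.IsSymmetric.apply_eigenvectorBasis,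
    T.sq_singularValues_fin hn, inner_smul_right, real_inner_comm x]
  simp; ring

variable {d : ℕ}

theorem Matrix.norm_toLp_mulVec_le (A : Matrix (Fin d) (Fin d) ℝ) (x : Fin d → ℝ) :
    ‖(WithLp.toLp 2 (A.mulVec x) : EuclideanSpace ℝ (Fin d))‖ ≤ ‖A‖ * ‖WithLp.toLp 2 x‖ :=
  A.l2_opNorm_mulVec (WithLp.toLp 2 x)

theorem Matrix.l2_opNorm_le_of_forall {A : Matrix (Fin d) (Fin d) ℝ} {c : ℝ} (hc : 0 ≤ c)
    (h : ∀ x : Fin d → ℝ, ‖(WithLp.toLp 2 (A.mulVec x) : EuclideanSpace ℝ (Fin d))‖ ≤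
      c * ‖WithLp.toLp 2 x‖) : ‖A‖ ≤ c :=
  ContinuousLinearMap.opNorm_le_bound _ hc fun x => h x.ofLp

theorem Matrix.l2_opNorm_transpose (A : Matrix (Fin d) (Fin d) ℝ) : ‖A.transpose‖ = ‖A‖ := by
  rw [← Matrix.l2_opNorm_conjTranspose A]; simp

/-- A square matrix with unit rows is bounded by its condition number, and so is its inverse:
its largest singular value is at least one, and its smallest one is at most one. -/
theorem norm_le_of_condNumber_le (hd : 0 < d) {W : Matrix (Fin d) (Fin d) ℝ} {K : ℝ}
    (hrow : ∀ i, ‖(WithLp.toLp 2 (W i) : EuclideanSpace ℝ (Fin d))‖ = 1) (hdet : IsUnit W.det)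
    (hK : condNumber W ≤ K) : 1 ≤ K ∧ ‖W‖ ≤ K ∧ ‖W⁻¹‖ ≤ K := by
  set T := W.toEuclideanLin with hT
  have hn : Module.finrank ℝ (EuclideanSpace ℝ (Fin d)) = d := by simp
  have hle : ∀ x, ‖T x‖ ^ 2 ≤ (T.singularValues 0 * ‖x‖) ^ 2 := by
    intro x
    rw [T.norm_sq_eq_sum_singularValues hn,
      mul_pow, ← (T.isSymmetric_adjoint_comp_self.eigenvectorBasis hn).sum_sq_inner_right,
      Finset.mul_sum]
    gcongr with i
    · exact T.singularValues_nonneg _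
    · exact T.singularValues_antitone (Nat.zero_le _)
  have hge : ∀ x, (T.singularValues (d - 1) * ‖x‖) ^ 2 ≤ ‖T x‖ ^ 2 := by
    intro x
    rw [T.norm_sq_eq_sum_singularValues hn,
      mul_pow, ← (T.isSymmetric_adjoint_comp_self.eigenvectorBasis hn).sum_sq_inner_right,
      Finset.mul_sum]
    gcongr with i
    · exact T.singularValues_nonneg _
    · exact T.singularValues_antitone (by omega)
  have hTx : ∀ x : Fin d → ℝ, T (WithLp.toLp 2 x) = WithLp.toLp 2 (W.mulVec x) := fun x => rfl
  -- the squares of the entries add up to `d`, so the columns have length one on average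
  have hfrob : ∑ j : Fin d, ‖T (EuclideanSpace.single j 1)‖ ^ 2 = d := by
    have h1 : ∀ i, ∑ j, W i j ^ 2 = 1 := fun i => by
      have := EuclideanSpace.real_norm_sq_eq (WithLp.toLp 2 (W i) : EuclideanSpace ℝ (Fin d))
      rw [hrow i] at this
      simpa using this.symm
    have h2 : ∀ j, ‖T (EuclideanSpace.single j 1)‖ ^ 2 = ∑ i, W i j ^ 2 := fun j => by
      rw [EuclideanSpace.real_norm_sq_eq]
      refine Finset.sum_congr rfl fun i _ => ?_
      have : (T (EuclideanSpace.single j 1)) i = W.mulVec (Pi.single j 1) i := rfl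
      rw [this, Matrix.mulVec_single_one]; rfl
    simp_rw [h2]
    rw [Finset.sum_comm]
    simp [h1]
  have hpos : 0 < T.singularValues (d - 1) := by
    refine T.injective_iff_forall_lt_finrank_singularValues_pos.1 ?_ _ (by rw [hn]; omega)
    intro x y hxy
    have h := congrArg WithLp.ofLp hxy
    change W.mulVec x.ofLp = W.mulVec y.ofLp at h
    have := Matrix.mulVec_injective_iff_isUnit.2 ((Matrix.isUnit_iff_isUnit_det _).2 hdet) h
    exact WithLp.ofLp_injective 2 this
  have h0 : 1 ≤ T.singularValues 0 := by
    by_contra! h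
    have : ∑ j : Fin d, ‖T (EuclideanSpace.single j 1)‖ ^ 2 < ∑ j : Fin d, 1 := by
      refine Finset.sum_lt_sum_of_nonempty ⟨⟨0, hd⟩, Finset.mem_univ _⟩ fun j _ => ?_
      refine (hle _).trans_lt ?_
      simpa using (sq_lt_one_iff₀ (T.singularValues_nonneg 0)).2 h
    simp [hfrob] at this
  have h1 : T.singularValues (d - 1) ≤ 1 := by
    by_contra! h
    have : ∑ j : Fin d, (1 : ℝ) < ∑ j : Fin d, ‖T (EuclideanSpace.single j 1)‖ ^ 2 := by
      refine Finset.sum_lt_sum_of_nonempty ⟨⟨0, hd⟩, Finset.mem_univ _⟩ fun j _ => ?_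
      refine lt_of_lt_of_le ?_ (hge _)
      simpa using (one_lt_sq_iff₀ (T.singularValues_nonneg _)).2 h
    simp [hfrob] at this
  rw [condNumber, ← hT, div_le_iff₀ hpos] at hK
  have hK0 : 0 ≤ K := by
    by_contra! h
    nlinarith
  have hK1 : T.singularValues 0 ≤ K := hK.trans (by nlinarith)
  refine ⟨h0.trans hK1, ?_, ?_⟩
  · refine Matrix.l2_opNorm_le_of_forall hK0 fun x => ?_
    rw [← hTx]
    refine (abs_le_of_sq_le_sq' (hle _) (by positivity)).2.trans ?_
    gcongr
  · refine Matrix.l2_opNorm_le_of_forall hK0 fun x => ?_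
    have := (abs_le_of_sq_le_sq' (hge (WithLp.toLp 2 (W⁻¹.mulVec x))) (norm_nonneg _)).2
    rw [hTx, Matrix.mulVec_mulVec, Matrix.mul_nonsing_inv _ hdet, Matrix.one_mulVec] at this
    have h2 : 1 ≤ K * T.singularValues (d - 1) := h0.trans hK
    calc _ ≤ (K * T.singularValues (d - 1)) * ‖(WithLp.toLp 2 (W⁻¹.mulVec x) :
            EuclideanSpace ℝ (Fin d))‖ := le_mul_of_one_le_left (norm_nonneg _) h2
      _ = K * (T.singularValues (d - 1) * ‖(WithLp.toLp 2 (W⁻¹.mulVec x) :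
            EuclideanSpace ℝ (Fin d))‖) := by ring
      _ ≤ _ := by gcongr

theorem Matrix.abs_entry_le_norm (A : Matrix (Fin d) (Fin d) ℝ) (i j : Fin d) : |A i j| ≤ ‖A‖ := by
  have h := A.norm_toLp_mulVec_le (Pi.single j 1)
  have h1 : ‖(WithLp.toLp 2 (Pi.single j 1) : EuclideanSpace ℝ (Fin d))‖ = 1 := by
    simp
  rw [h1, mul_one] at h
  refine le_trans ?_ h
  have h2 := PiLp.norm_apply_le
    (WithLp.toLp 2 (A.mulVec (Pi.single j 1)) : EuclideanSpace ℝ (Fin d)) i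
  simpa [Matrix.mulVec_single_one] using h2

theorem EuclideanSpace.norm_toLp_le {x : Fin d → ℝ} {ε : ℝ} (h : ∀ i, |x i| ≤ ε) :
    ‖(WithLp.toLp 2 x : EuclideanSpace ℝ (Fin d))‖ ≤ d * ε := by
  rcases Nat.eq_zero_or_pos d with rfl | hd
  · simp [EuclideanSpace.norm_eq]
  have hε : 0 ≤ ε := (abs_nonneg _).trans (h ⟨0, hd⟩)
  rw [EuclideanSpace.norm_eq]
  refine Real.sqrt_le_left (by positivity) |>.2 ?_
  calc ∑ i, ‖x i‖ ^ 2 ≤ ∑ _i : Fin d, ε ^ 2 := by gcongr with i; exact h i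
    _ = d * ε ^ 2 := by simp
    _ ≤ d * (d * ε ^ 2) := by
      have h1 : (1 : ℝ) ≤ d := by exact_mod_cast hd
      gcongr
      exact le_mul_of_one_le_left (sq_nonneg ε) h1
    _ = (d * ε) ^ 2 := by ring

theorem Matrix.norm_le_of_abs_entry_le {A : Matrix (Fin d) (Fin d) ℝ} {ε : ℝ}
    (h : ∀ i j, |A i j| ≤ ε) : ‖A‖ ≤ d ^ 2 * ε := by
  rcases Nat.eq_zero_or_pos d with rfl | hd
  · have : A = 0 := Subsingleton.elim _ _
    simp [this]
  have hε : 0 ≤ ε := (abs_nonneg _).trans (h ⟨0, hd⟩ ⟨0, hd⟩)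
  refine Matrix.l2_opNorm_le_of_forall (by positivity) fun x => ?_
  refine (EuclideanSpace.norm_toLp_le (ε := d * ε * ‖WithLp.toLp 2 x‖) fun i => ?_).trans_eq
    (by ring)
  rw [Matrix.mulVec, dotProduct]
  calc |∑ j, A i j * x j| ≤ ∑ j, |A i j * x j| := Finset.abs_sum_le_sum_abs _ _
    _ ≤ ∑ _j : Fin d, ε * ‖WithLp.toLp 2 x‖ := by
      gcongr with j
      rw [abs_mul]
      gcongr
      · exact h i j
      · simpa using PiLp.norm_apply_le (WithLp.toLp 2 x : EuclideanSpace ℝ (Fin d)) j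
    _ = _ := by simp; ring

theorem Matrix.abs_trace_le (A : Matrix (Fin d) (Fin d) ℝ) : |A.trace| ≤ d * ‖A‖ := by
  calc |A.trace| ≤ ∑ i, |A i i| := Finset.abs_sum_le_sum_abs _ _
    _ ≤ ∑ _i : Fin d, ‖A‖ := by gcongr with i; exact A.abs_entry_le_norm i i
    _ = _ := by simp

end Conditioning

/-! ### Richardson iteration -/

section Richardson

open scoped Matrix.Norms.L2Operator

variable {d : ℕ}

theorem one_sub_mul_richardson (α : ℝ) (A : Matrix (Fin d) (Fin d) ℝ) (n : ℕ) :
    1 - A * richardson α A n = (1 - α • A) ^ n := by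
  induction n with
  | zero => simp [richardson]
  | succ n ih =>
    rw [pow_succ', ← ih, richardson]
    simp only [mul_add, sub_mul, mul_smul_comm, smul_mul_assoc, one_mul, mul_sub, mul_one,
      smul_sub]
    abel

theorem norm_one_sub_smul_le {A : Matrix (Fin d) (Fin d) ℝ} {α m Λ : ℝ} (hα : 0 ≤ α)
    (hpos : ∀ x : EuclideanSpace ℝ (Fin d), m * ‖x‖ ^ 2 ≤
      inner ℝ x (WithLp.toLp 2 (A.mulVec x.ofLp)))
    (hΛ : ‖A‖ ≤ Λ) (hαm : α * Λ ^ 2 ≤ m) (h1 : α * m ≤ 1) : ‖1 - α • A‖ ≤ 1 - α * m / 2 := by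
  refine Matrix.l2_opNorm_le_of_forall (by linarith) fun x => ?_
  set y : EuclideanSpace ℝ (Fin d) := WithLp.toLp 2 x with hy
  have h2 : (WithLp.toLp 2 ((1 - α • A).mulVec x) : EuclideanSpace ℝ (Fin d)) =
      y - α • WithLp.toLp 2 (A.mulVec x) := by
    rw [Matrix.sub_mulVec, Matrix.one_mulVec, Matrix.smul_mulVec]; rfl
  rw [h2]
  have h3 := hpos y
  have h4 : ‖(WithLp.toLp 2 (A.mulVec x) : EuclideanSpace ℝ (Fin d))‖ ≤ Λ * ‖y‖ :=
    (A.norm_toLp_mulVec_le x).trans (by gcongr)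
  have h5 : ‖y - α • (WithLp.toLp 2 (A.mulVec x) : EuclideanSpace ℝ (Fin d))‖ ^ 2 ≤
      ((1 - α * m / 2) * ‖y‖) ^ 2 := by
    rw [norm_sub_sq_real, inner_smul_right, norm_smul, Real.norm_of_nonneg hα]
    have h6 : ‖(WithLp.toLp 2 (A.mulVec x) : EuclideanSpace ℝ (Fin d))‖ ^ 2 ≤ (Λ * ‖y‖) ^ 2 := by
      gcongr
    have h7 : α * (m * ‖y‖ ^ 2) ≤
      α * inner ℝ y (WithLp.toLp 2 (A.mulVec x) : EuclideanSpace ℝ (Fin d)) := by gcongr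
    have h8 : α * (α * Λ ^ 2) * ‖y‖ ^ 2 ≤ α * m * ‖y‖ ^ 2 := by gcongr
    have h9 : α ^ 2 * ‖(WithLp.toLp 2 (A.mulVec x) : EuclideanSpace ℝ (Fin d))‖ ^ 2 ≤
      α ^ 2 * (Λ * ‖y‖) ^ 2 := by gcongr
    nlinarith [sq_nonneg (α * m * ‖y‖)]
  exact (abs_le_of_sq_le_sq' h5 (mul_nonneg (by linarith) (norm_nonneg _))).2

/-- The Richardson iteration for a perturbation `A` of an invertible matrix `M`. The residual
`1 - A X` after `n` rounds is `(1 - α A) ^ n`, which decays because `A` is coercive; and `X - M⁻¹`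
is bounded by the residual and by `A - M`. -/
theorem norm_richardson_sub_inv_le {A M : Matrix (Fin d) (Fin d) ℝ} {α m Λ Λ' ε θ : ℝ} {n : ℕ}
    (hα : 0 ≤ α) (hM : IsUnit M.det) (hΛ' : ‖M⁻¹‖ ≤ Λ') (hε : ‖A - M‖ ≤ ε) (hsmall : Λ' * ε ≤ 1 / 2)
    (hpos : ∀ x : EuclideanSpace ℝ (Fin d), m * ‖x‖ ^ 2 ≤
      inner ℝ x (WithLp.toLp 2 (A.mulVec x.ofLp)))
    (hΛ : ‖A‖ ≤ Λ) (hαm : α * Λ ^ 2 ≤ m) (h1 : α * m ≤ 1)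
    (hθ : Real.exp (-(n * (α * m / 2))) ≤ θ) (hθ1 : θ ≤ 1) :
    ‖richardson α A n - M⁻¹‖ ≤ Λ' * (4 * Λ' * ε + θ) ∧ ‖richardson α A n‖ ≤ 4 * Λ' := by
  set X := richardson α A n with hX
  have hΛ0 : 0 ≤ Λ' := (norm_nonneg _).trans hΛ'
  have hε0 : 0 ≤ ε := (norm_nonneg _).trans hε
  have hres : ‖1 - A * X‖ ≤ θ := by
    rw [hX, one_sub_mul_richardson]
    rcases n with _ | n
    · have h1 : (1 : ℝ) ≤ θ := by simpa using hθ
      rw [pow_zero]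
      refine le_trans ?_ h1
      exact Matrix.l2_opNorm_le_of_forall zero_le_one fun x => by simp
    refine (norm_pow_le' _ (Nat.succ_pos n)).trans ?_
    refine le_trans ?_ hθ
    rw [← mul_neg, Real.exp_nat_mul]
    gcongr
    refine (norm_one_sub_smul_le hα hpos hΛ hαm h1).trans ?_
    linarith [Real.add_one_le_exp (-(α * m / 2))]
  have hMX : X - M⁻¹ = M⁻¹ * ((M - A) * X - (1 - A * X)) := by
    have : M⁻¹ * (M * X) = X := by rw [← mul_assoc, Matrix.nonsing_inv_mul _ hM, one_mul]
    calc X - M⁻¹ = M⁻¹ * (M * X) - M⁻¹ * 1 := by rw [this, mul_one]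
      _ = _ := by rw [← mul_sub]; congr 1; rw [sub_mul]; abel
  have hdiff : ‖X - M⁻¹‖ ≤ Λ' * (ε * ‖X‖ + θ) := by
    rw [hMX]
    refine (norm_mul_le _ _).trans ?_
    gcongr
    refine (norm_sub_le _ _).trans ?_
    gcongr
    refine (norm_mul_le _ _).trans ?_
    gcongr
    rwa [norm_sub_rev]
  have hXn : ‖X‖ ≤ 4 * Λ' := by
    have h2 : ‖X‖ ≤ ‖X - M⁻¹‖ + ‖M⁻¹‖ := by simpa using norm_add_le (X - M⁻¹) M⁻¹
    have h3 : Λ' * ε * ‖X‖ ≤ 1 / 2 * ‖X‖ := by gcongr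
    nlinarith
  refine ⟨hdiff.trans ?_, hXn⟩
  calc Λ' * (ε * ‖X‖ + θ) ≤ Λ' * (ε * (4 * Λ') + θ) := by gcongr
    _ = _ := by ring

end Richardson

/-! ### The spectral filter -/

section Filter

open scoped Matrix.Norms.L2Operator

variable {d : ℕ}

theorem norm_pow_sub_pow_le {R : Type*} [NormedRing R] (h1 : ‖(1 : R)‖ ≤ 1) {X Y : R} {ε : ℝ}
    (hX : ‖X‖ ≤ 1) (hY : ‖Y - X‖ ≤ ε) (N : ℕ) : ‖Y ^ N - X ^ N‖ ≤ (1 + ε) ^ N - 1 := by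
  have hε : 0 ≤ ε := (norm_nonneg _).trans hY
  have hXN : ∀ N, ‖X ^ N‖ ≤ 1 := by
    intro N
    induction N with
    | zero => simpa using h1
    | succ N ih =>
      rw [pow_succ]
      exact (norm_mul_le _ _).trans (mul_le_one₀ ih (norm_nonneg _) hX)
  induction N with
  | zero => simp
  | succ N ih =>
    have hYN : ‖Y ^ N‖ ≤ (1 + ε) ^ N := by
      have := norm_add_le (Y ^ N - X ^ N) (X ^ N)
      rw [sub_add_cancel] at this
      linarith [hXN N]
    have h2 : Y ^ (N + 1) - X ^ (N + 1) = (Y - X) * Y ^ N + X * (Y ^ N - X ^ N) := by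
      rw [pow_succ', pow_succ']; noncomm_ring
    calc ‖Y ^ (N + 1) - X ^ (N + 1)‖ ≤ ε * (1 + ε) ^ N + 1 * ((1 + ε) ^ N - 1) := by
          rw [h2]
          refine (norm_add_le _ _).trans (add_le_add ?_ ?_)
          · exact (norm_mul_le _ _).trans (by gcongr)
          · refine (norm_mul_le _ _).trans (mul_le_mul hX ih (norm_nonneg _) zero_le_one)
      _ = _ := by ring

theorem Matrix.norm_one_le : ‖(1 : Matrix (Fin d) (Fin d) ℝ)‖ ≤ 1 :=
  Matrix.l2_opNorm_le_of_forall zero_le_one fun x => by simp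

theorem inv_mul_pow_mul {W X : Matrix (Fin d) (Fin d) ℝ} (hW : IsUnit W.det) (N : ℕ) :
    (W⁻¹ * X * W) ^ N = W⁻¹ * X ^ N * W := by
  induction N with
  | zero => simp [Matrix.nonsing_inv_mul _ hW]
  | succ N ih =>
    rw [pow_succ, ih, pow_succ]
    have : W * W⁻¹ = 1 := Matrix.mul_nonsing_inv _ hW
    calc W⁻¹ * X ^ N * W * (W⁻¹ * X * W) = W⁻¹ * X ^ N * (W * W⁻¹) * X * W := by noncomm_ring
      _ = _ := by rw [this]; noncomm_ring

/-- The eigenvalues of the spectral filter. -/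
def filterWeight (N : ℕ) (l : Fin d → ℝ) (μ : ℝ) (i : Fin d) : ℝ := (1 - (l i - μ) ^ 2 / 64) ^ N

/-- The filter of a perturbation of a diagonalizable matrix. In the eigenbasis, the matrix to be
raised to a power is a perturbation of a diagonal contraction. -/
theorem norm_spectralFilter_sub_le {W B : Matrix (Fin d) (Fin d) ℝ} {l : Fin d → ℝ} {μ L ε : ℝ}
    {N : ℕ} (hW : IsUnit W.det) (hL : 1 ≤ L) (hWL : ‖W‖ ≤ L) (hWL' : ‖W⁻¹‖ ≤ L)
    (hl : ∀ i, |l i - μ| ≤ 8) (hB : ‖B - W⁻¹ * Matrix.diagonal l * W‖ ≤ ε)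
    (hN : N * (L ^ 2 * ε) ≤ 1) (hε1 : L ^ 2 * ε ≤ 1) :
    ‖spectralFilter N B μ - W⁻¹ * Matrix.diagonal (filterWeight N l μ) * W‖ ≤
      2 * L ^ 4 * N * ε := by
  have hε0 : 0 ≤ ε := (norm_nonneg _).trans hB
  have hWW : W * W⁻¹ = 1 := Matrix.mul_nonsing_inv _ hW
  have hWW' : W⁻¹ * W = 1 := Matrix.nonsing_inv_mul _ hW
  set E := W * (B - W⁻¹ * Matrix.diagonal l * W) * W⁻¹ with hE
  set D : Matrix (Fin d) (Fin d) ℝ := Matrix.diagonal fun i => l i - μ with hD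
  set X : Matrix (Fin d) (Fin d) ℝ := Matrix.diagonal fun i => 1 - (l i - μ) ^ 2 / 64 with hX
  have hEn : ‖E‖ ≤ L ^ 2 * ε := by
    calc ‖E‖ ≤ ‖W‖ * ‖B - W⁻¹ * Matrix.diagonal l * W‖ * ‖W⁻¹‖ :=
          (norm_mul_le _ _).trans (by gcongr; exact norm_mul_le _ _)
      _ ≤ L * ε * L := by gcongr
      _ = _ := by ring
  have hDn : ‖D‖ ≤ 8 := by
    rw [hD, Matrix.l2_opNorm_diagonal]
    exact (pi_norm_le_iff_of_nonneg (by norm_num)).2 fun i => hl i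
  have hDD : D * D = Matrix.diagonal fun i => (l i - μ) ^ 2 := by
    rw [hD, Matrix.diagonal_mul_diagonal]; simp only [sq]
  have hXD : X = 1 - (1 / 64 : ℝ) • (D * D) := by
    rw [hDD, hX, ← Matrix.diagonal_one, ← Matrix.diagonal_smul, Matrix.diagonal_sub]
    congr 1; ext i; simp; ring
  have hXn : ‖X‖ ≤ 1 := by
    rw [hX, Matrix.l2_opNorm_diagonal]
    refine (pi_norm_le_iff_of_nonneg (by norm_num)).2 fun i => ?_
    rw [Real.norm_eq_abs, abs_le]
    have := abs_le.1 (hl i)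
    constructor <;> nlinarith [sq_nonneg (l i - μ)]
  have hBD : B - μ • 1 = W⁻¹ * (D + E) * W := by
    have h1 : W⁻¹ * E * W = B - W⁻¹ * Matrix.diagonal l * W := by
      calc W⁻¹ * E * W = (W⁻¹ * W) * (B - W⁻¹ * Matrix.diagonal l * W) * (W⁻¹ * W) := by
            rw [hE]; noncomm_ring
        _ = _ := by rw [hWW']; simp
    have h2 : W⁻¹ * D * W = W⁻¹ * Matrix.diagonal l * W - μ • 1 := by
      have : D = Matrix.diagonal l - μ • 1 := by
        rw [hD, Matrix.smul_one_eq_diagonal, Matrix.diagonal_sub]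
      rw [this, mul_sub, sub_mul, mul_smul_comm, smul_mul_assoc, mul_one, hWW']
    rw [mul_add, add_mul, h1, h2]; abel
  set Y := 1 - (1 / 64 : ℝ) • ((D + E) * (D + E)) with hY
  have hC : 1 - (1 / 64 : ℝ) • ((B - μ • 1) * (B - μ • 1)) = W⁻¹ * Y * W := by
    have : (B - μ • 1) * (B - μ • 1) = W⁻¹ * ((D + E) * (D + E)) * W := by
      rw [hBD]
      calc _ = W⁻¹ * (D + E) * (W * W⁻¹) * (D + E) * W := by noncomm_ring
        _ = _ := by rw [hWW]; noncomm_ring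
    rw [this, hY, mul_sub, sub_mul, mul_smul_comm, smul_mul_assoc, mul_one, hWW']
  have hYX : ‖Y - X‖ ≤ L ^ 2 * ε := by
    have h1 : Y - X = -((1 / 64 : ℝ) • (D * E + E * D + E * E)) := by
      rw [hY, hXD, ← smul_neg]
      have : (D + E) * (D + E) = D * D + (D * E + E * D + E * E) := by noncomm_ring
      rw [this, smul_add, smul_neg]; abel
    rw [h1, norm_neg, norm_smul]
    have h2 : ‖D * E + E * D + E * E‖ ≤ 8 * (L ^ 2 * ε) + (L ^ 2 * ε) * 8 + 1 * (L ^ 2 * ε) := by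
      refine (norm_add₃_le).trans (add_le_add (add_le_add ?_ ?_) ?_)
      · exact (norm_mul_le _ _).trans (by gcongr)
      · exact (norm_mul_le _ _).trans (by gcongr)
      · exact (norm_mul_le _ _).trans (by gcongr; exact hEn.trans hε1)
    have h3 : 0 ≤ L ^ 2 * ε := by positivity
    rw [Real.norm_of_nonneg (by norm_num)]
    linarith
  have hpow := norm_pow_sub_pow_le Matrix.norm_one_le hXn hYX N
  have hexp : (1 + L ^ 2 * ε) ^ N - 1 ≤ 2 * (N * (L ^ 2 * ε)) := by
    have h0 : 0 ≤ N * (L ^ 2 * ε) := by positivity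
    have h1 : (1 + L ^ 2 * ε) ^ N ≤ Real.exp (N * (L ^ 2 * ε)) := by
      rw [Real.exp_nat_mul]
      gcongr
      linarith [Real.add_one_le_exp (L ^ 2 * ε)]
    have h2 := Real.abs_exp_sub_one_le (x := N * (L ^ 2 * ε)) (by rwa [abs_of_nonneg h0])
    rw [abs_of_nonneg h0] at h2
    linarith [le_abs_self (Real.exp (N * (L ^ 2 * ε)) - 1)]
  have hXN : X ^ N = Matrix.diagonal (filterWeight N l μ) := by
    rw [hX, Matrix.diagonal_pow]; rfl
  rw [spectralFilter, hC, inv_mul_pow_mul hW, ← hXN, ← sub_mul, ← mul_sub]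
  calc ‖W⁻¹ * (Y ^ N - X ^ N) * W‖ ≤ ‖W⁻¹‖ * ‖Y ^ N - X ^ N‖ * ‖W‖ :=
        (norm_mul_le _ _).trans (by gcongr; exact norm_mul_le _ _)
    _ ≤ L * (2 * (N * (L ^ 2 * ε))) * L := by
        gcongr
        exact hpow.trans hexp
    _ = _ := by ring

/-- The spectral projection with the number `i` of `W⁻¹ diag(l) W`. -/
def spectralProj (W : Matrix (Fin d) (Fin d) ℝ) (i : Fin d) : Matrix (Fin d) (Fin d) ℝ :=
  W⁻¹ * Matrix.diagonal (Pi.single i 1) * W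

theorem norm_spectralProj_le {W : Matrix (Fin d) (Fin d) ℝ} {L : ℝ} (hWL : ‖W‖ ≤ L)
    (hWL' : ‖W⁻¹‖ ≤ L) (i : Fin d) : ‖spectralProj W i‖ ≤ L ^ 2 := by
  have hL : 0 ≤ L := (norm_nonneg _).trans hWL
  calc ‖spectralProj W i‖ ≤ ‖W⁻¹‖ * ‖(Matrix.diagonal (Pi.single i 1) :
        Matrix (Fin d) (Fin d) ℝ)‖ * ‖W‖ :=
        (norm_mul_le _ _).trans (by gcongr; exact norm_mul_le _ _)
    _ ≤ L * 1 * L := by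
      gcongr
      rw [Matrix.l2_opNorm_diagonal]
      refine (pi_norm_le_iff_of_nonneg zero_le_one).2 fun j => ?_
      rcases eq_or_ne j i with rfl | h <;> simp [*]
    _ = _ := by ring

theorem filterWeight_nonneg {N : ℕ} {l : Fin d → ℝ} {μ : ℝ} (hl : ∀ i, |l i - μ| ≤ 8) (i : Fin d) :
    0 ≤ filterWeight N l μ i := by
  have := abs_le.1 (hl i)
  exact pow_nonneg (by nlinarith) _

theorem filterWeight_le {N : ℕ} {l : Fin d → ℝ} {μ r κ : ℝ} (hl : ∀ i, |l i - μ| ≤ 8) {i : Fin d}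
    (hr : 0 ≤ r) (hi : r ≤ |l i - μ|) (hκ : Real.exp (-(N * (r ^ 2 / 64))) ≤ κ) :
    filterWeight N l μ i ≤ κ := by
  refine le_trans ?_ hκ
  rw [← mul_neg, Real.exp_nat_mul, filterWeight]
  have h1 := abs_le.1 (hl i)
  have h2 : r ^ 2 ≤ (l i - μ) ^ 2 := by rw [← sq_abs (l i - μ)]; gcongr
  gcongr
  · nlinarith
  · linarith [Real.add_one_le_exp (-(r ^ 2 / 64))]

/-- If the trace of the filter is not small then `μ` is close to one eigenvalue, and the normalized
filter is close to the spectral projection of that eigenvalue. -/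
theorem exists_spectralProj_of_trace {W Q : Matrix (Fin d) (Fin d) ℝ} {l : Fin d → ℝ}
    {μ L ε η κ : ℝ} {N : ℕ} (hW : IsUnit W.det) (hL : 1 ≤ L) (hWL : ‖W‖ ≤ L) (hWL' : ‖W⁻¹‖ ≤ L)
    (hl : ∀ i, |l i - μ| ≤ 8) (hη : 0 < η) (hgap : ∀ i j, i ≠ j → η ≤ |l i - l j|)
    (hκ : Real.exp (-(N * ((η / 8) ^ 2 / 64))) ≤ κ) (hκd : 8 * d * κ < 1)
    (hQ : ‖Q - W⁻¹ * Matrix.diagonal (filterWeight N l μ) * W‖ ≤ ε) (hεd : 8 * d * ε ≤ 1)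
    (htr : 1 / 4 ≤ Q.trace) :
    ∃ i, |l i - μ| ≤ η / 8 ∧ ‖(Q.trace)⁻¹ • Q - spectralProj W i‖ ≤ 8 * d * L ^ 2 * (ε + κ) := by
  have hε0 : 0 ≤ ε := (norm_nonneg _).trans hQ
  have hκ0 : 0 ≤ κ := (Real.exp_pos _).le.trans hκ
  have hd : 0 < d := by
    rcases Nat.eq_zero_or_pos d with rfl | h
    · rw [Matrix.trace] at htr; norm_num at htr
    · exact h
  set q := filterWeight N l μ with hq
  have hWW : W * W⁻¹ = 1 := Matrix.mul_nonsing_inv _ hW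
  have htrace : ∀ v : Fin d → ℝ, (W⁻¹ * Matrix.diagonal v * W).trace = ∑ i, v i := by
    intro v
    rw [Matrix.trace_mul_comm, ← mul_assoc, hWW, one_mul, Matrix.trace_diagonal]
  have htr' : |Q.trace - ∑ i, q i| ≤ d * ε := by
    rw [← htrace, ← Matrix.trace_sub]
    exact (Matrix.abs_trace_le _).trans (by gcongr)
  obtain ⟨i, hi⟩ : ∃ i, |l i - μ| ≤ η / 8 := by
    by_contra! h
    have : ∑ i, q i ≤ d * κ := by
      calc ∑ i, q i ≤ ∑ _i : Fin d, κ := by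
            gcongr with i
            exact filterWeight_le hl (by positivity) (h i).le hκ
        _ = _ := by simp
    have := abs_le.1 htr'
    linarith
  have hoff : ∀ j, j ≠ i → q j ≤ κ := by
    intro j hj
    refine filterWeight_le hl (by positivity) ?_ hκ
    have h1 := hgap j i hj
    have h2 := abs_sub_le (l j) μ (l i)
    rw [abs_sub_comm μ (l i)] at h2
    linarith
  have hP := norm_spectralProj_le hWL hWL' i
  have hsum : |∑ j, q j - q i| ≤ d * κ := by
    rw [← Finset.add_sum_erase _ _ (Finset.mem_univ i), add_sub_cancel_left,
      abs_of_nonneg (Finset.sum_nonneg fun j _ => filterWeight_nonneg hl j)]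
    calc ∑ j ∈ Finset.univ.erase i, q j ≤ ∑ _j ∈ Finset.univ.erase i, κ :=
          Finset.sum_le_sum fun j hj => hoff j (Finset.ne_of_mem_erase hj)
      _ ≤ ∑ _j : Fin d, κ := Finset.sum_le_sum_of_subset_of_nonneg (Finset.erase_subset _ _)
          fun _ _ _ => hκ0
      _ = _ := by simp
  have hQi : ‖Q - q i • spectralProj W i‖ ≤ ε + L ^ 2 * κ := by
    have h1 : Q - q i • spectralProj W i = (Q - W⁻¹ * Matrix.diagonal q * W) +
        W⁻¹ * Matrix.diagonal (q - Pi.single i (q i)) * W := by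
      have : q i • spectralProj W i = W⁻¹ * Matrix.diagonal (Pi.single i (q i)) * W := by
        rw [spectralProj, ← smul_mul_assoc, ← mul_smul_comm, ← Matrix.diagonal_smul,
          ← Pi.single_smul]
        simp
      have h3 : (Matrix.diagonal (q - Pi.single i (q i)) : Matrix (Fin d) (Fin d) ℝ) =
          Matrix.diagonal q - Matrix.diagonal (Pi.single i (q i)) := by
        rw [Matrix.diagonal_sub]; rfl
      rw [this, h3, mul_sub, sub_mul]; abel
    rw [h1]
    refine (norm_add_le _ _).trans (add_le_add hQ ?_)
    calc _ ≤ ‖W⁻¹‖ * ‖Matrix.diagonal (q - Pi.single i (q i))‖ * ‖W‖ :=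
          (norm_mul_le _ _).trans (by gcongr; exact norm_mul_le _ _)
      _ ≤ L * κ * L := by
        gcongr
        rw [Matrix.l2_opNorm_diagonal]
        refine (pi_norm_le_iff_of_nonneg hκ0).2 fun j => ?_
        rcases eq_or_ne j i with rfl | h
        · simpa using hκ0
        · simpa [h, abs_of_nonneg (filterWeight_nonneg hl j), hq] using hoff j h
      _ = _ := by ring
  refine ⟨i, hi, ?_⟩
  have hs : 0 < Q.trace := by linarith
  have h1 : (Q.trace)⁻¹ • Q - spectralProj W i =
      (Q.trace)⁻¹ • ((Q - q i • spectralProj W i) + (q i - Q.trace) • spectralProj W i) := by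
    rw [sub_smul, sub_add_sub_cancel, smul_sub, smul_smul, inv_mul_cancel₀ hs.ne', one_smul]
  have h2 : |q i - Q.trace| ≤ d * κ + d * ε := by
    have h3 := abs_le.1 htr'
    have h4 := abs_le.1 hsum
    rw [abs_le]
    constructor <;> linarith
  have hd1 : (1 : ℝ) ≤ d := by exact_mod_cast hd
  have hinv : (Q.trace)⁻¹ ≤ 4 := by
    rw [inv_le_comm₀ hs (by norm_num)]; linarith
  rw [h1, norm_smul, Real.norm_of_nonneg (by positivity)]
  calc (Q.trace)⁻¹ * ‖(Q - q i • spectralProj W i) + (q i - Q.trace) • spectralProj W i‖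
      ≤ 4 * ((ε + L ^ 2 * κ) + (d * κ + d * ε) * L ^ 2) := by
        gcongr
        refine (norm_add_le _ _).trans (add_le_add hQi ?_)
        rw [norm_smul]
        gcongr
        exact h2
    _ ≤ 4 * ((d * L ^ 2 * ε + d * (L ^ 2 * κ)) + (d * κ + d * ε) * L ^ 2) := by
        have h4 : 1 ≤ d * L ^ 2 := one_le_mul_of_one_le_of_one_le hd1 (one_le_pow₀ hL)
        have h5 : ε ≤ d * L ^ 2 * ε := le_mul_of_one_le_left hε0 h4
        have h6 : L ^ 2 * κ ≤ d * (L ^ 2 * κ) := le_mul_of_one_le_left (by positivity) hd1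
        linarith
    _ = _ := by ring

/-- The filter is detected by its trace if `μ` is very close to an eigenvalue. -/
theorem trace_spectralFilter_ge {W Q : Matrix (Fin d) (Fin d) ℝ} {l : Fin d → ℝ}
    {μ ε r : ℝ} {N : ℕ} (hW : IsUnit W.det) (hl : ∀ i, |l i - μ| ≤ 8)
    (hQ : ‖Q - W⁻¹ * Matrix.diagonal (filterWeight N l μ) * W‖ ≤ ε) (hεd : 8 * d * ε ≤ 1)
    {i : Fin d} (hi : |l i - μ| ≤ r) (hr : N * (r ^ 2 / 64) ≤ 1 / 2) :
    1 / 4 ≤ Q.trace := by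
  set q := filterWeight N l μ with hq
  have hWW : W * W⁻¹ = 1 := Matrix.mul_nonsing_inv _ hW
  have htr' : |Q.trace - ∑ i, q i| ≤ d * ε := by
    have : ∑ i, q i = (W⁻¹ * Matrix.diagonal q * W).trace := by
      rw [Matrix.trace_mul_comm, ← mul_assoc, hWW, one_mul, Matrix.trace_diagonal]
    rw [this, ← Matrix.trace_sub]
    exact (Matrix.abs_trace_le _).trans (by gcongr)
  have h1 : q i ≤ ∑ i, q i :=
    Finset.single_le_sum (fun j _ => filterWeight_nonneg hl j) (Finset.mem_univ i)
  have h2 : 1 / 2 ≤ q i := by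
    have hr0 : 0 ≤ r := (abs_nonneg _).trans hi
    have h3 : (l i - μ) ^ 2 ≤ r ^ 2 := by rw [← sq_abs (l i - μ)]; gcongr
    have h4 := abs_le.1 (hl i)
    have h5 := one_add_mul_le_pow (a := -((l i - μ) ^ 2 / 64)) (by nlinarith) N
    have h6 : N * ((l i - μ) ^ 2 / 64) ≤ N * (r ^ 2 / 64) := by gcongr
    calc (1 : ℝ) / 2 ≤ 1 + N * -((l i - μ) ^ 2 / 64) := by linarith
      _ ≤ _ := h5
      _ = q i := by rw [hq, filterWeight]; ring
  have := abs_le.1 htr'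
  linarith

end Filter

/-! ### Extraction of the columns -/

section Extract

open scoped Matrix.Norms.L2Operator

variable {d : ℕ}

theorem extract_eq (Q : Matrix (Fin d) (Fin d) ℝ) (m : Fin d → ℝ) :
    let R := (Q.trace)⁻¹ • Q
    let p : EuclideanSpace ℝ (Fin d) := WithLp.toLp 2 (R.transpose.mulVec m)
    (WithLp.toLp 2 (extract Q m) : EuclideanSpace ℝ (Fin d)) =
      (‖p‖ * √‖p‖)⁻¹ • WithLp.toLp 2 (R.mulVec p.ofLp) := by
  intro R p
  have hp : ∀ a, p a = (∑ b, Q b a * m b) / Q.trace := by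
    intro a
    simp [p, R, Matrix.mulVec, dotProduct, mul_assoc, div_eq_inv_mul,
      Finset.mul_sum]
  have hn : ‖p‖ = √(∑ a, (∑ b, Q b a * m b) / Q.trace * ((∑ b, Q b a * m b) / Q.trace)) := by
    rw [EuclideanSpace.norm_eq]
    congr 1
    refine Finset.sum_congr rfl fun a _ => ?_
    rw [hp, Real.norm_eq_abs, sq_abs, sq]
  ext a
  simp only [extract, PiLp.smul_apply, smul_eq_mul, hn]
  rw [div_eq_inv_mul]
  congr 1
  simp only [R, Matrix.mulVec, dotProduct, hp, Matrix.smul_apply, smul_eq_mul, div_eq_inv_mul,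
    Finset.mul_sum, mul_assoc]

theorem abs_inv_mul_sqrt_sub_le {r c δ L : ℝ} (hL : 1 ≤ L) (hc : 1 / L ≤ c) (hcL : c ≤ L)
    (hr : |r - c| ≤ δ) (hδ : δ ≤ 1 / (2 * L)) :
    (r * √r)⁻¹ ≤ 4 * L ^ 2 ∧ |(r * √r)⁻¹ - (c * √c)⁻¹| ≤ 16 * L ^ 5 * δ := by
  have hL0 : 0 < L := by linarith
  have h1L : 1 / (2 * L) + 1 / (2 * L) = 1 / L := by field_simp; norm_num
  have h2L : 1 / (2 * L) ≤ 1 := by rw [div_le_one (by positivity)]; linarith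
  have hδ0 : 0 ≤ δ := (abs_nonneg _).trans hr
  have hrc := abs_le.1 hr
  have hr1 : 1 / (2 * L) ≤ r := by linarith
  have hr2 : r ≤ 2 * L := by linarith
  have hp : 0 < 1 / (2 * L) := by positivity
  have hr0 : 0 < r := hp.trans_le hr1
  have hc0 : 0 < c := by linarith [hp]
  have hs : ∀ x : ℝ, 1 / (2 * L) ≤ x → 1 / (2 * L) ≤ √x := fun x hx => by
    refine Real.le_sqrt_of_sq_le ((sq_le hp.le h2L).trans hx)
  have hs2 : ∀ x : ℝ, x ≤ 2 * L → √x ≤ 2 * L := fun x hx => by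
    refine Real.sqrt_le_left (by positivity) |>.2 (hx.trans ?_)
    nlinarith
  have hg : 1 / (4 * L ^ 2) ≤ r * √r := by
    calc 1 / (4 * L ^ 2) = 1 / (2 * L) * (1 / (2 * L)) := by field_simp; norm_num
      _ ≤ _ := mul_le_mul hr1 (hs r hr1) hp.le hr0.le
  have hgc : 1 / L ^ 2 ≤ c * √c := by
    calc 1 / L ^ 2 = 1 / L * (1 / L) := by field_simp
      _ ≤ _ := by
        refine mul_le_mul hc (Real.le_sqrt_of_sq_le (le_trans (sq_le ?_ ?_) hc)) ?_ hc0.le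
        · positivity
        · rw [div_le_one hL0]; exact hL
        · positivity
  have hinvr : (r * √r)⁻¹ ≤ 4 * L ^ 2 := by
    rw [inv_le_comm₀ (by positivity) (by positivity)]; simpa using hg
  have hinvc : (c * √c)⁻¹ ≤ L ^ 2 := by
    rw [inv_le_comm₀ (by positivity) (by positivity)]; simpa using hgc
  refine ⟨hinvr, ?_⟩
  have hdiff : |c * √c - r * √r| ≤ δ * (4 * L) := by
    have h1 : (√r + √c) * (√r - √c) = r - c := by
      have := Real.sq_sqrt hr0.le
      have := Real.sq_sqrt hc0.le
      linear_combination Real.sq_sqrt hr0.le - Real.sq_sqrt hc0.le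
    have h2 : |√r - √c| * √c ≤ δ := by
      calc |√r - √c| * √c ≤ |√r - √c| * (√r + √c) := by
            gcongr; linarith [Real.sqrt_nonneg r]
        _ = |r - c| := by rw [← h1, abs_mul, abs_of_nonneg (a := √r + √c) (by positivity), mul_comm]
        _ ≤ δ := hr
    have h3 : r * √r - c * √c = (r - c) * √r + √c * ((√r - √c) * √c) := by
      linear_combination (√r - √c) * (-(Real.sq_sqrt hc0.le))
    rw [abs_sub_comm, h3]
    calc _ ≤ |r - c| * √r + √c * (|√r - √c| * √c) := by
          refine (abs_add_le _ _).trans_eq ?_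
          rw [abs_mul, abs_mul, abs_mul, abs_of_nonneg (Real.sqrt_nonneg r),
            abs_of_nonneg (Real.sqrt_nonneg c)]
      _ ≤ δ * (2 * L) + (2 * L) * δ := by
          gcongr
          · exact hs2 r hr2
          · exact hs2 c (by linarith)
      _ = _ := by ring
  rw [inv_sub_inv (by positivity) (by positivity), abs_div, div_eq_mul_inv,
    abs_of_pos (a := r * √r * (c * √c)) (by positivity), mul_inv]
  calc _ ≤ δ * (4 * L) * (4 * L ^ 2 * L ^ 2) := by
        gcongr
    _ = _ := by ring

theorem spectralProj_apply (W : Matrix (Fin d) (Fin d) ℝ) (i a b : Fin d) :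
    spectralProj W i a b = W⁻¹ a i * W i b := by
  simp [spectralProj, Matrix.mul_apply, Matrix.diagonal_apply, Pi.single_apply]

theorem targetMatrix_apply {W : Matrix (Fin d) (Fin d) ℝ} {c : Finset (Fin d) → ℝ}
    (hc : ∀ i, 0 < c {i}) (a i : Fin d) : targetMatrix W c a i = W⁻¹ a i / √(c {i}) := by
  rw [targetMatrix, Matrix.mul_inv_rev, Matrix.inv_diagonal, Matrix.mul_diagonal]
  have : IsUnit fun i => √(c {i}) := by
    rw [Pi.isUnit_iff]
    exact fun i => (Real.sqrt_pos.2 (hc i)).ne'.isUnit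
  rw [Ring.inverse_of_isUnit this, div_eq_mul_inv]
  simp

/-- With the exact projection `u wᵀ` and the exact first moment `∑ cᵢ wᵢ`, the extraction yields a
column of the target matrix, because `(u wᵀ)ᵀ ∑ cᵢ wᵢ = cᵢ w`; and it is stable. -/
theorem norm_extract_sub_le {W Q : Matrix (Fin d) (Fin d) ℝ} {c : Finset (Fin d) → ℝ}
    {m : Fin d → ℝ} {i : Fin d} {L ε : ℝ} (hL : 1 ≤ L) (hdL : d ≤ L)
    (hrow : ∀ i, ‖(WithLp.toLp 2 (W i) : EuclideanSpace ℝ (Fin d))‖ = 1) (hW : IsUnit W.det)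
    (hWL : ‖W‖ ≤ L) (hWL' : ‖W⁻¹‖ ≤ L) (hc : ∀ i, 1 / L ≤ c {i} ∧ c {i} ≤ L)
    (hQ : ‖(Q.trace)⁻¹ • Q - spectralProj W i‖ ≤ ε)
    (hm : ‖(WithLp.toLp 2 m - WithLp.toLp 2 (W.transpose.mulVec fun j => c {j}) :
      EuclideanSpace ℝ (Fin d))‖ ≤ ε) (hε : ε ≤ 1 / (6 * L ^ 4)) :
    ‖(WithLp.toLp 2 (extract Q m) - WithLp.toLp 2 (fun a => targetMatrix W c a i) :
      EuclideanSpace ℝ (Fin d))‖ ≤ 68 * L ^ 11 * ε := by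
  have hL0 : 0 < L := by linarith
  have hε0 : 0 ≤ ε := (norm_nonneg _).trans hQ
  have hε1 : ε ≤ 1 := hε.trans (by
    rw [div_le_one (by positivity)]
    have := one_le_pow₀ hL (n := 4); linarith)
  have hc0 : ∀ i, 0 < c {i} := fun i => lt_of_lt_of_le (by positivity) (hc i).1
  rw [extract_eq]
  set R := (Q.trace)⁻¹ • Q
  set P := spectralProj W i with hP
  set m₀ := W.transpose.mulVec fun j => c {j} with hm₀
  set p : EuclideanSpace ℝ (Fin d) := WithLp.toLp 2 (R.transpose.mulVec m) with hp
  set p₀ : EuclideanSpace ℝ (Fin d) := WithLp.toLp 2 (P.transpose.mulVec m₀) with hp₀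
  have hp₀' : p₀ = c {i} • (WithLp.toLp 2 (W i) : EuclideanSpace ℝ (Fin d)) := by
    have h1 : P.transpose.mulVec m₀ = c {i} • W i := by
      have h2 : P.transpose.mulVec m₀ = W.transpose.mulVec
          ((Matrix.diagonal (Pi.single i 1)).mulVec
            ((W⁻¹.transpose * W.transpose).mulVec fun j => c {j})) := by
        rw [hP, spectralProj, Matrix.transpose_mul, Matrix.transpose_mul, Matrix.diagonal_transpose,
          hm₀]
        simp only [Matrix.mulVec_mulVec, mul_assoc]
      rw [h2, ← Matrix.transpose_mul, Matrix.mul_nonsing_inv _ hW, Matrix.transpose_one,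
        Matrix.one_mulVec]
      ext a
      simp [Matrix.mulVec, dotProduct, Matrix.diagonal_apply, Pi.single_apply, mul_comm]
    rw [hp₀, h1]; rfl
  have hp₀n : ‖p₀‖ = c {i} := by
    rw [hp₀', norm_smul, hrow, mul_one, Real.norm_of_nonneg (hc0 i).le]
  have hz : (c {i} * √(c {i}))⁻¹ • (WithLp.toLp 2 (P.mulVec p₀.ofLp) : EuclideanSpace ℝ (Fin d)) =
      WithLp.toLp 2 (fun a => targetMatrix W c a i) := by
    have hww : ∑ b, W i b * W i b = 1 := by
      have := EuclideanSpace.real_norm_sq_eq (WithLp.toLp 2 (W i) : EuclideanSpace ℝ (Fin d))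
      rw [hrow i] at this
      simpa [sq] using this.symm
    ext a
    have h1 : P.mulVec p₀.ofLp a = c {i} * W⁻¹ a i := by
      rw [hp₀', Matrix.mulVec, dotProduct]
      simp only [hP, spectralProj_apply, PiLp.smul_apply, smul_eq_mul]
      calc ∑ b, W⁻¹ a i * W i b * (c {i} * W i b) = c {i} * W⁻¹ a i * ∑ b, W i b * W i b := by
            rw [Finset.mul_sum]; exact Finset.sum_congr rfl fun b _ => by ring
        _ = _ := by rw [hww, mul_one]
    simp only [PiLp.smul_apply, smul_eq_mul, h1, targetMatrix_apply hc0]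
    have := (hc0 i).ne'
    have := (Real.sqrt_pos.2 (hc0 i)).ne'
    field_simp
  have hPn : ‖P‖ ≤ L ^ 2 := norm_spectralProj_le hWL hWL' i
  have hm₀n : ‖(WithLp.toLp 2 m₀ : EuclideanSpace ℝ (Fin d))‖ ≤ L ^ 3 := by
    refine (Matrix.norm_toLp_mulVec_le _ _).trans ?_
    rw [Matrix.l2_opNorm_transpose]
    calc _ ≤ L * (d * L) := by
          gcongr
          exact EuclideanSpace.norm_toLp_le fun j => by
            rw [abs_of_pos (hc0 j)]; exact (hc j).2
      _ ≤ L * (L * L) := by gcongr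
      _ = _ := by ring
  have hmul : ∀ (A B : Matrix (Fin d) (Fin d) ℝ) (x y : EuclideanSpace ℝ (Fin d)),
      ‖(WithLp.toLp 2 (A.mulVec x.ofLp) - WithLp.toLp 2 (B.mulVec y.ofLp) :
        EuclideanSpace ℝ (Fin d))‖ ≤ ‖A - B‖ * ‖x‖ + ‖B‖ * ‖x - y‖ := by
    intro A B x y
    have : (WithLp.toLp 2 (A.mulVec x.ofLp) - WithLp.toLp 2 (B.mulVec y.ofLp) :
        EuclideanSpace ℝ (Fin d)) = WithLp.toLp 2 ((A - B).mulVec x.ofLp) +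
        WithLp.toLp 2 (B.mulVec (x - y).ofLp) := by
      rw [Matrix.sub_mulVec, WithLp.ofLp_sub, Matrix.mulVec_sub]
      simp
    rw [this]
    exact (norm_add_le _ _).trans (add_le_add (Matrix.norm_toLp_mulVec_le _ _)
      (Matrix.norm_toLp_mulVec_le _ _))
  have hmn : ‖(WithLp.toLp 2 m : EuclideanSpace ℝ (Fin d))‖ ≤ 2 * L ^ 3 := by
    have h1 := norm_add_le (WithLp.toLp 2 m - WithLp.toLp 2 m₀ : EuclideanSpace ℝ (Fin d))
      (WithLp.toLp 2 m₀)
    rw [sub_add_cancel] at h1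
    have := one_le_pow₀ hL (n := 3)
    linarith
  have h3 : ‖p - p₀‖ ≤ 3 * L ^ 3 * ε := by
    refine (hmul _ _ (WithLp.toLp 2 m) (WithLp.toLp 2 m₀)).trans ?_
    rw [← Matrix.transpose_sub, Matrix.l2_opNorm_transpose, Matrix.l2_opNorm_transpose]
    calc _ ≤ ε * (2 * L ^ 3) + L ^ 2 * ε := by gcongr
      _ ≤ ε * (2 * L ^ 3) + L ^ 3 * ε := by gcongr; norm_num
      _ = _ := by ring
  have h3' : |‖p‖ - c {i}| ≤ 3 * L ^ 3 * ε := by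
    rw [← hp₀n]; exact (abs_norm_sub_norm_le _ _).trans h3
  have h3'' : 3 * L ^ 3 * ε ≤ 1 / (2 * L) := by
    calc 3 * L ^ 3 * ε ≤ 3 * L ^ 3 * (1 / (6 * L ^ 4)) := by gcongr
      _ = _ := by field_simp; norm_num
  obtain ⟨hg1, hg2⟩ := abs_inv_mul_sqrt_sub_le hL (hc i).1 (hc i).2 h3' h3''
  have hpn : ‖p‖ ≤ 2 * L := by
    have := (abs_le.1 h3').2
    have : 1 / (2 * L) ≤ L := by
      rw [div_le_iff₀ (by positivity)]; nlinarith
    linarith [(hc i).2]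
  have h4 : ‖(WithLp.toLp 2 (R.mulVec p.ofLp) - WithLp.toLp 2 (P.mulVec p₀.ofLp) :
      EuclideanSpace ℝ (Fin d))‖ ≤ 5 * L ^ 5 * ε := by
    refine (hmul _ _ p p₀).trans ?_
    have h5 : L ≤ L ^ 5 := le_self_pow₀ hL (by norm_num)
    calc _ ≤ ε * (2 * L) + L ^ 2 * (3 * L ^ 3 * ε) := by gcongr
      _ ≤ ε * (2 * L ^ 5) + L ^ 2 * (3 * L ^ 3 * ε) := by gcongr
      _ = _ := by ring
  have h6 : ‖(WithLp.toLp 2 (P.mulVec p₀.ofLp) : EuclideanSpace ℝ (Fin d))‖ ≤ L ^ 3 := by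
    refine (Matrix.norm_toLp_mulVec_le _ _).trans ?_
    change ‖P‖ * ‖p₀‖ ≤ _
    rw [hp₀n]
    calc _ ≤ L ^ 2 * L := by
          gcongr
          · exact (hc0 i).le
          · exact (hc i).2
      _ = _ := by ring
  rw [← hz]
  have hfin : ∀ (α β : ℝ) (x y : EuclideanSpace ℝ (Fin d)),
      α • x - β • y = α • (x - y) + (α - β) • y := by
    intro α β x y; rw [smul_sub, sub_smul]; abel
  rw [hfin]
  refine (norm_add_le _ _).trans ?_
  rw [norm_smul, norm_smul, Real.norm_of_nonneg (by positivity), Real.norm_eq_abs]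
  have h7 : L ^ 7 ≤ L ^ 11 := pow_le_pow_right₀ hL (by norm_num)
  refine (add_le_add (mul_le_mul hg1 h4 (norm_nonneg _) (by positivity))
    (mul_le_mul hg2 h6 (norm_nonneg _) (by positivity))).trans ?_
  calc 4 * L ^ 2 * (5 * L ^ 5 * ε) + 16 * L ^ 5 * (3 * L ^ 3 * ε) * L ^ 3
      = 20 * L ^ 7 * ε + 48 * L ^ 11 * ε := by ring
    _ ≤ 20 * L ^ 11 * ε + 48 * L ^ 11 * ε := by gcongr
    _ = _ := by ring

end Extract

/-! ### The scan of the spectrum -/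

section Scan

variable {d : ℕ}

/-- If every hit of the filter lies near exactly one eigenvalue and gives a good output for it, and
every eigenvalue is hit, then the scan outputs every eigenvalue exactly once: an interval that is
shorter than the gap but longer than a cluster of hits is skipped after an output. -/
theorem exists_perm_scan {mesh skip η : ℝ} {Q : ℝ → Matrix (Fin d) (Fin d) ℝ}
    {z : Matrix (Fin d) (Fin d) ℝ → Fin d → ℝ} {l : Fin d → ℝ} {J : ℕ}
    {Good : (Fin d → ℝ) → Fin d → Prop} (hmesh : 0 ≤ mesh) (hη : 0 < η) (hskip : η / 3 ≤ skip)
    (hskip' : skip ≤ η / 2)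
    (hgap : ∀ i j, i ≠ j → η ≤ |l i - l j|)
    (hhit : ∀ j < J, 1 / 4 ≤ (Q (j * mesh)).trace →
      ∃ i, |l i - j * mesh| ≤ η / 8 ∧ Good (z (Q (j * mesh))) i)
    (hall : ∀ i, ∃ j < J, |l i - j * mesh| ≤ η / 8 ∧ 1 / 4 ≤ (Q (j * mesh)).trace) :
    ∃ π : Equiv.Perm (Fin d), ∀ i : Fin d, Good ((scan mesh skip Q z J).out i) (π i) := by
  -- `φ k` is the eigenvalue of the output with number `k`. The end of the skipped interval lies
  -- beyond all further hits near the eigenvalues that were output, and before any hit near another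
  -- eigenvalue, by the bounds with `η / 6` and `5 η / 8`.
  have key : ∀ n ≤ J, ∃ φ : ℕ → Option (Fin d),
      (∀ k < (scan mesh skip Q z n).count, ∃ i, φ k = some i ∧
        Good ((scan mesh skip Q z n).out k) i ∧ l i + η / 6 < (scan mesh skip Q z n).next) ∧
      (∀ k < (scan mesh skip Q z n).count, ∀ k' < (scan mesh skip Q z n).count,
        φ k = φ k' → k = k') ∧
      (∀ i, ∀ j < n, |l i - j * mesh| ≤ η / 8 → 1 / 4 ≤ (Q (j * mesh)).trace →
        ∃ k < (scan mesh skip Q z n).count, φ k = some i) ∧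
      ((scan mesh skip Q z n).next = 0 ∨ ∃ k < (scan mesh skip Q z n).count, ∃ i, φ k = some i ∧
        (scan mesh skip Q z n).next ≤ l i + 5 * η / 8 ∧ l i ≤ n * mesh + η / 8) := by
    intro n
    induction n with
    | zero => exact fun _ => ⟨fun _ => none, by simp [scan]⟩
    | succ n ih =>
      intro hn
      obtain ⟨φ, h1, h2, h3, h4⟩ := ih (by omega)
      set S := scan mesh skip Q z n with hS
      have hnm : (n : ℝ) * mesh ≤ ((n + 1 : ℕ) : ℝ) * mesh := by push_cast; nlinarith
      have hnn : 0 ≤ (n : ℝ) * mesh := by positivity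
      have hscan : scan mesh skip Q z (n + 1) =
        if 1 / 4 ≤ (Q (n * mesh)).trace ∧ S.next ≤ n * mesh then
          ⟨S.count + 1, n * mesh + skip, Function.update S.out S.count (z (Q (n * mesh)))⟩
        else S := rfl
      by_cases hb : 1 / 4 ≤ (Q (n * mesh)).trace ∧ S.next ≤ n * mesh
      · rw [hscan, if_pos hb]
        obtain ⟨i, hi, hgood⟩ := hhit n (by omega) hb.1
        have hi' := abs_le.1 hi
        have hnew : ∀ k < S.count, φ k ≠ some i := by
          intro k hk he
          obtain ⟨i', hi1, -, hi2⟩ := h1 k hk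
          obtain rfl : i' = i := by rw [hi1] at he; exact Option.some.inj he
          linarith [hb.2]
        refine ⟨Function.update φ S.count (some i), ?_, ?_, ?_, ?_⟩
        · intro k hk
          rcases Nat.lt_succ_iff_lt_or_eq.1 hk with hk | rfl
          · obtain ⟨i', hi1, hi2, hi3⟩ := h1 k hk
            refine ⟨i', by rwa [Function.update_of_ne hk.ne],
              by simpa [Function.update_of_ne hk.ne] using hi2, ?_⟩
            simp only
            linarith [hb.2]
          · refine ⟨i, by simp, by simpa using hgood, ?_⟩
            simp only
            linarith
        · intro k hk k' hk' he
          rcases Nat.lt_succ_iff_lt_or_eq.1 hk with hk | rfl <;>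
            rcases Nat.lt_succ_iff_lt_or_eq.1 hk' with hk' | rfl
          · rw [Function.update_of_ne hk.ne, Function.update_of_ne hk'.ne] at he
            exact h2 k hk k' hk' he
          · rw [Function.update_of_ne hk.ne, Function.update_self] at he
            exact absurd he (hnew k hk)
          · rw [Function.update_of_ne hk'.ne, Function.update_self] at he
            exact absurd he.symm (hnew k' hk')
          · rfl
        · intro i' j hj hij hQj
          rcases Nat.lt_succ_iff_lt_or_eq.1 hj with hj | rfl
          · obtain ⟨k, hk, hφ⟩ := h3 i' j hj hij hQj
            exact ⟨k, Nat.lt_succ_of_lt hk, by rwa [Function.update_of_ne hk.ne]⟩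
          · refine ⟨S.count, Nat.lt_succ_self _, ?_⟩
            rw [Function.update_self]
            congr 1
            by_contra hne
            have h5 := hgap i i' hne
            have h6 := abs_le.1 hij
            have : |l i - l i'| ≤ η / 4 := by rw [abs_le]; constructor <;> linarith
            linarith
        · refine Or.inr ⟨S.count, Nat.lt_succ_self _, i, by simp, ?_, ?_⟩
          · simp only; linarith
          · linarith
      · rw [hscan, if_neg hb]
        refine ⟨φ, h1, h2, ?_, ?_⟩
        · intro i' j hj hij hQj
          rcases Nat.lt_succ_iff_lt_or_eq.1 hj with hj | rfl
          · exact h3 i' j hj hij hQj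
          · have hlt : j * mesh < S.next := by
              by_contra! h
              exact hb ⟨hQj, h⟩
            rcases h4 with h4 | ⟨k, hk, i, hφ, h5, h6⟩
            · linarith
            · refine ⟨k, hk, ?_⟩
              rw [hφ]
              congr 1
              by_contra hne
              have h7 := hgap i i' hne
              have h8 := abs_le.1 hij
              have : |l i - l i'| ≤ 3 * η / 4 := by rw [abs_le]; constructor <;> linarith
              linarith
        · rcases h4 with h4 | ⟨k, hk, i, hφ, h5, h6⟩
          · exact Or.inl h4
          · exact Or.inr ⟨k, hk, i, hφ, h5, by linarith⟩
  obtain ⟨φ, h1, h2, h3, -⟩ := key J le_rfl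
  set S := scan mesh skip Q z J with hS
  choose ψ hψ1 hψ2 _ using h1
  have hsurj : ∀ i, ∃ k : Fin S.count, ψ k k.2 = i := by
    intro i
    obtain ⟨j, hj, hij, hQj⟩ := hall i
    obtain ⟨k, hk, hφ⟩ := h3 i j hj hij hQj
    exact ⟨⟨k, hk⟩, Option.some.inj ((hψ1 k hk).symm.trans hφ)⟩
  have hbij : Function.Bijective fun k : Fin S.count => ψ k k.2 :=
    ⟨fun k k' he => Fin.ext (h2 k k.2 k' k'.2 (by
      rw [hψ1 k k.2, hψ1 k' k'.2]; exact congrArg some he)), hsurj⟩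
  have hcard : S.count = d := by simpa using Fintype.card_of_bijective hbij
  refine ⟨(finCongr hcard.symm).trans (Equiv.ofBijective _ hbij), fun i => ?_⟩
  exact hψ2 i (by rw [hcard]; exact i.2)

end Scan

/-! ### Finite differences of a sum of exponentials -/

section Differences

variable {d : ℕ}

/-- The Laplace transform `∑ cᵢ exp ⟨u, wᵢ⟩` of the measure with weight `cᵢ` at the `i`-th row. -/
def rowLaplace (W : Matrix (Fin d) (Fin d) ℝ) (c : Fin d → ℝ) (u : EuclideanSpace ℝ (Fin d)) : ℝ :=
  ∑ i, c i * Real.exp (W.mulVec u.ofLp i)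

theorem abs_exp_sub_one_div_sub_le {h a : ℝ} (hh : 0 < h) (hh1 : h ≤ 1) (ha : |a| ≤ 1) :
    |(Real.exp (h * a) - 1) / h - a| ≤ h := by
  have h1 : |h * a| ≤ h := by
    rw [abs_mul, abs_of_pos hh]; exact mul_le_of_le_one_right hh.le ha
  have h2 := Real.abs_exp_sub_one_sub_id_le (h1.trans hh1)
  have h3 : (Real.exp (h * a) - 1) / h - a = (Real.exp (h * a) - 1 - h * a) / h := by
    field_simp
  rw [h3, abs_div, abs_of_pos hh, div_le_iff₀ hh]
  refine h2.trans ?_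
  rw [← sq_abs (h * a), sq]
  exact mul_le_mul h1 h1 (abs_nonneg _) hh.le

theorem mulVec_testPoint (W : Matrix (Fin d) (Fin d) ℝ) (h σ : ℝ) (v : EuclideanSpace ℝ (Fin d))
    (a b : ℕ) (i : Fin d) : W.mulVec (testPoint h σ v a b).ofLp i =
      σ * W.mulVec v.ofLp i + h * (if ha : a < d then W i ⟨a, ha⟩ else 0) +
        h * (if hb : b < d then W i ⟨b, hb⟩ else 0) := by
  have key : ∀ a : ℕ, ∑ j : Fin d, W i j * ((if a = (j : ℕ) then (1 : ℝ) else 0) * h) =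
      h * (if ha : a < d then W i ⟨a, ha⟩ else 0) := by
    intro a
    split_ifs with ha
    · rw [Finset.sum_eq_single ⟨a, ha⟩]
      · simp [mul_comm]
      · intro j _ hj
        have : a ≠ (j : ℕ) := fun h => hj (Fin.ext h.symm)
        simp [this]
      · simp
    · rw [mul_zero]
      refine Finset.sum_eq_zero fun j _ => ?_
      have : a ≠ (j : ℕ) := fun h => ha (h ▸ j.2)
      simp [this]
  simp only [Matrix.mulVec, dotProduct, testPoint, mul_add, Finset.sum_add_distrib, key]
  rw [Finset.mul_sum]
  congr 3
  ext j; ring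

/-- The first difference of an approximation to `b + √e ∑ cᵢ exp ⟨u, wᵢ⟩`. -/
theorem abs_firstDiff_sub_le {W : Matrix (Fin d) (Fin d) ℝ} {c : Fin d → ℝ} {h b ε : ℝ}
    {Φ : EuclideanSpace ℝ (Fin d) → ℝ} (hh : 0 < h) (hh1 : h ≤ 1)
    (hW : ∀ i j, |W i j| ≤ 1) (hc : ∀ i, 0 ≤ c i)
    (hΦ : ∀ a b' : ℕ, a ≤ d → b' ≤ d → |Φ (testPoint h 0 0 a b') -
      (b + Real.exp (1 / 2) * rowLaplace W c (testPoint h 0 0 a b'))| ≤ ε) (a : Fin d) :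
    |firstDiff h Φ a - W.transpose.mulVec c a| ≤ (∑ i, c i) * h + 2 * ε / h := by
  have e1 := hΦ a d a.2.le le_rfl
  have e0 := hΦ d d le_rfl le_rfl
  have he : 1 ≤ Real.exp (1 / 2) := Real.one_le_exp (by norm_num)
  have hR : rowLaplace W c (testPoint h 0 0 a d) - rowLaplace W c (testPoint h 0 0 d d) =
      ∑ i, c i * (Real.exp (h * W i a) - 1) := by
    rw [rowLaplace, rowLaplace, ← Finset.sum_sub_distrib]
    refine Finset.sum_congr rfl fun i _ => ?_
    rw [mulVec_testPoint, mulVec_testPoint]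
    simp [mul_sub]
  have hsplit : firstDiff h Φ a - W.transpose.mulVec c a =
      (∑ i, c i * ((Real.exp (h * W i a) - 1) / h - W i a)) +
      ((Φ (testPoint h 0 0 a d) - (b + Real.exp (1 / 2) * rowLaplace W c (testPoint h 0 0 a d))) -
       (Φ (testPoint h 0 0 d d) - (b + Real.exp (1 / 2) * rowLaplace W c (testPoint h 0 0 d d)))) /
        h / Real.exp (1 / 2) := by
    have h1 : ∑ i, c i * ((Real.exp (h * W i a) - 1) / h - W i a) =
        (∑ i, c i * (Real.exp (h * W i a) - 1)) / h - W.transpose.mulVec c a := by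
      rw [Finset.sum_div, Matrix.mulVec, dotProduct, ← Finset.sum_sub_distrib]
      refine Finset.sum_congr rfl fun i _ => ?_
      rw [Matrix.transpose_apply]; ring
    rw [h1, ← hR, firstDiff]
    field_simp
    ring
  rw [hsplit]
  refine (abs_add_le _ _).trans (add_le_add ?_ ?_)
  · rw [Finset.sum_mul]
    refine (Finset.abs_sum_le_sum_abs _ _).trans (Finset.sum_le_sum fun i _ => ?_)
    rw [abs_mul, abs_of_nonneg (hc i)]
    exact mul_le_mul_of_nonneg_left (abs_exp_sub_one_div_sub_le hh hh1 (hW i a)) (hc i)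
  · rw [abs_div, abs_div, abs_of_pos hh, abs_of_pos (Real.exp_pos _)]
    refine (div_le_self (div_nonneg (abs_nonneg _) (by positivity)) he).trans ?_
    gcongr
    refine (abs_sub _ _).trans ?_
    linarith

/-- The second difference of an approximation to `b + √e ∑ cᵢ exp ⟨u, wᵢ⟩`. -/
theorem abs_secondDiff_sub_le {W : Matrix (Fin d) (Fin d) ℝ} {c l : Fin d → ℝ} {h b ε : ℝ}
    {v : EuclideanSpace ℝ (Fin d)}
    {Φ : EuclideanSpace ℝ (Fin d) → ℝ} (hh : 0 < h) (hh1 : h ≤ 1)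
    (hW : ∀ i j, |W i j| ≤ 1) (hc : ∀ i, 0 ≤ c i) (hl : ∀ i, l i = Real.exp (W.mulVec v.ofLp i))
    (hΦ : ∀ a b' : ℕ, a ≤ d → b' ≤ d → |Φ (testPoint h 1 v a b') -
      (b + Real.exp (1 / 2) * rowLaplace W c (testPoint h 1 v a b'))| ≤ ε) (a a' : Fin d) :
    |(secondDiff h v Φ - W.transpose * Matrix.diagonal (fun i => c i * l i) * W) a a'| ≤
      3 * (∑ i, c i * l i) * h + 4 * ε / h ^ 2 := by
  have e1 := hΦ a a' a.2.le a'.2.le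
  have e2 := hΦ a d a.2.le le_rfl
  have e3 := hΦ d a' le_rfl a'.2.le
  have e4 := hΦ d d le_rfl le_rfl
  have he : 1 ≤ Real.exp (1 / 2) := Real.one_le_exp (by norm_num)
  have hl0 : ∀ i, 0 < l i := fun i => by rw [hl]; exact Real.exp_pos _
  set R := rowLaplace W c with hRdef
  have hR : R (testPoint h 1 v a a') - R (testPoint h 1 v a d) - R (testPoint h 1 v d a') +
      R (testPoint h 1 v d d) =
      ∑ i, c i * l i * ((Real.exp (h * W i a) - 1) * (Real.exp (h * W i a') - 1)) := by
    simp only [hRdef, rowLaplace]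
    rw [← Finset.sum_sub_distrib, ← Finset.sum_sub_distrib, ← Finset.sum_add_distrib]
    refine Finset.sum_congr rfl fun i _ => ?_
    simp only [mulVec_testPoint, hl, Fin.is_lt, dite_true, lt_irrefl, dite_false, Fin.eta,
      Real.exp_add, one_mul, mul_zero, Real.exp_zero]
    ring
  have hsplit : (secondDiff h v Φ - W.transpose * Matrix.diagonal (fun i => c i * l i) * W) a a' =
      (∑ i, c i * l i * ((Real.exp (h * W i a) - 1) / h * ((Real.exp (h * W i a') - 1) / h) -
        W i a * W i a')) +
      ((Φ (testPoint h 1 v a a') - (b + Real.exp (1 / 2) * R (testPoint h 1 v a a'))) -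
       (Φ (testPoint h 1 v a d) - (b + Real.exp (1 / 2) * R (testPoint h 1 v a d))) -
       (Φ (testPoint h 1 v d a') - (b + Real.exp (1 / 2) * R (testPoint h 1 v d a'))) +
       (Φ (testPoint h 1 v d d) - (b + Real.exp (1 / 2) * R (testPoint h 1 v d d)))) /
        h ^ 2 / Real.exp (1 / 2) := by
    have h1 : ∑ i, c i * l i * ((Real.exp (h * W i a) - 1) / h * ((Real.exp (h * W i a') - 1) / h) -
        W i a * W i a') =
        (∑ i, c i * l i * ((Real.exp (h * W i a) - 1) * (Real.exp (h * W i a') - 1))) / h ^ 2 -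
          (W.transpose * Matrix.diagonal (fun i => c i * l i) * W) a a' := by
      rw [Finset.sum_div, Matrix.mul_apply, ← Finset.sum_sub_distrib]
      refine Finset.sum_congr rfl fun i _ => ?_
      rw [Matrix.mul_diagonal, Matrix.transpose_apply]
      field_simp
    rw [h1, ← hR, Matrix.sub_apply, secondDiff]
    field_simp
    ring
  rw [hsplit]
  refine (abs_add_le _ _).trans (add_le_add ?_ ?_)
  · rw [Finset.mul_sum, Finset.sum_mul]
    refine (Finset.abs_sum_le_sum_abs _ _).trans (Finset.sum_le_sum fun i _ => ?_)
    have hcl : 0 ≤ c i * l i := mul_nonneg (hc i) (hl0 i).le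
    rw [abs_mul, abs_of_nonneg hcl]
    have h1 := abs_exp_sub_one_div_sub_le hh hh1 (hW i a)
    have h2 := abs_exp_sub_one_div_sub_le hh hh1 (hW i a')
    set x := (Real.exp (h * W i a) - 1) / h
    set y := (Real.exp (h * W i a') - 1) / h
    have h3 : |y| ≤ 2 := by
      have := abs_sub_abs_le_abs_sub y (W i a')
      linarith [hW i a']
    have h4 : |x * y - W i a * W i a'| ≤ 3 * h := by
      have : x * y - W i a * W i a' = (x - W i a) * y + W i a * (y - W i a') := by ring
      rw [this]
      refine (abs_add_le _ _).trans ?_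
      rw [abs_mul, abs_mul]
      have h5 : |x - W i a| * |y| ≤ h * 2 := mul_le_mul h1 h3 (abs_nonneg _) hh.le
      have h6 : |W i a| * |y - W i a'| ≤ 1 * h := mul_le_mul (hW i a) h2 (abs_nonneg _) zero_le_one
      linarith
    calc c i * l i * |x * y - W i a * W i a'| ≤ c i * l i * (3 * h) := by gcongr
      _ = _ := by ring
  · rw [abs_div, abs_div, abs_of_pos (by positivity : 0 < h ^ 2), abs_of_pos (Real.exp_pos _)]
    refine (div_le_self (div_nonneg (abs_nonneg _) (by positivity)) he).trans ?_
    gcongr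
    rw [abs_le] at *
    constructor <;> linarith

end Differences

/-! ### Recovery from approximate moments -/

section Recovery

open scoped Matrix.Norms.L2Operator

variable {d : ℕ}

theorem pow_mul_one_div_pow {L : ℝ} (hL : 0 < L) (a b : ℕ) :
    L ^ a * (1 / L ^ (a + b)) = 1 / L ^ b := by
  rw [pow_add]; field_simp

theorem exp_neg_le_one_div_pow {L y : ℝ} {n : ℕ} (hL : 1 ≤ L) (hn : n ≤ L) (hy : L ^ 2 ≤ y) :
    Real.exp (-y) ≤ 1 / L ^ n := by
  have hL0 : 0 < L := by linarith
  rw [Real.exp_neg, ← one_div]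
  apply one_div_le_one_div_of_le (by positivity)
  calc L ^ n = Real.exp (n * Real.log L) := by
        rw [mul_comm, Real.exp_mul, Real.exp_log hL0, Real.rpow_natCast]
    _ ≤ Real.exp (L * L) := by
        have h1 := Real.log_le_sub_one_of_pos hL0
        have h2 := Real.log_nonneg hL
        gcongr
        linarith
    _ ≤ _ := by rw [← sq]; gcongr

/-- The matrix `∑ cᵢ wᵢ wᵢᵀ` and its positivity. -/
theorem le_inner_gram {W A : Matrix (Fin d) (Fin d) ℝ} {c : Fin d → ℝ} {L ε : ℝ} (hL : 0 < L)
    (hW : IsUnit W.det) (hWL' : ‖W⁻¹‖ ≤ L) (hc : ∀ i, 1 / L ≤ c i)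
    (hA : ‖A - W.transpose * Matrix.diagonal c * W‖ ≤ ε) (x : EuclideanSpace ℝ (Fin d)) :
    (1 / L ^ 3 - ε) * ‖x‖ ^ 2 ≤ inner ℝ x (WithLp.toLp 2 (A.mulVec x.ofLp)) := by
  set M := W.transpose * Matrix.diagonal c * W with hM
  have h1 : ‖x‖ ≤ L * ‖(WithLp.toLp 2 (W.mulVec x.ofLp) : EuclideanSpace ℝ (Fin d))‖ := by
    have h := W⁻¹.norm_toLp_mulVec_le (W.mulVec x.ofLp)
    rw [Matrix.mulVec_mulVec, Matrix.nonsing_inv_mul _ hW, Matrix.one_mulVec] at h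
    exact h.trans (by gcongr)
  have h2 : inner ℝ x (WithLp.toLp 2 (M.mulVec x.ofLp) : EuclideanSpace ℝ (Fin d)) =
      ∑ i, c i * (W.mulVec x.ofLp i) ^ 2 := by
    rw [EuclideanSpace.inner_eq_star_dotProduct, hM, mul_assoc, ← Matrix.mulVec_mulVec,
      ← Matrix.mulVec_mulVec]
    simp only [star_trivial]
    rw [Matrix.mulVec_transpose, ← Matrix.dotProduct_mulVec, dotProduct]
    refine Finset.sum_congr rfl fun i _ => ?_
    rw [Matrix.mulVec_diagonal]; ring
  have h3 : 1 / L ^ 3 * ‖x‖ ^ 2 ≤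
      inner ℝ x (WithLp.toLp 2 (M.mulVec x.ofLp) : EuclideanSpace ℝ (Fin d)) := by
    rw [h2]
    calc 1 / L ^ 3 * ‖x‖ ^ 2
        ≤ 1 / L ^ 3 * (L * ‖(WithLp.toLp 2 (W.mulVec x.ofLp) : EuclideanSpace ℝ (Fin d))‖) ^ 2 := by
          gcongr
      _ = 1 / L * ∑ i, (W.mulVec x.ofLp i) ^ 2 := by
          rw [mul_pow, EuclideanSpace.real_norm_sq_eq]; field_simp
      _ ≤ _ := by
          rw [Finset.mul_sum]
          gcongr with i
          exact hc i
  have h4 : |inner ℝ x (WithLp.toLp 2 ((A - M).mulVec x.ofLp) : EuclideanSpace ℝ (Fin d))| ≤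
      ε * ‖x‖ ^ 2 := by
    refine (abs_real_inner_le_norm _ _).trans ?_
    have := (A - M).norm_toLp_mulVec_le x.ofLp
    calc _ ≤ ‖x‖ * (ε * ‖x‖) := by gcongr; exact this.trans (by gcongr)
      _ = _ := by ring
  have h5 : (WithLp.toLp 2 (A.mulVec x.ofLp) : EuclideanSpace ℝ (Fin d)) =
      WithLp.toLp 2 (M.mulVec x.ofLp) + WithLp.toLp 2 ((A - M).mulVec x.ofLp) := by
    rw [Matrix.sub_mulVec, ← WithLp.toLp_add]; congr 1; abel
  rw [h5, inner_add_right]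
  have := (abs_le.1 h4).1
  linarith

theorem norm_transpose_mul_diagonal_mul_le {W : Matrix (Fin d) (Fin d) ℝ} {c : Fin d → ℝ}
    {L r : ℝ} (hWL : ‖W‖ ≤ L) (hr : 0 ≤ r) (hc : ∀ i, |c i| ≤ r) :
    ‖W.transpose * Matrix.diagonal c * W‖ ≤ L ^ 2 * r := by
  have hL : 0 ≤ L := (norm_nonneg _).trans hWL
  have h1 : ‖Matrix.diagonal c‖ ≤ r := by
    rw [Matrix.l2_opNorm_diagonal]
    exact (pi_norm_le_iff_of_nonneg hr).2 hc
  calc _ ≤ ‖W.transpose‖ * ‖Matrix.diagonal c‖ * ‖W‖ :=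
        (norm_mul_le _ _).trans (by gcongr; exact norm_mul_le _ _)
    _ ≤ L * r * L := by rw [Matrix.l2_opNorm_transpose]; gcongr
    _ = _ := by ring

/-- The product of the Richardson iterate for the approximate `∑ cᵢ wᵢ wᵢᵀ` and of the approximate
`∑ cᵢ lᵢ wᵢ wᵢᵀ` is close to the matrix `W⁻¹ diag(l) W`. -/
theorem norm_richardson_mul_sub_le {W A A' : Matrix (Fin d) (Fin d) ℝ} {c l : Fin d → ℝ}
    {L : ℝ} {e n : ℕ} (hL : 128 ≤ L) (hdL : d ≤ L) (heL : (e : ℝ) ≤ L) (he : 6 ≤ e)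
    (hn : (n : ℝ) = L ^ 19) (hW : IsUnit W.det) (hWL : ‖W‖ ≤ L) (hWL' : ‖W⁻¹‖ ≤ L)
    (hc : ∀ i, 1 / L ≤ c i ∧ c i ≤ L) (hl : ∀ i, 0 ≤ l i ∧ l i ≤ 3)
    (hA : ∀ a b, |(A - W.transpose * Matrix.diagonal c * W) a b| ≤ 1 / L ^ e)
    (hA' : ∀ a b, |(A' - W.transpose * Matrix.diagonal (fun i => c i * l i) * W) a b| ≤
      1 / L ^ e) :
    ‖richardson (1 / L ^ 12) A n * A' - W⁻¹ * Matrix.diagonal l * W‖ ≤ L ^ 13 * (1 / L ^ e) := by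
  have hL0 : 0 < L := by linarith
  have hL1 : 1 ≤ L := by linarith
  set ε : ℝ := 1 / L ^ e with hε
  have hε0 : 0 < ε := by positivity
  have hpow : ∀ a b : ℕ, a + b = e → L ^ a * ε = 1 / L ^ b := fun a b h => by
    rw [hε, ← h, pow_mul_one_div_pow hL0]
  have hinv : ∀ a b : ℕ, a ≤ b → 1 / L ^ b ≤ 1 / L ^ a := fun a b h =>
    one_div_le_one_div_of_le (by positivity) (pow_le_pow_right₀ hL1 h)
  have hc0 : ∀ i, 0 < c i := fun i => lt_of_lt_of_le (by positivity) (hc i).1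
  set M := W.transpose * Matrix.diagonal c * W with hM
  set M' := W.transpose * Matrix.diagonal (fun i => c i * l i) * W with hM'
  have hAM : ‖A - M‖ ≤ L ^ 2 * ε :=
    (Matrix.norm_le_of_abs_entry_le hA).trans (by gcongr)
  have hAM' : ‖A' - M'‖ ≤ L ^ 2 * ε :=
    (Matrix.norm_le_of_abs_entry_le hA').trans (by gcongr)
  have hMdet : IsUnit M.det := by
    rw [hM, Matrix.det_mul, Matrix.det_mul, Matrix.det_transpose, Matrix.det_diagonal]
    refine (hW.mul ?_).mul hW
    exact (Finset.prod_ne_zero_iff.2 fun i _ => (hc0 i).ne').isUnit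
  have hMinv : M⁻¹ = W⁻¹ * Matrix.diagonal (fun i => (c i)⁻¹) * W⁻¹.transpose := by
    refine Matrix.inv_eq_right_inv ?_
    have h1 : W.transpose * W⁻¹.transpose = 1 := by
      rw [← Matrix.transpose_mul, Matrix.nonsing_inv_mul _ hW, Matrix.transpose_one]
    have h2 : Matrix.diagonal c * Matrix.diagonal (fun i => (c i)⁻¹) = 1 := by
      rw [Matrix.diagonal_mul_diagonal, ← Matrix.diagonal_one]
      congr 1; ext i; exact mul_inv_cancel₀ (hc0 i).ne'
    calc M * (W⁻¹ * Matrix.diagonal (fun i => (c i)⁻¹) * W⁻¹.transpose) =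
          W.transpose * (Matrix.diagonal c * (W * W⁻¹) *
            Matrix.diagonal (fun i => (c i)⁻¹)) * W⁻¹.transpose := by
          rw [hM]; simp only [mul_assoc]
      _ = 1 := by rw [Matrix.mul_nonsing_inv _ hW, mul_one, h2, mul_one, h1]
  have hMM' : M⁻¹ * M' = W⁻¹ * Matrix.diagonal l * W := by
    have h1 : M' = M * (W⁻¹ * Matrix.diagonal l * W) := by
      calc M' = W.transpose * (Matrix.diagonal c * Matrix.diagonal l) * W := by
            rw [hM', Matrix.diagonal_mul_diagonal]
        _ = W.transpose * Matrix.diagonal c * (W * W⁻¹) * Matrix.diagonal l * W := by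
            rw [Matrix.mul_nonsing_inv _ hW]; simp only [mul_assoc, mul_one]
        _ = _ := by rw [hM]; simp only [mul_assoc]
    rw [h1, ← mul_assoc, Matrix.nonsing_inv_mul _ hMdet, one_mul]
  have hMinvL : ‖M⁻¹‖ ≤ L ^ 3 := by
    have h := norm_transpose_mul_diagonal_mul_le (W := W⁻¹.transpose) (c := fun i => (c i)⁻¹)
      (L := L) (r := L) (by rwa [Matrix.l2_opNorm_transpose]) hL0.le fun i => by
        rw [abs_of_pos (inv_pos.2 (hc0 i)), inv_le_comm₀ (hc0 i) hL0, ← one_div]; exact (hc i).1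
    rw [Matrix.transpose_transpose] at h
    rw [hMinv]
    exact h.trans_eq (by ring)
  have hMn : ‖M‖ ≤ L ^ 3 :=
    (norm_transpose_mul_diagonal_mul_le hWL hL0.le fun i => by
      rw [abs_of_pos (hc0 i)]; exact (hc i).2).trans_eq (by ring)
  have hMn' : ‖M'‖ ≤ L ^ 4 := by
    refine (norm_transpose_mul_diagonal_mul_le hWL (r := L * 3) (by positivity)
      fun i => ?_).trans ?_
    · rw [abs_of_nonneg (mul_nonneg (hc0 i).le (hl i).1)]
      exact mul_le_mul (hc i).2 (hl i).2 (hl i).1 hL0.le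
    · calc L ^ 2 * (L * 3) ≤ L ^ 2 * (L * L) := by gcongr; linarith
        _ = _ := by ring
  -- the Richardson iteration
  set X := richardson (1 / L ^ 12) A n with hX
  have hL2ε : L ^ 2 * ε ≤ 1 / L ^ 4 := by
    rw [hpow 2 (e - 2) (by omega)]; exact hinv _ _ (by omega)
  have h34 : 1 / L ^ 4 ≤ 1 / L ^ 3 - L ^ 2 * ε := by
    have : 2 * (1 / L ^ 4) ≤ 1 / L ^ 3 := by
      rw [pow_succ L 3]
      rw [mul_one_div, div_le_div_iff₀ (by positivity) (by positivity)]
      nlinarith [pow_pos hL0 3]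
    linarith
  obtain ⟨hXM, hXn⟩ : ‖X - M⁻¹‖ ≤ L ^ 3 * (4 * L ^ 3 * (L ^ 2 * ε) + ε) ∧ ‖X‖ ≤ 4 * L ^ 3 := by
    rw [hX]
    refine norm_richardson_sub_inv_le (m := 1 / L ^ 4) (Λ := L ^ 4) (by positivity) hMdet hMinvL hAM
      ?_ ?_ ?_ ?_ ?_ ?_ ?_
    · rw [← mul_assoc, ← pow_add, hpow (3 + 2) (e - 5) (by omega)]
      refine (hinv 1 _ (by omega)).trans ?_
      rw [pow_one]
      exact one_div_le_one_div_of_le (by norm_num) (by linarith)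
    · exact fun x => le_trans (by gcongr) (le_inner_gram hL0 hW hWL' (fun i => (hc i).1) hAM x)
    · have h := norm_add_le (A - M) M
      rw [sub_add_cancel] at h
      have h1 : (1 : ℝ) / L ^ 4 ≤ 1 := by
        rw [div_le_one (by positivity)]; exact one_le_pow₀ hL1
      have h2 : 1 + L ^ 3 ≤ L ^ 4 := by nlinarith [one_le_pow₀ hL1 (n := 3)]
      linarith
    · rw [← pow_mul, one_div_mul_eq_div, div_le_div_iff₀ (by positivity) (by positivity)]
      apply le_of_eq; ring
    · rw [div_mul_div_comm, one_mul, div_le_one (by positivity), ← pow_add]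
      exact one_le_pow₀ hL1
    · refine exp_neg_le_one_div_pow hL1 heL ?_
      rw [hn]
      have : L ^ 19 * (1 / L ^ 12 * (1 / L ^ 4) / 2) = L ^ 2 * (L / 2) := by field_simp
      rw [this]
      exact le_mul_of_one_le_right (by positivity) (by linarith)
    · rw [hε, div_le_one (by positivity)]; exact one_le_pow₀ hL1
  have h1 : X * A' - W⁻¹ * Matrix.diagonal l * W = X * (A' - M') + (X - M⁻¹) * M' := by
    rw [← hMM', mul_sub, sub_mul]; abel
  rw [h1]
  calc _ ≤ ‖X‖ * ‖A' - M'‖ + ‖X - M⁻¹‖ * ‖M'‖ :=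
        (norm_add_le _ _).trans (add_le_add (norm_mul_le _ _) (norm_mul_le _ _))
    _ ≤ 4 * L ^ 3 * (L ^ 2 * ε) + L ^ 3 * (4 * L ^ 3 * (L ^ 2 * ε) + ε) * L ^ 4 := by gcongr
    _ = (4 * L ^ 5 + 4 * L ^ 12 + L ^ 7) * ε := by ring
    _ ≤ (4 * L ^ 12 + 4 * L ^ 12 + L ^ 12) * ε := by
        gcongr <;> first | exact hL1 | norm_num
    _ = 9 * L ^ 12 * ε := by ring
    _ ≤ L * L ^ 12 * ε := by gcongr; linarith
    _ = _ := by ring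

/-- The algorithm recovers the columns of the target from the moments `∑ cᵢ wᵢ`, `∑ cᵢ wᵢ wᵢᵀ` and
`∑ cᵢ lᵢ wᵢ wᵢᵀ`, if these are known up to a small error and the numbers `lᵢ` are well separated.
All parameters are powers of a number `L` that dominates all constants. -/
theorem recoverScan_recovers {W A A' : Matrix (Fin d) (Fin d) ℝ} {c : Finset (Fin d) → ℝ}
    {l m : Fin d → ℝ} {L : ℝ} {s k : ℕ} {p : Exponents} (hL : 128 ≤ L)
    (hdL : d ≤ L) (hkL : ((2 * s + k + 38 : ℕ) : ℝ) ≤ L)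
    (hskip : (d : ℝ) ^ p.skip = L ^ s) (hpower : (d : ℝ) ^ p.power = L ^ (2 * s + 4))
    (hmesh : (d : ℝ) ^ p.mesh = L ^ (2 * s + 4)) (hrelax : (d : ℝ) ^ p.relax = L ^ 12)
    (hrounds : (d : ℝ) ^ p.rounds = L ^ 19)
    (hrow : ∀ i, ‖(WithLp.toLp 2 (W i) : EuclideanSpace ℝ (Fin d))‖ = 1) (hW : IsUnit W.det)
    (hWL : ‖W‖ ≤ L) (hWL' : ‖W⁻¹‖ ≤ L) (hc : ∀ i, 1 / L ≤ c {i} ∧ c {i} ≤ L)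
    (hl : ∀ i, 0 ≤ l i ∧ l i ≤ 3) (hgap : ∀ i j, i ≠ j → 2 / L ^ s ≤ |l i - l j|)
    (hm : ∀ a, |m a - W.transpose.mulVec (fun i => c {i}) a| ≤ 1 / L ^ (2 * s + k + 38))
    (hA : ∀ a b, |(A - W.transpose * Matrix.diagonal (fun i => c {i}) * W) a b| ≤
      1 / L ^ (2 * s + k + 38))
    (hA' : ∀ a b, |(A' - W.transpose * Matrix.diagonal (fun i => c {i} * l i) * W) a b| ≤
      1 / L ^ (2 * s + k + 38)) :
    ∃ π : Equiv.Perm (Fin d), ∀ i : Fin d,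
      ‖(WithLp.toLp 2 ((recoverScan p m A A').out i) -
        WithLp.toLp 2 (fun a => targetMatrix W c a (π i)) : EuclideanSpace ℝ (Fin d))‖ ≤
          1 / L ^ k := by
  have hL0 : 0 < L := by linarith
  have hL1 : 1 ≤ L := by linarith
  set ε : ℝ := 1 / L ^ (2 * s + k + 38) with hε
  have hε0 : 0 < ε := by positivity
  -- powers of `L` times the error
  have hpow : ∀ a b : ℕ, a + b = 2 * s + k + 38 → L ^ a * ε = 1 / L ^ b := fun a b h => by
    rw [hε, ← h, pow_mul_one_div_pow hL0]
  have hinv : ∀ a b : ℕ, a ≤ b → 1 / L ^ b ≤ 1 / L ^ a := fun a b h =>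
    one_div_le_one_div_of_le (by positivity) (pow_le_pow_right₀ hL1 h)
  set X := richardson (1 / (d : ℝ) ^ p.relax) A (d ^ p.rounds) with hX
  have hB : ‖X * A' - W⁻¹ * Matrix.diagonal l * W‖ ≤ L ^ 13 * ε := by
    rw [hX, hrelax]
    exact norm_richardson_mul_sub_le hL hdL hkL (by omega) (by push_cast; exact hrounds) hW hWL hWL'
      hc hl hA hA'
  set w := 2 * s + 4 with hw
  have hN : ((d ^ p.power : ℕ) : ℝ) = L ^ w := by push_cast; exact hpower
  -- the error of the filter
  set εQ : ℝ := 1 / L ^ (k + 16) with hεQ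
  have hεQ0 : 0 < εQ := by positivity
  have hμ : ∀ j < 8 * d ^ p.mesh, ∀ i, |l i - j * (1 / (d : ℝ) ^ p.mesh)| ≤ 8 := by
    intro j hj i
    have h1 : (j : ℝ) < 8 * L ^ w := by rw [← hmesh]; exact_mod_cast hj
    have h2 : (j : ℝ) * (1 / (d : ℝ) ^ p.mesh) ≤ 8 := by
      rw [hmesh, mul_one_div, div_le_iff₀ (by positivity)]; exact h1.le
    have h3 : 0 ≤ (j : ℝ) * (1 / (d : ℝ) ^ p.mesh) := by positivity
    have := hl i
    rw [abs_le]; constructor <;> linarith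
  have hQ : ∀ μ, (∀ i, |l i - μ| ≤ 8) →
      ‖spectralFilter (d ^ p.power) (X * A') μ -
        W⁻¹ * Matrix.diagonal (filterWeight (d ^ p.power) l μ) * W‖ ≤ εQ := by
    intro μ hμ
    refine (norm_spectralFilter_sub_le hW hL1 hWL hWL' hμ hB ?_ ?_).trans ?_
    · rw [hN, ← mul_assoc, ← mul_assoc, ← pow_add, ← pow_add, hpow _ (k + 19) (by omega),
        div_le_one (by positivity)]
      exact one_le_pow₀ hL1
    · rw [← mul_assoc, ← pow_add, hpow _ (2 * s + k + 23) (by omega), div_le_one (by positivity)]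
      exact one_le_pow₀ hL1
    · rw [hN]
      calc 2 * L ^ 4 * L ^ w * (L ^ 13 * ε) ≤ L * L ^ 4 * L ^ w * (L ^ 13 * ε) := by
            gcongr; linarith
        _ = L ^ (w + 18) * ε := by ring
        _ = _ := hpow _ _ (by omega)
  have h8 : 8 * d * εQ < 1 := by
    calc 8 * d * εQ ≤ 8 * L * εQ := by gcongr
      _ ≤ 8 * L * (1 / L ^ 2) := by gcongr; exact hinv _ _ (by omega)
      _ < 1 := by rw [mul_one_div, div_lt_one (by positivity)]; nlinarith
  set η : ℝ := 2 / L ^ s with hη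
  have hη0 : 0 < η := by positivity
  have hskip' : 1 / (d : ℝ) ^ p.skip = η / 2 := by rw [hskip, hη]; ring
  have hκ : Real.exp (-((d ^ p.power : ℕ) * ((η / 8) ^ 2 / 64))) ≤ εQ := by
    refine exp_neg_le_one_div_pow hL1 (le_trans (Nat.cast_le.2 (by omega)) hkL) ?_
    rw [hN]
    have h1 : L ^ w * ((η / 8) ^ 2 / 64) = L ^ 2 * (L ^ 2 / 1024) := by
      rw [hη, hw, pow_add, pow_mul']; field_simp; norm_num
    rw [h1]
    refine le_mul_of_one_le_right (by positivity) ?_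
    rw [le_div_iff₀ (by norm_num)]
    calc (1 : ℝ) * 1024 ≤ 128 ^ 2 := by norm_num
      _ ≤ L ^ 2 := by gcongr
  refine exists_perm_scan (l := l) (η := η)
    (Good := fun z i => ‖(WithLp.toLp 2 z - WithLp.toLp 2 (fun a => targetMatrix W c a i) :
      EuclideanSpace ℝ (Fin d))‖ ≤ 1 / L ^ k) (by positivity) hη0 (by rw [hskip']; linarith)
      hskip'.le hgap ?_ ?_
  · intro j hj htr
    have hQj := hQ _ (hμ j hj)
    obtain ⟨i, hi, hP⟩ := exists_spectralProj_of_trace (κ := εQ) hW hL1 hWL hWL' (hμ j hj) hη0 hgap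
      hκ h8 hQj h8.le htr
    refine ⟨i, hi, ?_⟩
    have hP' : 8 * d * L ^ 2 * (εQ + εQ) ≤ 1 / L ^ (k + 12) := by
      calc 8 * d * L ^ 2 * (εQ + εQ) ≤ 8 * L * L ^ 2 * (εQ + εQ) := by gcongr
        _ = 16 * (L ^ 3 * εQ) := by ring
        _ ≤ L * (L ^ 3 * εQ) := by gcongr; linarith
        _ = L ^ 4 * εQ := by ring
        _ = _ := by rw [hεQ, show k + 16 = 4 + (k + 12) by ring, pow_mul_one_div_pow hL0]
    have hm' : ‖(WithLp.toLp 2 m - WithLp.toLp 2 (W.transpose.mulVec fun j => c {j}) :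
        EuclideanSpace ℝ (Fin d))‖ ≤ 1 / L ^ (k + 12) := by
      rw [← WithLp.toLp_sub]
      refine (EuclideanSpace.norm_toLp_le hm).trans ?_
      calc d * ε ≤ L ^ 1 * ε := by rw [pow_one]; gcongr
        _ = 1 / L ^ (2 * s + k + 37) := hpow _ _ (by omega)
        _ ≤ _ := hinv _ _ (by omega)
    refine (norm_extract_sub_le hL1 hdL hrow hW hWL hWL' hc (hP.trans hP') hm' ?_).trans ?_
    · calc 1 / L ^ (k + 12) ≤ 1 / L ^ 5 := hinv _ _ (by omega)
        _ ≤ _ := by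
          apply one_div_le_one_div_of_le (by positivity)
          rw [pow_succ' L 4]
          gcongr
          linarith
    · calc 68 * L ^ 11 * (1 / L ^ (k + 12)) ≤ L * L ^ 11 * (1 / L ^ (k + 12)) := by
            gcongr; linarith
        _ = L ^ 12 * (1 / L ^ (12 + k)) := by rw [add_comm k]; ring
        _ = 1 / L ^ k := pow_mul_one_div_pow hL0 _ _
  · intro i
    set x : ℝ := l i * L ^ w with hx
    have hx0 : 0 ≤ x := mul_nonneg (hl i).1 (by positivity)
    have hLw : (1 : ℝ) ≤ L ^ w := one_le_pow₀ hL1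
    have hdist : |l i - (⌊x⌋₊ : ℝ) * (1 / (d : ℝ) ^ p.mesh)| ≤ 1 / L ^ w := by
      have h1 := Nat.floor_le hx0
      have h2 := Nat.lt_floor_add_one x
      have h3 : l i - (⌊x⌋₊ : ℝ) * (1 / (d : ℝ) ^ p.mesh) = (x - ⌊x⌋₊) * (1 / L ^ w) := by
        rw [hmesh, hx]; field_simp
      rw [h3, abs_mul, abs_of_pos (by positivity : 0 < 1 / L ^ w)]
      refine mul_le_of_le_one_left (by positivity) ?_
      rw [abs_le]; constructor <;> linarith
    have hj : ⌊x⌋₊ < 8 * d ^ p.mesh := by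
      rw [Nat.floor_lt hx0]
      push_cast
      rw [hmesh, hx]
      exact mul_lt_mul_of_pos_right ((hl i).2.trans_lt (by norm_num)) (by positivity)
    refine ⟨⌊x⌋₊, hj, hdist.trans ?_, ?_⟩
    · rw [hη, div_div, div_le_div_iff₀ (by positivity) (by positivity)]
      calc 1 * (L ^ s * 8) ≤ 2 * (L ^ s * L) := by nlinarith [pow_pos hL0 s]
        _ = 2 * L ^ (s + 1) := by ring
        _ ≤ 2 * L ^ w := by gcongr; omega
    · refine trace_spectralFilter_ge hW (hμ _ hj) (hQ _ (hμ _ hj)) h8.le hdist ?_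
      rw [hN]
      have : L ^ w * ((1 / L ^ w) ^ 2 / 64) = 1 / L ^ w / 64 := by field_simp
      rw [this]
      have : 1 / L ^ w ≤ 1 := by rw [div_le_one (by positivity)]; exact hLw
      linarith

theorem abs_sub_le_exp_one_mul_abs_exp_sub {x y : ℝ} (hx : -1 ≤ x) (hy : -1 ≤ y) :
    |x - y| ≤ Real.exp 1 * |Real.exp x - Real.exp y| := by
  have key : ∀ {x y : ℝ}, -1 ≤ y → y ≤ x → x - y ≤ Real.exp 1 * (Real.exp x - Real.exp y) := by
    intro x y hy hyx
    have h1 : Real.exp x = Real.exp y * Real.exp (x - y) := by rw [← Real.exp_add]; congr 1; ring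
    have h2 : Real.exp 1 * Real.exp y = Real.exp (1 + y) := by rw [Real.exp_add]
    have h3 : 1 ≤ Real.exp (1 + y) := Real.one_le_exp (by linarith)
    have h4 := Real.add_one_le_exp (x - y)
    rw [h1]
    calc x - y ≤ Real.exp (x - y) - 1 := by linarith
      _ ≤ Real.exp (1 + y) * (Real.exp (x - y) - 1) :=
        le_mul_of_one_le_left (by linarith) h3
      _ = _ := by rw [← h2]; ring
  rcases le_total y x with h | h
  · rw [abs_of_nonneg (by linarith), abs_of_nonneg (by simpa using h)]
    exact key hy h
  · rw [abs_sub_comm, abs_sub_comm (Real.exp x), abs_of_nonneg (by linarith),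
      abs_of_nonneg (by simpa using h)]
    exact key hx h

theorem abs_mulVec_le_norm {W : Matrix (Fin d) (Fin d) ℝ}
    (hrow : ∀ i, ‖(WithLp.toLp 2 (W i) : EuclideanSpace ℝ (Fin d))‖ = 1)
    (v : EuclideanSpace ℝ (Fin d)) (i : Fin d) : |W.mulVec v.ofLp i| ≤ ‖v‖ := by
  have h := abs_real_inner_le_norm v (WithLp.toLp 2 (W i) : EuclideanSpace ℝ (Fin d))
  rw [hrow, mul_one, EuclideanSpace.inner_eq_star_dotProduct] at h
  simpa [Matrix.mulVec] using h

theorem abs_entry_le_one {W : Matrix (Fin d) (Fin d) ℝ}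
    (hrow : ∀ i, ‖(WithLp.toLp 2 (W i) : EuclideanSpace ℝ (Fin d))‖ = 1) (i j : Fin d) :
    |W i j| ≤ 1 := by
  have h := PiLp.norm_apply_le (WithLp.toLp 2 (W i) : EuclideanSpace ℝ (Fin d)) j
  rw [hrow] at h
  simpa using h

/-- The algorithm succeeds if the Laplace transform is known at all test points, up to an additive
constant and a small error, and if the random direction separates the rows of `W`. -/
theorem recoversColumns_of_laplace {W : Matrix (Fin d) (Fin d) ℝ} {c : Finset (Fin d) → ℝ}
    {L b : ℝ} {e s k : ℕ} {p : Exponents} {f : EuclideanSpace ℝ (Fin d) → ℝ} {t : ℝ}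
    {ω : ℕ → EuclideanSpace ℝ (Fin d) × ℝ} (hL : 128 ≤ L)
    (hdL : d ≤ L) (he : e = 2 * s + k + 40) (heL : (e : ℝ) ≤ L)
    (hskip : (d : ℝ) ^ p.skip = L ^ (s + 1)) (hpower : (d : ℝ) ^ p.power = L ^ (2 * s + 6))
    (hmesh : (d : ℝ) ^ p.mesh = L ^ (2 * s + 6)) (hrelax : (d : ℝ) ^ p.relax = L ^ 12)
    (hrounds : (d : ℝ) ^ p.rounds = L ^ 19) (hstep : (d : ℝ) ^ p.step = L ^ (e + 4))
    (hrow : ∀ i, ‖(WithLp.toLp 2 (W i) : EuclideanSpace ℝ (Fin d))‖ = 1) (hW : IsUnit W.det)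
    (hWL : ‖W‖ ≤ L) (hWL' : ‖W⁻¹‖ ≤ L) (hc : ∀ i, 1 / L ≤ c {i} ∧ c {i} ≤ L)
    (hv : ‖direction p ω‖ ≤ 1)
    (hgap : ∀ i j, i ≠ j →
      1 / L ^ s ≤ |W.mulVec (direction p ω).ofLp i - W.mulVec (direction p ω).ofLp j|)
    (hΦ : ∀ v, v = 0 ∨ v = direction p ω → ∀ a a' : ℕ, a ≤ d → a' ≤ d →
      |learnedLaplace p f t ω (testPoint (1 / (d : ℝ) ^ p.step) 1 v a a') -
        (b + Real.exp (1 / 2) * rowLaplace W (fun i => c {i})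
          (testPoint (1 / (d : ℝ) ^ p.step) 1 v a a'))| ≤ 1 / L ^ (3 * e + 9)) :
    RecoversColumns (fun i => WithLp.toLp 2 (learnedVectors p f t ω i)) (targetMatrix W c)
      (1 / L ^ k) := by
  have hL0 : 0 < L := by linarith
  have hL1 : 1 ≤ L := by linarith
  set v := direction p ω with hv'
  set h : ℝ := 1 / (d : ℝ) ^ p.step with hh
  have hhL : h = 1 / L ^ (e + 4) := by rw [hh, hstep]
  have hh0 : 0 < h := by rw [hhL]; positivity
  have hh1 : h ≤ 1 := by rw [hhL, div_le_one (by positivity)]; exact one_le_pow₀ hL1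
  have hW1 := abs_entry_le_one hrow
  have hc0 : ∀ i, 0 ≤ c {i} := fun i => le_trans (by positivity) (hc i).1
  have hwv : ∀ i, |W.mulVec v.ofLp i| ≤ 1 := fun i => (abs_mulVec_le_norm hrow v i).trans hv
  have he3 : Real.exp 1 ≤ 3 := Real.exp_one_lt_d9.le.trans (by norm_num)
  have hl3 : ∀ i, Real.exp (W.mulVec v.ofLp i) ≤ 3 := fun i =>
    (Real.exp_le_exp.2 (abs_le.1 (hwv i)).2).trans he3
  have hinv : ∀ a b : ℕ, a ≤ b → 1 / L ^ b ≤ 1 / L ^ a := fun a b h =>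
    one_div_le_one_div_of_le (by positivity) (pow_le_pow_right₀ hL1 h)
  have hsucc : ∀ {x : ℝ}, x ≤ 9 * (1 / L ^ (e + 2)) + 4 * (1 / L ^ (e + 1)) → x ≤ 1 / L ^ e := by
    intro x hx
    refine hx.trans ?_
    have h1 := hinv (e + 1) (e + 2) (by omega)
    calc _ ≤ L * (1 / L ^ (e + 1)) := by
          nlinarith [show 0 < 1 / L ^ (e + 1) by positivity]
      _ = _ := by rw [pow_succ]; field_simp
  have hsum : ∀ l : Fin d → ℝ, (∀ i, 0 ≤ l i ∧ l i ≤ 3) → (∑ i, c {i} * l i) ≤ 3 * L ^ 2 := by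
    intro l hl
    calc _ ≤ ∑ _i : Fin d, L * 3 :=
          Finset.sum_le_sum fun i _ => mul_le_mul (hc i).2 (hl i).2 (hl i).1 hL0.le
      _ = d * (L * 3) := by simp
      _ ≤ L * (L * 3) := by gcongr
      _ = _ := by ring
  have hmoment : ∀ v', v' = 0 ∨ v' = v → (∀ i, Real.exp (W.mulVec v'.ofLp i) ≤ 3) → ∀ a a',
      |(secondDiff h v' (learnedLaplace p f t ω) - W.transpose *
        Matrix.diagonal (fun i => c {i} * Real.exp (W.mulVec v'.ofLp i)) * W) a a'| ≤
        1 / L ^ e := by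
    intro v' hv' hl a a'
    refine hsucc ((abs_secondDiff_sub_le hh0 hh1 hW1 hc0 (fun _ => rfl) (hΦ v' hv') a a').trans ?_)
    gcongr ?_ + ?_
    · calc _ ≤ 3 * (3 * L ^ 2) * h := by
            gcongr; exact hsum _ fun i => ⟨(Real.exp_pos _).le, hl i⟩
        _ = 9 * (L ^ 2 * (1 / L ^ (2 + (e + 2)))) := by rw [hhL]; ring
        _ = _ := by rw [pow_mul_one_div_pow hL0]
    · apply le_of_eq
      rw [hhL, show 3 * e + 9 = (e + 4) + (e + 4) + (e + 1) by ring, pow_add, pow_add]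
      field_simp
  have he' : e = 2 * (s + 1) + k + 38 := by omega
  refine recoverScan_recovers (s := s + 1) (l := fun i => Real.exp (W.mulVec v.ofLp i)) hL hdL
    (he' ▸ heL) hskip hpower hmesh hrelax hrounds hrow hW hWL hWL' hc
    (fun i => ⟨(Real.exp_pos _).le, hl3 i⟩) (fun i j hij => ?_) (fun a => ?_) (fun a a' => ?_)
    (fun a a' => ?_)
  · have h1 := abs_sub_le_exp_one_mul_abs_exp_sub (abs_le.1 (hwv i)).1 (abs_le.1 (hwv j)).1
    have h2 : 1 / L ^ s ≤ 3 * |Real.exp (W.mulVec v.ofLp i) - Real.exp (W.mulVec v.ofLp j)| :=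
      ((hgap i j hij).trans h1).trans (by gcongr)
    have h3 : 2 / L ^ (s + 1) ≤ 1 / L ^ s / 3 := by
      rw [pow_succ, div_div, div_le_div_iff₀ (by positivity) (by positivity)]
      nlinarith [pow_pos hL0 s]
    linarith
  · rw [← he']
    refine (abs_firstDiff_sub_le (b := b) (ε := 1 / L ^ (3 * e + 9)) hh0 hh1 hW1 hc0
      (fun a b ha hb => ?_) a).trans (hsucc ?_)
    · rw [RealRAM.testPoint_zero]
      exact hΦ 0 (.inl rfl) a b ha hb
    · gcongr ?_ + ?_
      · calc (∑ i, c {i}) * h ≤ (3 * L ^ 2) * h := by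
              gcongr
              simpa using hsum (fun _ => 1) fun _ => by norm_num
          _ = 3 * (L ^ 2 * (1 / L ^ (2 + (e + 2)))) := by rw [hhL]; ring
          _ = 3 * (1 / L ^ (e + 2)) := by rw [pow_mul_one_div_pow hL0]
          _ ≤ _ := by gcongr; norm_num
      · calc 2 * (1 / L ^ (3 * e + 9)) / h = 2 * (1 / L ^ (2 * e + 5)) := by
              rw [hhL, show 3 * e + 9 = (e + 4) + (2 * e + 5) by ring, pow_add]; field_simp
          _ ≤ 4 * (1 / L ^ (e + 1)) := by
              gcongr ?_ * ?_
              · norm_num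
              · exact hinv _ _ (by omega)
  · rw [← he']
    have := hmoment 0 (.inl rfl) (fun i => by simp) a a'
    simpa [hh] using this
  · rw [← he']
    exact hmoment v (.inr rfl) hl3 a a'

end Recovery


/-! ### The Laplace transform of the Gaussian measure -/

section Laplace

variable {d : ℕ}

theorem map_inner_stdGaussian (q : EuclideanSpace ℝ (Fin d)) :
    (stdGaussian (EuclideanSpace ℝ (Fin d))).map (fun x => inner ℝ q x) =
      gaussianReal 0 (Real.toNNReal (‖q‖ ^ 2)) := by
  have h := IsGaussian.map_eq_gaussianReal (μ := stdGaussian (EuclideanSpace ℝ (Fin d)))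
    (innerSL ℝ q)
  rw [integral_strongDual_stdGaussian, variance_dual_stdGaussian, innerSL_apply_norm] at h
  exact h

theorem integrable_exp_inner (q : EuclideanSpace ℝ (Fin d)) :
    Integrable (fun x => Real.exp (inner ℝ q x)) (stdGaussian (EuclideanSpace ℝ (Fin d))) := by
  have h := integrable_exp_mul_gaussianReal (μ := 0) (v := Real.toNNReal (‖q‖ ^ 2)) 1
  rw [← map_inner_stdGaussian] at h
  simpa [Function.comp_def] using h.comp_measurable (by fun_prop)

theorem integral_exp_inner (q : EuclideanSpace ℝ (Fin d)) :
    ∫ x, Real.exp (inner ℝ q x) ∂stdGaussian (EuclideanSpace ℝ (Fin d)) =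
      Real.exp (‖q‖ ^ 2 / 2) := by
  have h := mgf_gaussianReal (map_inner_stdGaussian q) 1
  simpa [mgf] using h

theorem tilt_eq (u x : EuclideanSpace ℝ (Fin d)) :
    tilt u x = Real.exp (inner ℝ u x - ‖u‖ ^ 2 / 2) := by
  rw [tilt, Finset.sum_sub_distrib, EuclideanSpace.real_norm_sq_eq, Finset.sum_div]
  simp [PiLp.inner_apply, mul_comm, sq]

theorem tilt_pos (u x : EuclideanSpace ℝ (Fin d)) : 0 < tilt u x := Real.exp_pos _

theorem tilt_zero (x : EuclideanSpace ℝ (Fin d)) : tilt 0 x = 1 := by simp [tilt]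

theorem tilt_mul_exp_inner (u q x : EuclideanSpace ℝ (Fin d)) :
    tilt u x * Real.exp (inner ℝ q x) =
      Real.exp (-(‖u‖ ^ 2 / 2)) * Real.exp (inner ℝ (u + q) x) := by
  rw [tilt_eq, inner_add_left, ← Real.exp_add, ← Real.exp_add]; congr 1; ring

theorem integrable_tilt_mul_exp_inner (u q : EuclideanSpace ℝ (Fin d)) :
    Integrable (fun x => tilt u x * Real.exp (inner ℝ q x))
      (stdGaussian (EuclideanSpace ℝ (Fin d))) := by
  simp_rw [tilt_mul_exp_inner]
  exact (integrable_exp_inner _).const_mul _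

theorem integral_tilt_mul_exp_inner (u q : EuclideanSpace ℝ (Fin d)) :
    ∫ x, tilt u x * Real.exp (inner ℝ q x) ∂stdGaussian (EuclideanSpace ℝ (Fin d)) =
      Real.exp (inner ℝ u q + ‖q‖ ^ 2 / 2) := by
  simp_rw [tilt_mul_exp_inner]
  rw [integral_const_mul, integral_exp_inner, norm_add_sq_real, ← Real.exp_add]
  congr 1; ring

theorem integral_tilt_mul_exp_inner_le {u : EuclideanSpace ℝ (Fin d)} (hu : ‖u‖ ≤ 2)
    (q : EuclideanSpace ℝ (Fin d)) :
    ∫ x, tilt u x * Real.exp (inner ℝ q x) ∂stdGaussian (EuclideanSpace ℝ (Fin d)) ≤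
      Real.exp (2 * ‖q‖ + ‖q‖ ^ 2 / 2) := by
  rw [integral_tilt_mul_exp_inner]
  gcongr
  exact (real_inner_le_norm _ _).trans (by gcongr)

theorem integrable_tilt (u : EuclideanSpace ℝ (Fin d)) :
    Integrable (tilt u) (stdGaussian (EuclideanSpace ℝ (Fin d))) := by
  simpa using integrable_tilt_mul_exp_inner u 0

theorem integral_tilt (u : EuclideanSpace ℝ (Fin d)) :
    ∫ x, tilt u x ∂stdGaussian (EuclideanSpace ℝ (Fin d)) = 1 := by
  simpa using integral_tilt_mul_exp_inner u 0

theorem tilt_sq (u x : EuclideanSpace ℝ (Fin d)) :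
    tilt u x ^ 2 = Real.exp (-‖u‖ ^ 2) * Real.exp (inner ℝ ((2 : ℝ) • u) x) := by
  rw [tilt_eq, ← Real.exp_nat_mul, ← Real.exp_add, inner_smul_left]
  congr 1; simp; ring

theorem integrable_tilt_sq (u : EuclideanSpace ℝ (Fin d)) :
    Integrable (fun x => tilt u x ^ 2) (stdGaussian (EuclideanSpace ℝ (Fin d))) := by
  simp_rw [tilt_sq]
  exact (integrable_exp_inner _).const_mul _

theorem integral_tilt_sq (u : EuclideanSpace ℝ (Fin d)) :
    ∫ x, tilt u x ^ 2 ∂stdGaussian (EuclideanSpace ℝ (Fin d)) = Real.exp (‖u‖ ^ 2) := by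
  simp_rw [tilt_sq]
  rw [integral_const_mul, integral_exp_inner, ← Real.exp_add, norm_smul]
  congr 1; simp; ring

theorem continuous_tilt (u : EuclideanSpace ℝ (Fin d)) : Continuous (tilt u) := by
  unfold tilt; fun_prop

end Laplace

/-! ### The network as a perturbation of a sum of exponentials -/

section Network

open scoped Matrix.Norms.L2Operator

variable {d : ℕ}

/-- A bound for the difference between `e^t` times the network and the sum of its constant term and
of the exponentials `cᵢ exp ⟨wᵢ, x⟩`, if the coefficients of the network are bounded by `M`. -/
def remainder (t : ℝ) (W : Matrix (Fin d) (Fin d) ℝ) (M : ℝ) (x : EuclideanSpace ℝ (Fin d)) : ℝ :=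
  M * (∑ i, Real.exp (-t) * Real.exp (2 * W.mulVec x.ofLp i) +
    ∑ S : Finset (Fin d) with 1 < S.card,
      Real.exp (t - S.card * t) * Real.exp (∑ j ∈ S, W.mulVec x.ofLp j))

theorem Finset.sum_finset_eq_add_sum_card {ι : Type*} [Fintype ι] [DecidableEq ι]
    (F : Finset ι → ℝ) :
    ∑ S, F S = F ∅ + ∑ i, F {i} + ∑ S : Finset ι with 1 < S.card, F S := by
  rw [← Finset.sum_filter_not_add_sum_filter Finset.univ (fun S : Finset ι => 1 < S.card)]
  congr 1
  have : (Finset.univ.filter fun S : Finset ι => ¬ 1 < S.card) =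
      insert ∅ (Finset.univ.map ⟨fun i : ι => ({i} : Finset ι), Finset.singleton_injective⟩) := by
    ext S
    simp only [Finset.mem_filter, Finset.mem_univ, true_and, Finset.mem_insert, Finset.mem_map,
      Function.Embedding.coeFn_mk, not_lt]
    constructor
    · intro h
      rcases S.eq_empty_or_nonempty with rfl | ⟨i, hi⟩
      · exact .inl rfl
      · refine .inr ⟨i, ?_⟩
        exact (Finset.eq_singleton_iff_unique_mem.2
          ⟨hi, fun j hj => Finset.card_le_one.1 h j hj i hi⟩).symm
    · rintro (rfl | ⟨i, rfl⟩) <;> simp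
  rw [this, Finset.sum_insert (by simp), Finset.sum_map]
  rfl

theorem Real.sigmoid_le_exp (x : ℝ) : Real.sigmoid x ≤ Real.exp x := by
  rw [Real.sigmoid_def, inv_le_comm₀ (by positivity) (Real.exp_pos _), ← Real.exp_neg]
  linarith

theorem abs_exp_mul_sigmoid_sub_le (a t : ℝ) :
    |Real.exp t * Real.sigmoid (a - t) - Real.exp a| ≤ Real.exp (-t) * Real.exp (2 * a) := by
  have h1 : Real.exp a = Real.exp t * Real.exp (a - t) := by rw [← Real.exp_add]; congr 1; ring
  have h2 : Real.exp (-t) * Real.exp (2 * a) = Real.exp t * Real.exp (a - t) ^ 2 := by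
    rw [← Real.exp_nat_mul, ← Real.exp_add, ← Real.exp_add]; congr 1; push_cast; ring
  have h3 : Real.exp (a - t) - Real.sigmoid (a - t) = Real.exp (a - t) * Real.sigmoid (a - t) := by
    rw [Real.sigmoid_def, Real.exp_neg]
    have := Real.exp_pos (a - t)
    field_simp; ring
  rw [h2, h1, ← mul_sub, abs_mul, abs_of_pos (Real.exp_pos t), abs_sub_comm, h3]
  have := Real.sigmoid_le_exp (a - t)
  rw [abs_of_nonneg (mul_nonneg (Real.exp_pos _).le (Real.sigmoid_nonneg _))]
  have := Real.exp_pos (a - t)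
  have := Real.exp_pos t
  gcongr
  nlinarith

/-- Up to the remainder, `e^t` times the network is a sum of exponentials. -/
theorem abs_exp_mul_network_sub_le {t M : ℝ} {W : Matrix (Fin d) (Fin d) ℝ}
    {c : Finset (Fin d) → ℝ} (hc : ∀ i, 0 ≤ c {i} ∧ c {i} ≤ M)
    (hcS : ∀ S : Finset (Fin d), 1 < S.card → |c S| ≤ M) (x : EuclideanSpace ℝ (Fin d)) :
    |Real.exp t * network t W c x - Real.exp t * c ∅ - rowLaplace W (fun i => c {i}) x| ≤
      remainder t W M x := by
  set a := W.mulVec x.ofLp with ha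
  have hsplit : Real.exp t * network t W c x - Real.exp t * c ∅ - rowLaplace W (fun i => c {i}) x =
      ∑ i, c {i} * (Real.exp t * Real.sigmoid (a i - t) - Real.exp (a i)) +
      ∑ S : Finset (Fin d) with 1 < S.card,
        c S * (Real.exp t * ∏ j ∈ S, Real.sigmoid (a j - t)) := by
    rw [network, Finset.sum_finset_eq_add_sum_card, rowLaplace]
    simp only [Finset.prod_empty, mul_one, Finset.prod_singleton, mul_add, Finset.mul_sum, mul_sub,
      Finset.sum_sub_distrib, ← ha]
    simp only [mul_left_comm (Real.exp t)]
    ring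
  rw [hsplit, remainder, mul_add, Finset.mul_sum, Finset.mul_sum]
  refine (abs_add_le _ _).trans (add_le_add ?_ ?_)
  · refine (Finset.abs_sum_le_sum_abs _ _).trans (Finset.sum_le_sum fun i _ => ?_)
    rw [abs_mul, abs_of_nonneg (hc i).1]
    exact mul_le_mul (hc i).2 (abs_exp_mul_sigmoid_sub_le _ _) (abs_nonneg _)
      ((hc i).1.trans (hc i).2)
  · refine (Finset.abs_sum_le_sum_abs _ _).trans (Finset.sum_le_sum fun S hS => ?_)
    rw [abs_mul]
    have h1 : 0 ≤ ∏ j ∈ S, Real.sigmoid (a j - t) :=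
      Finset.prod_nonneg fun j _ => Real.sigmoid_nonneg _
    have h2 : ∏ j ∈ S, Real.sigmoid (a j - t) ≤ Real.exp (∑ j ∈ S, a j - S.card * t) := by
      calc _ ≤ ∏ j ∈ S, Real.exp (a j - t) :=
            Finset.prod_le_prod (fun j _ => Real.sigmoid_nonneg _) fun j _ => Real.sigmoid_le_exp _
        _ = _ := by rw [← Real.exp_sum, Finset.sum_sub_distrib]; simp
    have h3 := hcS S (Finset.mem_filter.1 hS).2
    rw [abs_of_nonneg (mul_nonneg (Real.exp_pos _).le h1)]
    refine mul_le_mul h3 ?_ (by positivity) ((abs_nonneg _).trans h3)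
    calc _ ≤ Real.exp t * Real.exp (∑ j ∈ S, a j - S.card * t) := by gcongr
      _ = _ := by rw [← Real.exp_add, ← Real.exp_add]; congr 1; ring

theorem continuous_network (t : ℝ) (W : Matrix (Fin d) (Fin d) ℝ) (c : Finset (Fin d) → ℝ) :
    Continuous (network t W c) := by
  unfold network Matrix.mulVec dotProduct
  refine continuous_finsetSum _ fun S _ => continuous_const.mul (continuous_finsetProd _ fun j _ =>
    continuous_sigmoid.comp ?_)
  fun_prop

theorem abs_network_le (t : ℝ) (W : Matrix (Fin d) (Fin d) ℝ) (c : Finset (Fin d) → ℝ)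
    (x : EuclideanSpace ℝ (Fin d)) : |network t W c x| ≤ ∑ S, |c S| := by
  refine (Finset.abs_sum_le_sum_abs _ _).trans (Finset.sum_le_sum fun S _ => ?_)
  rw [abs_mul]
  refine mul_le_of_le_one_right (abs_nonneg _) ?_
  rw [abs_of_nonneg (Finset.prod_nonneg fun j _ => Real.sigmoid_nonneg _)]
  exact Finset.prod_le_one (fun j _ => Real.sigmoid_nonneg _) fun j _ => Real.sigmoid_le_one _

/-- The constant term is the limit of the network when all activations tend to `-∞`. -/
theorem constantTerm_nonneg {t : ℝ} {W : Matrix (Fin d) (Fin d) ℝ} {c : Finset (Fin d) → ℝ}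
    (hW : IsUnit W.det) (hf : ∀ x, 0 ≤ network t W c x) : 0 ≤ c ∅ := by
  have h : Filter.Tendsto (fun s : ℝ =>
      network t W c (WithLp.toLp 2 (W⁻¹.mulVec fun _ => s))) Filter.atBot
      (nhds (∑ S : Finset (Fin d), c S * ∏ _j ∈ S, (0 : ℝ))) := by
    unfold network
    refine tendsto_finsetSum _ fun S _ =>
      tendsto_const_nhds.mul (tendsto_finsetProd _ fun j _ => ?_)
    have : ∀ s : ℝ, W.mulVec (W⁻¹.mulVec fun _ => s) j = s := fun s => by
      rw [Matrix.mulVec_mulVec, Matrix.mul_nonsing_inv _ hW, Matrix.one_mulVec]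
    simp only [this]
    exact Real.tendsto_sigmoid_atBot.comp
      (Filter.tendsto_atBot_add_const_right _ (-t) Filter.tendsto_id)
  have h0 : ∑ S : Finset (Fin d), c S * ∏ _j ∈ S, (0 : ℝ) = c ∅ := by
    rw [Finset.sum_eq_single ∅]
    · simp
    · intro S _ hS
      obtain ⟨j, hj⟩ := Finset.nonempty_iff_ne_empty.2 hS
      rw [Finset.prod_eq_zero hj rfl, mul_zero]
    · simp
  rw [h0] at h
  exact ge_of_tendsto' h fun s => hf _

/-! ### Gaussian moments of the exponentials -/

/-- The linear combination `∑ bᵢ wᵢ` of the rows of `W`. -/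
def rowCombination (W : Matrix (Fin d) (Fin d) ℝ) (b : Fin d → ℝ) : EuclideanSpace ℝ (Fin d) :=
  WithLp.toLp 2 (W.transpose.mulVec b)

theorem inner_rowCombination (W : Matrix (Fin d) (Fin d) ℝ) (b : Fin d → ℝ)
    (x : EuclideanSpace ℝ (Fin d)) :
    inner ℝ (rowCombination W b) x = ∑ i, b i * W.mulVec x.ofLp i := by
  rw [rowCombination, EuclideanSpace.inner_eq_star_dotProduct]
  simp only [star_trivial]
  rw [dotProduct_comm, Matrix.mulVec_transpose, ← Matrix.dotProduct_mulVec]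
  rfl

theorem norm_rowCombination_single {W : Matrix (Fin d) (Fin d) ℝ}
    (hrow : ∀ i, ‖(WithLp.toLp 2 (W i) : EuclideanSpace ℝ (Fin d))‖ = 1) (i : Fin d) (r : ℝ) :
    ‖rowCombination W (Pi.single i r)‖ = |r| := by
  have : rowCombination W (Pi.single i r) = r • WithLp.toLp 2 (W i) := by
    ext j
    simp [rowCombination]
  rw [this, norm_smul, hrow, mul_one, Real.norm_eq_abs]

theorem inner_rowCombination_single (W : Matrix (Fin d) (Fin d) ℝ) (i : Fin d) (r : ℝ)
    (x : EuclideanSpace ℝ (Fin d)) :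
    inner ℝ (rowCombination W (Pi.single i r)) x = r * W.mulVec x.ofLp i := by
  rw [inner_rowCombination, Finset.sum_eq_single i]
  · simp
  · intro j _ hj; simp [hj]
  · simp

theorem norm_rowCombination_le {W : Matrix (Fin d) (Fin d) ℝ} {K : ℝ} (hWK : ‖W‖ ≤ K)
    (S : Finset (Fin d)) :
    ‖rowCombination W (fun i => if i ∈ S then 1 else 0)‖ ≤ K * √S.card := by
  refine (Matrix.norm_toLp_mulVec_le _ _).trans ?_
  rw [Matrix.l2_opNorm_transpose]
  refine mul_le_mul hWK (le_of_eq ?_) (norm_nonneg _) ((norm_nonneg _).trans hWK)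
  rw [EuclideanSpace.norm_eq]
  congr 1
  simp [apply_ite]

theorem inner_rowCombination_indicator (W : Matrix (Fin d) (Fin d) ℝ) (S : Finset (Fin d))
    (x : EuclideanSpace ℝ (Fin d)) :
    inner ℝ (rowCombination W (fun i => if i ∈ S then 1 else 0)) x =
      ∑ j ∈ S, W.mulVec x.ofLp j := by
  rw [inner_rowCombination]
  simp

theorem integrable_tilt_mul_exp_row (W : Matrix (Fin d) (Fin d) ℝ) (u : EuclideanSpace ℝ (Fin d))
    (i : Fin d) (r : ℝ) : Integrable (fun x => tilt u x * Real.exp (r * W.mulVec x.ofLp i))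
      (stdGaussian (EuclideanSpace ℝ (Fin d))) := by
  simpa only [inner_rowCombination_single] using
    integrable_tilt_mul_exp_inner u (rowCombination W (Pi.single i r))

theorem integral_tilt_mul_exp_row {W : Matrix (Fin d) (Fin d) ℝ}
    (hrow : ∀ i, ‖(WithLp.toLp 2 (W i) : EuclideanSpace ℝ (Fin d))‖ = 1)
    (u : EuclideanSpace ℝ (Fin d)) (i : Fin d) (r : ℝ) :
    ∫ x, tilt u x * Real.exp (r * W.mulVec x.ofLp i) ∂stdGaussian (EuclideanSpace ℝ (Fin d)) =
      Real.exp (r * W.mulVec u.ofLp i + r ^ 2 / 2) := by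
  have h := integral_tilt_mul_exp_inner u (rowCombination W (Pi.single i r))
  rw [norm_rowCombination_single hrow, real_inner_comm, sq_abs] at h
  simpa only [inner_rowCombination_single] using h

theorem integral_tilt_mul_exp_row_le {W : Matrix (Fin d) (Fin d) ℝ}
    (hrow : ∀ i, ‖(WithLp.toLp 2 (W i) : EuclideanSpace ℝ (Fin d))‖ = 1)
    {u : EuclideanSpace ℝ (Fin d)} (hu : ‖u‖ ≤ 2) (i : Fin d) (r : ℝ) :
    ∫ x, tilt u x * Real.exp (r * W.mulVec x.ofLp i) ∂stdGaussian (EuclideanSpace ℝ (Fin d)) ≤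
      Real.exp (2 * |r| + r ^ 2 / 2) := by
  rw [integral_tilt_mul_exp_row hrow]
  refine Real.exp_le_exp.2 (add_le_add ?_ le_rfl)
  refine (le_abs_self _).trans ?_
  rw [abs_mul, mul_comm]
  gcongr
  exact (abs_mulVec_le_norm hrow u i).trans hu

theorem integrable_tilt_mul_rowLaplace (W : Matrix (Fin d) (Fin d) ℝ) (c : Fin d → ℝ)
    (u : EuclideanSpace ℝ (Fin d)) : Integrable (fun x => tilt u x * rowLaplace W c x)
      (stdGaussian (EuclideanSpace ℝ (Fin d))) := by
  simp only [rowLaplace, Finset.mul_sum, mul_left_comm (tilt u _)]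
  refine integrable_finsetSum _ fun i _ => Integrable.const_mul ?_ _
  simpa using integrable_tilt_mul_exp_row W u i 1

/-- The Cameron–Martin formula for the sum of exponentials. -/
theorem integral_tilt_mul_rowLaplace {W : Matrix (Fin d) (Fin d) ℝ}
    (hrow : ∀ i, ‖(WithLp.toLp 2 (W i) : EuclideanSpace ℝ (Fin d))‖ = 1) (c : Fin d → ℝ)
    (u : EuclideanSpace ℝ (Fin d)) :
    ∫ x, tilt u x * rowLaplace W c x ∂stdGaussian (EuclideanSpace ℝ (Fin d)) =
      Real.exp (1 / 2) * rowLaplace W c u := by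
  have h1 : ∀ i, Integrable (fun x => tilt u x * Real.exp (W.mulVec x.ofLp i))
      (stdGaussian (EuclideanSpace ℝ (Fin d))) := fun i => by
    simpa using integrable_tilt_mul_exp_row W u i 1
  simp only [rowLaplace, Finset.mul_sum, mul_left_comm (tilt u _)]
  rw [integral_finsetSum _ fun i _ => (h1 i).const_mul _]
  refine Finset.sum_congr rfl fun i _ => ?_
  have h2 := integral_tilt_mul_exp_row hrow u i 1
  simp only [one_mul, one_pow, Real.exp_add] at h2
  rw [integral_const_mul, h2]
  ring

theorem sq_rowLaplace_le (W : Matrix (Fin d) (Fin d) ℝ) {c : Fin d → ℝ} {M : ℝ}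
    (hc : ∀ i, 0 ≤ c i ∧ c i ≤ M) (x : EuclideanSpace ℝ (Fin d)) :
    rowLaplace W c x ^ 2 ≤ d * M ^ 2 * ∑ i, Real.exp (2 * W.mulVec x.ofLp i) := by
  have h : ∀ i, (c i * Real.exp (W.mulVec x.ofLp i)) ^ 2 ≤
      M ^ 2 * Real.exp (2 * W.mulVec x.ofLp i) := fun i => by
    rw [mul_pow, ← Real.exp_nat_mul]
    have := (hc i).1
    push_cast
    gcongr
    exact (hc i).2
  calc rowLaplace W c x ^ 2
      ≤ (Finset.univ : Finset (Fin d)).card * ∑ i, (c i * Real.exp (W.mulVec x.ofLp i)) ^ 2 :=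
        sq_sum_le_card_mul_sum_sq
    _ ≤ d * ∑ i, M ^ 2 * Real.exp (2 * W.mulVec x.ofLp i) := by
        rw [Finset.card_univ, Fintype.card_fin]
        gcongr with i
        exact h i
    _ = _ := by rw [← Finset.mul_sum]; ring

theorem integrable_tilt_mul_remainder (t : ℝ) (W : Matrix (Fin d) (Fin d) ℝ) (M : ℝ)
    (u : EuclideanSpace ℝ (Fin d)) : Integrable (fun x => tilt u x * remainder t W M x)
      (stdGaussian (EuclideanSpace ℝ (Fin d))) := by
  simp only [remainder, mul_add, Finset.mul_sum]
  refine Integrable.add (integrable_finsetSum _ fun i _ => ?_)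
    (integrable_finsetSum _ fun S _ => ?_)
  · simp only [mul_left_comm (tilt u _)]
    exact ((integrable_tilt_mul_exp_row W u i 2).const_mul _).const_mul _
  · simp only [mul_left_comm (tilt u _)]
    simp only [← inner_rowCombination_indicator]
    exact ((integrable_tilt_mul_exp_inner u _).const_mul _).const_mul _

theorem sum_pow_card_le {τ : ℝ} (hτ : 0 ≤ τ) (hdτ : d * τ ≤ 1) :
    ∑ S : Finset (Fin d) with 1 < S.card, τ ^ S.card ≤ (d * τ) ^ 2 := by
  have h1 : ∑ S : Finset (Fin d), τ ^ S.card = (τ + 1) ^ d := by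
    have := Finset.sum_pow_mul_eq_add_pow τ 1 (Finset.univ : Finset (Fin d))
    simpa using this
  rw [Finset.sum_finset_eq_add_sum_card] at h1
  simp only [Finset.card_empty, pow_zero, Finset.card_singleton, pow_one, Finset.sum_const,
    Finset.card_univ, Fintype.card_fin, nsmul_eq_mul] at h1
  have h2 : (τ + 1) ^ d ≤ Real.exp (d * τ) := by
    rw [Real.exp_nat_mul]
    gcongr
    exact Real.add_one_le_exp τ
  have h3 := (abs_le.1 (Real.abs_exp_sub_one_sub_id_le (x := d * τ) (by
    rwa [abs_of_nonneg (by positivity)]))).2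
  linarith

/-- The remainder is exponentially small in the threshold. -/
theorem integral_tilt_mul_remainder_le {t M K : ℝ} {W : Matrix (Fin d) (Fin d) ℝ}
    (hrow : ∀ i, ‖(WithLp.toLp 2 (W i) : EuclideanSpace ℝ (Fin d))‖ = 1) (hK : 1 ≤ K)
    (hWK : ‖W‖ ≤ K) (hM : 0 ≤ M) (hdt : d * Real.exp (2 * K + K ^ 2 / 2 - t) ≤ 1)
    {u : EuclideanSpace ℝ (Fin d)} (hu : ‖u‖ ≤ 2) :
    ∫ x, tilt u x * remainder t W M x ∂stdGaussian (EuclideanSpace ℝ (Fin d)) ≤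
      M * (d * Real.exp 6 + d ^ 2 * Real.exp (4 * K + K ^ 2)) * Real.exp (-t) := by
  have hK0 : 0 ≤ K := by linarith
  have hi := fun i => integrable_tilt_mul_exp_row W u i 2
  have hS := fun S : Finset (Fin d) => integrable_tilt_mul_exp_inner u
    (rowCombination W (fun i => if i ∈ S then 1 else 0))
  simp only [inner_rowCombination_indicator] at hS
  set τ := Real.exp (2 * K + K ^ 2 / 2 - t) with hτ
  have h1 : ∫ x, tilt u x * remainder t W M x ∂stdGaussian (EuclideanSpace ℝ (Fin d)) =
      M * (∑ i, Real.exp (-t) * ∫ x, tilt u x * Real.exp (2 * W.mulVec x.ofLp i)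
          ∂stdGaussian (EuclideanSpace ℝ (Fin d)) +
        ∑ S : Finset (Fin d) with 1 < S.card, Real.exp (t - S.card * t) *
          ∫ x, tilt u x * Real.exp (∑ j ∈ S, W.mulVec x.ofLp j)
            ∂stdGaussian (EuclideanSpace ℝ (Fin d))) := by
    have hpt : ∀ x, tilt u x * remainder t W M x =
        M * (∑ i, Real.exp (-t) * (tilt u x * Real.exp (2 * W.mulVec x.ofLp i)) +
          ∑ S : Finset (Fin d) with 1 < S.card, Real.exp (t - S.card * t) *
            (tilt u x * Real.exp (∑ j ∈ S, W.mulVec x.ofLp j))) := fun x => by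
      rw [remainder, mul_left_comm, mul_add, Finset.mul_sum, Finset.mul_sum]
      simp only [mul_left_comm (tilt u x)]
    simp only [hpt]
    rw [integral_const_mul, integral_add, integral_finsetSum, integral_finsetSum]
    · simp only [integral_const_mul]
    · exact fun S _ => (hS S).const_mul _
    · exact fun i _ => (hi i).const_mul _
    · exact integrable_finsetSum _ fun i _ => (hi i).const_mul _
    · exact integrable_finsetSum _ fun S _ => (hS S).const_mul _
  have h2 : ∀ S : Finset (Fin d), Real.exp (t - S.card * t) *
      ∫ x, tilt u x * Real.exp (∑ j ∈ S, W.mulVec x.ofLp j)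
        ∂stdGaussian (EuclideanSpace ℝ (Fin d)) ≤ Real.exp t * τ ^ S.card := by
    intro S
    have h3 := integral_tilt_mul_exp_inner_le hu
      (rowCombination W (fun i => if i ∈ S then 1 else 0))
    simp only [inner_rowCombination_indicator] at h3
    have h4 := norm_rowCombination_le hWK S
    set n := ‖rowCombination W (fun i => if i ∈ S then 1 else 0)‖
    have h5 : √(S.card : ℝ) ≤ S.card := by
      rcases Nat.eq_zero_or_pos S.card with h | h
      · simp [h]
      · refine Real.sqrt_le_left (by positivity) |>.2 ?_
        have : (1 : ℝ) ≤ S.card := by exact_mod_cast h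
        nlinarith
    have h6 : 2 * n + n ^ 2 / 2 ≤ S.card * (2 * K + K ^ 2 / 2) := by
      have h7 : n ^ 2 ≤ K ^ 2 * S.card := by
        calc n ^ 2 ≤ (K * √S.card) ^ 2 := by gcongr
          _ = _ := by rw [mul_pow, Real.sq_sqrt (by positivity)]
      have h8 : n ≤ K * S.card := h4.trans (by gcongr)
      nlinarith
    calc _ ≤ Real.exp (t - S.card * t) * Real.exp (2 * n + n ^ 2 / 2) := by gcongr
      _ ≤ Real.exp (t - S.card * t) * Real.exp (S.card * (2 * K + K ^ 2 / 2)) := by gcongr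
      _ = _ := by
        rw [hτ, ← Real.exp_nat_mul, ← Real.exp_add, ← Real.exp_add]; congr 1; ring
  have h3 : ∀ i, Real.exp (-t) * ∫ x, tilt u x * Real.exp (2 * W.mulVec x.ofLp i)
      ∂stdGaussian (EuclideanSpace ℝ (Fin d)) ≤ Real.exp (-t) * Real.exp 6 := by
    intro i
    gcongr
    refine (integral_tilt_mul_exp_row_le hrow hu i 2).trans (le_of_eq ?_)
    norm_num
  rw [h1, mul_assoc]
  gcongr
  rw [add_mul]
  refine add_le_add ((Finset.sum_le_sum fun i _ => h3 i).trans (le_of_eq ?_))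
    ((Finset.sum_le_sum fun S _ => h2 S).trans ?_)
  · simp; ring
  · rw [← Finset.mul_sum]
    calc _ ≤ Real.exp t * (d * τ) ^ 2 := by
          gcongr; exact sum_pow_card_le (Real.exp_pos _).le hdt
      _ = d ^ 2 * (Real.exp t * τ ^ 2) := by ring
      _ = _ := by
        rw [hτ, ← Real.exp_nat_mul, ← Real.exp_add, mul_assoc, ← Real.exp_add]
        congr 2; push_cast; ring

end Network


/-! ### The biased law -/

section BiasedLaw

variable {d : ℕ} {f φ : EuclideanSpace ℝ (Fin d) → ℝ}

theorem integral_biasedLaw (hf : Measurable f) (hf0 : ∀ x, 0 ≤ f x)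
    (hfi : Integrable f (stdGaussian (EuclideanSpace ℝ (Fin d))))
    (φ : EuclideanSpace ℝ (Fin d) → ℝ) :
    ∫ x, φ x ∂biasedLaw f =
      (∫ x, f x * φ x ∂stdGaussian (EuclideanSpace ℝ (Fin d))) /
        ∫ x, f x ∂stdGaussian (EuclideanSpace ℝ (Fin d)) := by
  rw [biasedLaw, integral_smul_measure,
    integral_withDensity_eq_integral_toReal_smul (by fun_prop) (by simp),
    ← ofReal_integral_eq_lintegral_ofReal hfi (.of_forall hf0), ENNReal.toReal_inv,
    ENNReal.toReal_ofReal (integral_nonneg hf0), smul_eq_mul, div_eq_inv_mul]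
  simp [ENNReal.toReal_ofReal (hf0 _)]

theorem integrable_biasedLaw (hf : Measurable f) (hf0 : ∀ x, 0 ≤ f x)
    (hfi : Integrable f (stdGaussian (EuclideanSpace ℝ (Fin d))))
    (hpos : 0 < ∫ x, f x ∂stdGaussian (EuclideanSpace ℝ (Fin d)))
    (hφ : Integrable (fun x => f x * φ x) (stdGaussian (EuclideanSpace ℝ (Fin d)))) :
    Integrable φ (biasedLaw f) := by
  refine Integrable.smul_measure ?_ ?_
  · rw [integrable_withDensity_iff_integrable_smul' (by fun_prop) (by simp)]
    simpa [ENNReal.toReal_ofReal (hf0 _)] using hφ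
  · rw [← ofReal_integral_eq_lintegral_ofReal hfi (.of_forall hf0)]
    simpa using hpos

theorem isProbabilityMeasure_biasedLaw (hf0 : ∀ x, 0 ≤ f x)
    (hfi : Integrable f (stdGaussian (EuclideanSpace ℝ (Fin d))))
    (hpos : 0 < ∫ x, f x ∂stdGaussian (EuclideanSpace ℝ (Fin d))) :
    IsProbabilityMeasure (biasedLaw f) := by
  refine ⟨?_⟩
  rw [biasedLaw, Measure.smul_apply, withDensity_apply _ MeasurableSet.univ, Measure.restrict_univ,
    ← ofReal_integral_eq_lintegral_ofReal hfi (.of_forall hf0), smul_eq_mul]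
  exact ENNReal.inv_mul_cancel (by simpa using hpos) (by simp)

theorem biasedLaw_real_apply (hf : Measurable f) (hf0 : ∀ x, 0 ≤ f x)
    (hfi : Integrable f (stdGaussian (EuclideanSpace ℝ (Fin d))))
    {A : Set (EuclideanSpace ℝ (Fin d))} (hA : MeasurableSet A) :
    (biasedLaw f).real A =
      (∫ x, A.indicator f x ∂stdGaussian (EuclideanSpace ℝ (Fin d))) /
        ∫ x, f x ∂stdGaussian (EuclideanSpace ℝ (Fin d)) := by
  rw [← integral_indicator_one hA, integral_biasedLaw hf hf0 hfi]
  congr 2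
  ext x
  by_cases hx : x ∈ A <;> simp [hx]

end BiasedLaw

/-! ### The bias of the clipped estimator -/

section Weight

theorem measurable_weight (δ A : ℝ) : Measurable fun z : ℝ × ℝ => weight δ A z.1 z.2 := by
  unfold weight
  refine Measurable.ite ?_ measurable_const (by fun_prop)
  exact (measurableSet_lt measurable_snd (measurable_fst.const_mul δ)).union
    ((measurableSet_lt (measurable_fst.add_const A) measurable_snd).union
      (measurableSet_lt measurable_snd (measurable_fst.sub_const A)))

/-- The weight of a rejected label is zero. -/
theorem weight_cases {δ A a : ℝ} (hδ : 0 < δ) (ha : 0 < a) (y : ℝ) :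
    (weight δ A a y = 0 ∧ (y < δ * a ∨ A < |y - a|)) ∨
      (weight δ A a y * y = 1 ∧ δ * a ≤ y ∧ |y - a| ≤ A) := by
  unfold weight
  split_ifs with h
  · refine .inl ⟨rfl, ?_⟩
    rcases h with h | h | h
    · exact .inl h
    · exact .inr (lt_of_lt_of_le (by linarith) (le_abs_self _))
    · exact .inr (lt_of_lt_of_le (by linarith) (neg_le_abs _))
  · push Not at h
    refine .inr ⟨?_, h.1, abs_le.2 ⟨by linarith, by linarith⟩⟩
    have : 0 < y := lt_of_lt_of_le (by positivity) h.1
    field_simp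

theorem abs_mul_weight_le {δ A a : ℝ} (hδ : 0 < δ) (ha : 0 < a) (hA : 0 ≤ A) (y : ℝ) :
    |y * (weight δ A a y * (y - a))| ≤ A := by
  rcases weight_cases hδ ha y (A := A) with ⟨h1, _⟩ | ⟨h1, _, h2⟩
  · simpa [h1] using hA
  · rw [mul_left_comm, ← mul_assoc, h1, one_mul]; exact h2

end Weight

section Perturbation

variable {d : ℕ}

/-- A nonnegative function `G` that is a constant `C₀` plus a positive function `H` with bounded
Gaussian moments, up to a small remainder `ρ`. The function `κ` bounds `1 / H`. The number `b`
bounds the moments of `H` and `κ`, and `r` those of `ρ`, also under the tilts by vectors of length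
at most two. -/
structure IsPerturbation (G : EuclideanSpace ℝ (Fin d) → ℝ) (C₀ : ℝ)
    (H ρ κ : EuclideanSpace ℝ (Fin d) → ℝ) (b r : ℝ) : Prop where
  measurable : Measurable G
  nonneg : ∀ x, 0 ≤ G x
  const_nonneg : 0 ≤ C₀
  integrable : Integrable G (stdGaussian (EuclideanSpace ℝ (Fin d)))
  H_nonneg : ∀ x, 0 ≤ H x
  κ_nonneg : ∀ x, 0 ≤ κ x
  abs_sub_le : ∀ x, |G x - C₀ - H x| ≤ ρ x
  one_le_mul : ∀ x, 1 ≤ H x * κ x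
  integrable_H : ∀ u, Integrable (fun x => tilt u x * H x)
    (stdGaussian (EuclideanSpace ℝ (Fin d)))
  integrable_sq : ∀ u, Integrable (fun x => tilt u x * H x ^ 2)
    (stdGaussian (EuclideanSpace ℝ (Fin d)))
  integrable_ρ : ∀ u, Integrable (fun x => tilt u x * ρ x)
    (stdGaussian (EuclideanSpace ℝ (Fin d)))
  integrable_κ : ∀ u, Integrable (fun x => tilt u x * κ x)
    (stdGaussian (EuclideanSpace ℝ (Fin d)))
  one_le : 1 ≤ b
  integral_H_le : ∀ u, ‖u‖ ≤ 2 →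
    ∫ x, tilt u x * H x ∂stdGaussian (EuclideanSpace ℝ (Fin d)) ≤ b
  integral_sq_le : ∀ u, ‖u‖ ≤ 2 →
    ∫ x, tilt u x * H x ^ 2 ∂stdGaussian (EuclideanSpace ℝ (Fin d)) ≤ b
  integral_κ_le : ∀ u, ‖u‖ ≤ 2 →
    ∫ x, tilt u x * κ x ∂stdGaussian (EuclideanSpace ℝ (Fin d)) ≤ b
  integral_ρ_le : ∀ u, ‖u‖ ≤ 2 →
    ∫ x, tilt u x * ρ x ∂stdGaussian (EuclideanSpace ℝ (Fin d)) ≤ r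
  le_integral : C₀ + 1 / b ≤ ∫ x, G x ∂stdGaussian (EuclideanSpace ℝ (Fin d))

/-- A bound for the contribution of a rejected label. The first two terms account for the labels
that are far from the reference, and the last one for those that are too small. -/
def rejectionBound (H ρ κ : EuclideanSpace ℝ (Fin d) → ℝ) (δ A₁ A₂ : ℝ)
    (x : EuclideanSpace ℝ (Fin d)) : ℝ :=
  4 * ρ x + 4 / A₁ * H x ^ 2 + A₂ * (ρ x / (δ * A₁) + 2 * δ * A₁ * κ x)

namespace IsPerturbation

variable {G H ρ κ : EuclideanSpace ℝ (Fin d) → ℝ} {C₀ b r : ℝ}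

theorem ρ_nonneg (h : IsPerturbation G C₀ H ρ κ b r) (x : EuclideanSpace ℝ (Fin d)) : 0 ≤ ρ x :=
  (abs_nonneg _).trans (h.abs_sub_le x)

theorem add_le (h : IsPerturbation G C₀ H ρ κ b r) {A₁ : ℝ} (hA₁ : 0 < A₁)
    {x : EuclideanSpace ℝ (Fin d)} (hx : A₁ < H x + ρ x) :
    H x + ρ x ≤ 2 * ρ x + 4 / A₁ * H x ^ 2 := by
  have h1 := h.H_nonneg x
  have h2 := h.ρ_nonneg x
  rcases le_total (ρ x) (H x) with h3 | h3
  · have h4 : 2 * H x ≤ 4 / A₁ * H x ^ 2 := by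
      rw [div_mul_eq_mul_div, le_div_iff₀ hA₁]; nlinarith
    linarith
  · have : 0 ≤ 4 / A₁ * H x ^ 2 := by positivity
    linarith

/-- If a label is rejected then either the remainder or `H` is large, or `H` is small. -/
theorem le_rejectionBound (h : IsPerturbation G C₀ H ρ κ b r) {δ A₁ A₂ a : ℝ} (hδ : 0 < δ)
    (hδ1 : δ ≤ 1) (hA₁ : 1 ≤ A₁) (hA₂ : 3 * A₁ ≤ A₂) (ha : |a - C₀| ≤ A₁)
    {x : EuclideanSpace ℝ (Fin d)} (hx : G x < δ * a ∨ A₂ < |G x - a|) :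
    A₁ ≤ rejectionBound H ρ κ δ A₁ A₂ x ∧ |G x - a| ≤ rejectionBound H ρ κ δ A₁ A₂ x := by
  have h1 := h.H_nonneg x
  have h2 := h.ρ_nonneg x
  have h3 := h.κ_nonneg x
  have h4 := abs_le.1 (h.abs_sub_le x)
  have h5 := abs_le.1 ha
  have hC := h.const_nonneg
  unfold rejectionBound
  -- A label far from the reference has `2 A₁ < H + ρ`. A small label that is not far from it has
  -- `C₀ + H < ρ + δ (C₀ + A₁)`, and so `H < 2 δ A₁` unless `δ A₁ ≤ ρ`.
  by_cases hclip : A₂ < |G x - a|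
  · have h6 : |G x - a| ≤ H x + ρ x + A₁ := by
      rw [abs_le]; constructor <;> linarith
    have h7 := h.add_le (by linarith) (x := x) (by linarith : A₁ < H x + ρ x)
    have h8 : 0 ≤ A₂ * (ρ x / (δ * A₁) + 2 * δ * A₁ * κ x) := by
      have : 0 ≤ A₂ := by linarith
      have : 0 ≤ A₁ := by linarith
      positivity
    have h9 : 2 * (H x + ρ x) ≤ 4 * ρ x + 4 / A₁ * H x ^ 2 := by
      rcases le_total (ρ x) (H x) with h3 | h3
      · have : 4 * H x ≤ 4 / A₁ * H x ^ 2 := by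
          rw [div_mul_eq_mul_div, le_div_iff₀ (by linarith)]; nlinarith
        linarith
      · have : 0 ≤ 4 / A₁ * H x ^ 2 := by
          have : 0 < A₁ := by linarith
          positivity
        linarith
    constructor <;> linarith
  · push Not at hclip
    have hlow := hx.resolve_right (not_lt.2 hclip)
    have hA0 : 0 < A₁ := by linarith
    have h6 : 1 ≤ ρ x / (δ * A₁) + 2 * δ * A₁ * κ x := by
      rcases le_total (δ * A₁) (ρ x) with h7 | h7
      · have : 1 ≤ ρ x / (δ * A₁) := by rwa [le_div_iff₀ (by positivity), one_mul]
        have : 0 ≤ 2 * δ * A₁ * κ x := by positivity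
        linarith
      · have h8 : H x ≤ 2 * δ * A₁ := by nlinarith
        have h9 : 0 ≤ ρ x / (δ * A₁) := by positivity
        have h10 : H x * κ x ≤ 2 * δ * A₁ * κ x := by gcongr
        linarith [h.one_le_mul x]
    have h7 : A₂ ≤ A₂ * (ρ x / (δ * A₁) + 2 * δ * A₁ * κ x) :=
      le_mul_of_one_le_right (by linarith) h6
    have h8 : 0 ≤ 4 / A₁ * H x ^ 2 := by positivity
    constructor <;> linarith

theorem rejectionBound_nonneg (h : IsPerturbation G C₀ H ρ κ b r) {δ A₁ A₂ : ℝ} (hδ : 0 < δ)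
    (hA₁ : 1 ≤ A₁) (hA₂ : 3 * A₁ ≤ A₂) (x : EuclideanSpace ℝ (Fin d)) :
    0 ≤ rejectionBound H ρ κ δ A₁ A₂ x := by
  have h2 := h.ρ_nonneg x
  have h3 := h.κ_nonneg x
  have : 0 ≤ A₂ := by linarith
  have : 0 < A₁ := by linarith
  unfold rejectionBound
  positivity

theorem integrable_rejectionBound (h : IsPerturbation G C₀ H ρ κ b r) (δ A₁ A₂ : ℝ)
    (u : EuclideanSpace ℝ (Fin d)) :
    Integrable (fun x => tilt u x * rejectionBound H ρ κ δ A₁ A₂ x)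
      (stdGaussian (EuclideanSpace ℝ (Fin d))) := by
  have : (fun x => tilt u x * rejectionBound H ρ κ δ A₁ A₂ x) = fun x =>
      4 * (tilt u x * ρ x) + 4 / A₁ * (tilt u x * H x ^ 2) +
        (A₂ / (δ * A₁) * (tilt u x * ρ x) + A₂ * (2 * δ * A₁) * (tilt u x * κ x)) := by
    ext x; unfold rejectionBound; ring
  rw [this]
  exact (((h.integrable_ρ u).const_mul _).add ((h.integrable_sq u).const_mul _)).add
    (((h.integrable_ρ u).const_mul _).add ((h.integrable_κ u).const_mul _))

theorem integral_rejectionBound_le (h : IsPerturbation G C₀ H ρ κ b r) {δ A₁ A₂ : ℝ} (hδ : 0 < δ)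
    (hA₁ : 1 ≤ A₁) (hA₂ : 3 * A₁ ≤ A₂) {u : EuclideanSpace ℝ (Fin d)} (hu : ‖u‖ ≤ 2) :
    ∫ x, tilt u x * rejectionBound H ρ κ δ A₁ A₂ x ∂stdGaussian (EuclideanSpace ℝ (Fin d)) ≤
      4 * r + 4 / A₁ * b + (A₂ / (δ * A₁) * r + A₂ * (2 * δ * A₁) * b) := by
  have h1 : (fun x => tilt u x * rejectionBound H ρ κ δ A₁ A₂ x) = fun x =>
      4 * (tilt u x * ρ x) + 4 / A₁ * (tilt u x * H x ^ 2) +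
        (A₂ / (δ * A₁) * (tilt u x * ρ x) + A₂ * (2 * δ * A₁) * (tilt u x * κ x)) := by
    ext x; unfold rejectionBound; ring
  have : 0 ≤ A₂ := by linarith
  have : 0 < A₁ := by linarith
  rw [h1, integral_add, integral_add, integral_add, integral_const_mul, integral_const_mul,
    integral_const_mul, integral_const_mul]
  · have := h.integral_ρ_le u hu
    have := h.integral_sq_le u hu
    have := h.integral_κ_le u hu
    gcongr
  · exact (h.integrable_ρ u).const_mul _
  · exact (h.integrable_κ u).const_mul _
  · exact (h.integrable_ρ u).const_mul _
  · exact (h.integrable_sq u).const_mul _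
  · exact ((h.integrable_ρ u).const_mul _).add ((h.integrable_sq u).const_mul _)
  · exact ((h.integrable_ρ u).const_mul _).add ((h.integrable_κ u).const_mul _)

section Bias

variable {δ A₁ A₂ a : ℝ}

theorem integrable_weight_mul (h : IsPerturbation G C₀ H ρ κ b r) (hδ : 0 < δ) (ha0 : 0 < a)
    (hA₂ : 0 ≤ A₂) (u : EuclideanSpace ℝ (Fin d)) :
    Integrable (fun x => G x * (weight δ A₂ a (G x) * (G x - a) * tilt u x))
      (stdGaussian (EuclideanSpace ℝ (Fin d))) := by
  have hm := h.measurable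
  have hw : Measurable fun x => weight δ A₂ a (G x) :=
    (measurable_weight δ A₂).comp (measurable_const.prodMk hm)
  have ht := (continuous_tilt u).measurable
  refine ((integrable_tilt u).const_mul A₂).mono' (by fun_prop) (.of_forall fun x => ?_)
  rw [Real.norm_eq_abs, ← mul_assoc, abs_mul, abs_of_pos (tilt_pos u x)]
  exact mul_le_mul_of_nonneg_right (abs_mul_weight_le hδ ha0 hA₂ (G x)) (tilt_pos u x).le

/-- The bias of the numerator: the weighted mean of `(G - a) e_u` is close to its unweighted
Gaussian mean. -/
theorem abs_integral_sub_le (h : IsPerturbation G C₀ H ρ κ b r) (hδ : 0 < δ) (hδ1 : δ ≤ 1)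
    (hA₁ : 1 ≤ A₁) (hA₂ : 3 * A₁ ≤ A₂) (ha : |a - C₀| ≤ A₁) (ha0 : 0 < a)
    {u : EuclideanSpace ℝ (Fin d)} (hu : ‖u‖ ≤ 2) :
    |(∫ x, G x * (weight δ A₂ a (G x) * (G x - a) * tilt u x)
        ∂stdGaussian (EuclideanSpace ℝ (Fin d))) -
      (C₀ - a + ∫ x, tilt u x * H x ∂stdGaussian (EuclideanSpace ℝ (Fin d)))| ≤
      4 * r + 4 / A₁ * b + (A₂ / (δ * A₁) * r + A₂ * (2 * δ * A₁) * b) + r := by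
  have hA0 : 0 ≤ A₂ := by linarith
  have h1 := h.integrable_weight_mul hδ ha0 hA0 u
  have h2 : ∫ x, (C₀ - a) * tilt u x + tilt u x * H x ∂stdGaussian (EuclideanSpace ℝ (Fin d)) =
      C₀ - a + ∫ x, tilt u x * H x ∂stdGaussian (EuclideanSpace ℝ (Fin d)) := by
    rw [integral_add ((integrable_tilt u).const_mul _) (h.integrable_H u), integral_const_mul,
      integral_tilt, mul_one]
  have h3 : Integrable (fun x => (C₀ - a) * tilt u x + tilt u x * H x)
      (stdGaussian (EuclideanSpace ℝ (Fin d))) :=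
    ((integrable_tilt u).const_mul _).add (h.integrable_H u)
  rw [← h2, ← integral_sub h1 h3]
  refine (abs_integral_le_integral_abs).trans ?_
  refine (integral_mono_of_nonneg (.of_forall fun x => abs_nonneg _)
    ((h.integrable_rejectionBound δ A₁ A₂ u).add (h.integrable_ρ u))
    (.of_forall fun x => ?_)).trans ?_
  · simp only [Pi.add_apply]
    have h3 : G x * (weight δ A₂ a (G x) * (G x - a) * tilt u x) -
        ((C₀ - a) * tilt u x + tilt u x * H x) =
        tilt u x * (weight δ A₂ a (G x) * G x * (G x - a) - (C₀ + H x - a)) := by ring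
    rw [h3, abs_mul, abs_of_pos (tilt_pos u x), ← mul_add]
    refine mul_le_mul_of_nonneg_left ?_ (tilt_pos u x).le
    have h4 := abs_le.1 (h.abs_sub_le x)
    rcases weight_cases hδ ha0 (G x) (A := A₂) with ⟨h5, h6⟩ | ⟨h5, _, _⟩
    · have h7 := abs_le.1 (h.le_rejectionBound hδ hδ1 hA₁ hA₂ ha h6).2
      rw [h5, abs_le]; constructor <;> linarith
    · have h7 := h.rejectionBound_nonneg hδ hA₁ hA₂ x
      rw [h5, abs_le]; constructor <;> linarith
  · simp only [Pi.add_apply]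
    rw [integral_add (h.integrable_rejectionBound δ A₁ A₂ u) (h.integrable_ρ u)]
    exact add_le_add (h.integral_rejectionBound_le hδ hA₁ hA₂ hu) (h.integral_ρ_le u hu)

theorem integrable_weight (h : IsPerturbation G C₀ H ρ κ b r) (hδ : 0 < δ) (ha0 : 0 < a) :
    Integrable (fun x => G x * weight δ A₂ a (G x)) (stdGaussian (EuclideanSpace ℝ (Fin d))) := by
  have hm := h.measurable
  have hw : Measurable fun x => weight δ A₂ a (G x) :=
    (measurable_weight δ A₂).comp (measurable_const.prodMk hm)
  refine (integrable_const (1 : ℝ)).mono' (by fun_prop) (.of_forall fun x => ?_)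
  rcases weight_cases hδ ha0 (G x) (A := A₂) with ⟨h5, _⟩ | ⟨h5, _, _⟩
  · simp [h5]
  · rw [mul_comm, h5]; simp

/-- The bias of the denominator. -/
theorem abs_integral_weight_sub_le (h : IsPerturbation G C₀ H ρ κ b r) (hδ : 0 < δ) (hδ1 : δ ≤ 1)
    (hA₁ : 1 ≤ A₁) (hA₂ : 3 * A₁ ≤ A₂) (ha : |a - C₀| ≤ A₁) (ha0 : 0 < a) :
    |(∫ x, G x * weight δ A₂ a (G x) ∂stdGaussian (EuclideanSpace ℝ (Fin d))) - 1| ≤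
      (4 * r + 4 / A₁ * b + (A₂ / (δ * A₁) * r + A₂ * (2 * δ * A₁) * b)) / A₁ := by
  have hA0 : 0 < A₁ := by linarith
  have h1 := h.integrable_weight (A₂ := A₂) hδ ha0
  have h2 : ∫ _x, (1 : ℝ) ∂stdGaussian (EuclideanSpace ℝ (Fin d)) = 1 := by simp
  have hR := (h.integrable_rejectionBound δ A₁ A₂ 0)
  simp only [tilt_zero, one_mul] at hR
  have hRle := h.integral_rejectionBound_le hδ hA₁ hA₂ (u := 0) (by simp)
  simp only [tilt_zero, one_mul] at hRle
  conv_lhs => rw [← h2]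
  rw [← integral_sub h1 (integrable_const _)]
  refine (abs_integral_le_integral_abs).trans ?_
  refine (integral_mono_of_nonneg (.of_forall fun x => abs_nonneg _) (hR.div_const A₁)
    (.of_forall fun x => ?_)).trans ?_
  · dsimp only
    rcases weight_cases hδ ha0 (G x) (A := A₂) with ⟨h5, h6⟩ | ⟨h5, _, _⟩
    · rw [h5, mul_zero, zero_sub, abs_neg, abs_one, le_div_iff₀ hA0, one_mul]
      exact (h.le_rejectionBound hδ hδ1 hA₁ hA₂ ha h6).1
    · rw [mul_comm, h5, sub_self, abs_zero]
      exact div_nonneg (h.rejectionBound_nonneg hδ hA₁ hA₂ x) hA0.le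
  · rw [integral_div]
    gcongr

/-- The second moment of the numerator. -/
theorem integral_sq_weight_mul_le (h : IsPerturbation G C₀ H ρ κ b r) (hδ : 0 < δ)
    (ha0 : 0 < a) {u : EuclideanSpace ℝ (Fin d)} (hu : ‖u‖ ≤ 2) :
    Integrable (fun x => G x * (weight δ A₂ a (G x) * (G x - a) * tilt u x) ^ 2)
      (stdGaussian (EuclideanSpace ℝ (Fin d))) ∧
    ∫ x, G x * (weight δ A₂ a (G x) * (G x - a) * tilt u x) ^ 2
      ∂stdGaussian (EuclideanSpace ℝ (Fin d)) ≤ A₂ ^ 2 * Real.exp 4 / (δ * a) := by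
  have hm := h.measurable
  have hw : Measurable fun x => weight δ A₂ a (G x) :=
    (measurable_weight δ A₂).comp (measurable_const.prodMk hm)
  have ht := (continuous_tilt u).measurable
  have hb : ∀ x, |G x * (weight δ A₂ a (G x) * (G x - a) * tilt u x) ^ 2| ≤
      A₂ ^ 2 / (δ * a) * tilt u x ^ 2 := by
    intro x
    rw [mul_pow, ← mul_assoc, abs_mul, abs_of_nonneg (sq_nonneg (tilt u x))]
    gcongr
    rcases weight_cases hδ ha0 (G x) (A := A₂) with ⟨h5, h6⟩ | ⟨h5, h6, h7⟩
    · rw [h5]; simp; positivity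
    · have h8 : 0 < δ * a := by positivity
      have h9 : 0 < G x := h8.trans_le h6
      have h10 : weight δ A₂ a (G x) = 1 / G x := by field_simp; exact h5
      have h11 : G x * (weight δ A₂ a (G x) * (G x - a)) ^ 2 = (G x - a) ^ 2 / G x := by
        rw [h10]; field_simp
      rw [h11, abs_of_nonneg (by positivity), ← sq_abs (G x - a)]
      gcongr
  have hi := (integrable_tilt_sq u).const_mul (A₂ ^ 2 / (δ * a))
  refine ⟨hi.mono' (by fun_prop) (.of_forall hb), ?_⟩
  refine (integral_mono_of_nonneg (.of_forall fun x => mul_nonneg (h.nonneg x) (sq_nonneg _)) hi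
    (.of_forall fun x => (le_abs_self _).trans (hb x))).trans ?_
  rw [integral_const_mul, integral_tilt_sq, div_mul_eq_mul_div]
  have : ‖u‖ ^ 2 ≤ 2 ^ 2 := by gcongr
  gcongr
  linarith

/-- The second moment of the denominator. -/
theorem integral_sq_weight_le (h : IsPerturbation G C₀ H ρ κ b r) (hδ : 0 < δ) (ha0 : 0 < a) :
    Integrable (fun x => G x * weight δ A₂ a (G x) ^ 2)
      (stdGaussian (EuclideanSpace ℝ (Fin d))) ∧
    ∫ x, G x * weight δ A₂ a (G x) ^ 2 ∂stdGaussian (EuclideanSpace ℝ (Fin d)) ≤ 1 / (δ * a) := by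
  have hm := h.measurable
  have hw : Measurable fun x => weight δ A₂ a (G x) :=
    (measurable_weight δ A₂).comp (measurable_const.prodMk hm)
  have hb : ∀ x, |G x * weight δ A₂ a (G x) ^ 2| ≤ 1 / (δ * a) := by
    intro x
    rcases weight_cases hδ ha0 (G x) (A := A₂) with ⟨h5, h6⟩ | ⟨h5, h6, h7⟩
    · rw [h5]; simp; positivity
    · have h8 : 0 < δ * a := by positivity
      have h9 : 0 < G x := h8.trans_le h6
      have h10 : weight δ A₂ a (G x) = 1 / G x := by field_simp; exact h5
      have h11 : G x * weight δ A₂ a (G x) ^ 2 = 1 / G x := by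
        rw [h10]; field_simp
      rw [h11, abs_of_nonneg (by positivity)]
      gcongr
  have hi := integrable_const (μ := stdGaussian (EuclideanSpace ℝ (Fin d))) (1 / (δ * a))
  refine ⟨hi.mono' (by fun_prop) (.of_forall hb), ?_⟩
  refine (integral_mono_of_nonneg (.of_forall fun x => mul_nonneg (h.nonneg x) (sq_nonneg _)) hi
    (.of_forall fun x => (le_abs_self _).trans (hb x))).trans ?_
  simp

end Bias

end IsPerturbation

end Perturbation

/-! ### Concentration of the estimator -/

section Chebyshev

variable {Ω α : Type*} [MeasurableSpace Ω] [MeasurableSpace α] {μ : Measure Ω}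
  [IsProbabilityMeasure μ]

/-- Chebyshev's inequality for the mean of independent and identically distributed numbers. -/
theorem measure_abs_average_sub_ge_le {ν : Measure α} {Y : ℕ → Ω → α} (hY : ∀ n, Measurable (Y n))
    (hind : iIndepFun Y μ) (hlaw : ∀ n, μ.map (Y n) = ν) {φ : α → ℝ} (hφ : Measurable φ)
    (hφ2 : Integrable (fun x => φ x ^ 2) ν) {V τ : ℝ} (hV : ∫ x, φ x ^ 2 ∂ν ≤ V) (hτ : 0 < τ)
    {N : ℕ} (hN : 0 < N) :
    μ {ω | τ ≤ |(∑ n ∈ Finset.range N, φ (Y n ω)) / N - ∫ x, φ x ∂ν|} ≤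
      ENNReal.ofReal (V / (N * τ ^ 2)) := by
  have hN' : (0 : ℝ) < N := by exact_mod_cast hN
  have hmem : ∀ n, MemLp (fun ω => φ (Y n ω)) 2 μ := fun n => by
    have : AEStronglyMeasurable (fun ω => φ (Y n ω)) μ :=
      (hφ.comp (hY n)).aestronglyMeasurable
    rw [memLp_two_iff_integrable_sq this]
    rw [← hlaw n] at hφ2
    exact hφ2.comp_measurable (hY n)
  have hint : ∀ n, ∫ ω, φ (Y n ω) ∂μ = ∫ x, φ x ∂ν := fun n => by
    rw [← hlaw n, integral_map (hY n).aemeasurable hφ.aestronglyMeasurable]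
  have hvar : ∀ n, variance (fun ω => φ (Y n ω)) μ ≤ V := fun n => by
    refine (variance_le_expectation_sq (hφ.comp (hY n)).aestronglyMeasurable).trans
      (le_trans (le_of_eq ?_) hV)
    rw [← hlaw n, integral_map (hY n).aemeasurable (by fun_prop)]
    rfl
  have hsum : MemLp (∑ n ∈ Finset.range N, fun ω => φ (Y n ω)) 2 μ :=
    memLp_finsetSum' _ fun n _ => hmem n
  have hE : ∫ ω, (∑ n ∈ Finset.range N, fun ω => φ (Y n ω)) ω ∂μ = N * ∫ x, φ x ∂ν := by
    simp only [Finset.sum_apply]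
    rw [integral_finsetSum _ fun n _ => (hmem n).integrable (by norm_num)]
    simp [hint]
  have hvs : variance (∑ n ∈ Finset.range N, fun ω => φ (Y n ω)) μ ≤ N * V := by
    rw [IndepFun.variance_sum (fun n _ => hmem n)
      fun i _ j _ hij => (hind.indepFun hij).comp hφ hφ]
    calc _ ≤ ∑ _n ∈ Finset.range N, V := Finset.sum_le_sum fun n _ => hvar n
      _ = _ := by simp
  have h := meas_ge_le_variance_div_sq hsum (mul_pos hN' hτ)
  rw [hE] at h
  refine le_trans (measure_mono fun ω hω => ?_) (h.trans (ENNReal.ofReal_le_ofReal ?_))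
  · simp only [Set.mem_ofPred_eq, Finset.sum_apply] at hω ⊢
    have h1 : ∑ n ∈ Finset.range N, φ (Y n ω) - N * ∫ x, φ x ∂ν =
        N * ((∑ n ∈ Finset.range N, φ (Y n ω)) / N - ∫ x, φ x ∂ν) := by field_simp
    rw [h1, abs_mul, abs_of_pos hN']
    gcongr
  · calc _ ≤ N * V / (N * τ) ^ 2 := by gcongr
      _ = _ := by field_simp

end Chebyshev

theorem abs_div_sub_le {n m Ψ P e₁ e₂ : ℝ} (hn : |n - Ψ| ≤ e₁) (hm : |m - 1| ≤ e₂)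
    (he₂ : e₂ ≤ 1 / 2) (hP : |Ψ| ≤ P) : |n / m - Ψ| ≤ 2 * (e₁ + P * e₂) := by
  have h1 := abs_le.1 hm
  have hm0 : 1 / 2 ≤ m := by linarith
  have h2 : n / m - Ψ = ((n - Ψ) - Ψ * (m - 1)) / m := by
    field_simp; ring
  have h3 : |(n - Ψ) - Ψ * (m - 1)| ≤ e₁ + P * e₂ := by
    refine (abs_sub _ _).trans (add_le_add hn ?_)
    rw [abs_mul]
    exact mul_le_mul hP hm (abs_nonneg _) ((abs_nonneg _).trans hP)
  rw [h2, abs_div, abs_of_pos (by linarith : 0 < m), div_le_iff₀ (by linarith)]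
  nlinarith [(abs_nonneg _).trans h3]

section Concentration

variable {d : ℕ} {G H ρ κ : EuclideanSpace ℝ (Fin d) → ℝ} {C₀ b r : ℝ}

/-- A bound for the integral of `tilt u * rejectionBound`. -/
def rejectionError (b r δ A₁ A₂ : ℝ) : ℝ :=
  4 * r + 4 / A₁ * b + (A₂ / (δ * A₁) * r + A₂ * (2 * δ * A₁) * b)

namespace IsPerturbation

theorem integral_pos (h : IsPerturbation G C₀ H ρ κ b r) :
    0 < ∫ x, G x ∂stdGaussian (EuclideanSpace ℝ (Fin d)) := by
  have := h.le_integral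
  have := h.const_nonneg
  have := one_div_pos.2 (zero_lt_one.trans_le h.one_le)
  linarith

/-- For a fixed admissible reference label `a`, the empirical Laplace transform is accurate with
high probability. -/
theorem measure_empirical_le (h : IsPerturbation G C₀ H ρ κ b r) {Ω : Type*} [MeasurableSpace Ω]
    {μ : Measure Ω} [IsProbabilityMeasure μ] {Y : ℕ → Ω → EuclideanSpace ℝ (Fin d)}
    (hY : ∀ n, Measurable (Y n)) (hind : iIndepFun Y μ) (hlaw : ∀ n, μ.map (Y n) = biasedLaw G)
    {δ β A₁ A₂ a τ : ℝ} (hδ : 0 < δ) (hδ1 : δ ≤ 1) (hβ : 0 < β) (hA₁ : 1 ≤ A₁) (hb : b ≤ A₁)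
    (hA₂ : 3 * A₁ ≤ A₂) (ha : |a - C₀| ≤ A₁)
    (haβ : β * ∫ x, G x ∂stdGaussian (EuclideanSpace ℝ (Fin d)) ≤ a) (hτ : 0 < τ)
    (hsmall : τ + rejectionError b r δ A₁ A₂ / A₁ ≤ 1 / 2) {N : ℕ} (hN : 0 < N)
    {u : EuclideanSpace ℝ (Fin d)} (hu : ‖u‖ ≤ 2) :
    μ {ω | ¬ |empirical δ A₂ a N (fun n => Y n ω) (fun n => G (Y n ω)) u -
        (C₀ - a + ∫ x, tilt u x * H x ∂stdGaussian (EuclideanSpace ℝ (Fin d)))| ≤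
        6 * (rejectionError b r δ A₁ A₂ + r + A₁ * τ)} ≤
      ENNReal.ofReal (2 * (A₂ ^ 2 * Real.exp 4 / (δ * β)) / (N * τ ^ 2)) := by
  set S := ∫ x, G x ∂stdGaussian (EuclideanSpace ℝ (Fin d)) with hS
  have hS0 : 0 < S := h.integral_pos
  have ha0 : 0 < a := lt_of_lt_of_le (by positivity) haβ
  have hA0 : 0 < A₁ := by linarith
  have hA20 : 0 ≤ A₂ := by linarith
  have hN' : (0 : ℝ) < N := by exact_mod_cast hN
  have hm := h.measurable
  have hw : Measurable fun x => weight δ A₂ a (G x) :=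
    (measurable_weight δ A₂).comp (measurable_const.prodMk hm)
  have ht := (continuous_tilt u).measurable
  set V := A₂ ^ 2 * Real.exp 4 / (δ * β) with hV
  have hV0 : 0 < V := by
    have : 0 < A₂ := by linarith
    positivity
  -- the numerator and the denominator
  set φ₁ : EuclideanSpace ℝ (Fin d) → ℝ := fun x => weight δ A₂ a (G x) * (G x - a) * tilt u x
  set φ₂ : EuclideanSpace ℝ (Fin d) → ℝ := fun x => weight δ A₂ a (G x)
  obtain ⟨hi₁, hV₁⟩ := h.integral_sq_weight_mul_le (A₂ := A₂) hδ ha0 hu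
  obtain ⟨hi₂, hV₂⟩ := h.integral_sq_weight_le (A₂ := A₂) hδ ha0
  have hcheb : ∀ φ : EuclideanSpace ℝ (Fin d) → ℝ, Measurable φ →
      Integrable (fun x => G x * φ x ^ 2) (stdGaussian (EuclideanSpace ℝ (Fin d))) →
      ∫ x, G x * φ x ^ 2 ∂stdGaussian (EuclideanSpace ℝ (Fin d)) ≤
        A₂ ^ 2 * Real.exp 4 / (δ * a) →
      μ {ω | τ ≤ |S * (∑ n ∈ Finset.range N, φ (Y n ω)) / N -
        ∫ x, G x * φ x ∂stdGaussian (EuclideanSpace ℝ (Fin d))|} ≤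
        ENNReal.ofReal (V / (N * τ ^ 2)) := by
    intro φ hφ hφi hφV
    have h1 := measure_abs_average_sub_ge_le hY hind hlaw hφ
      (integrable_biasedLaw hm h.nonneg h.integrable hS0 hφi) (V := V / S ^ 2) (τ := τ / S) (by
        rw [integral_biasedLaw hm h.nonneg h.integrable, ← hS, div_le_div_iff₀ hS0 (by positivity)]
        have : A₂ ^ 2 * Real.exp 4 / (δ * a) ≤ V / S := by
          rw [hV, div_div, mul_assoc δ β]
          gcongr
        calc _ ≤ V / S * S ^ 2 := by gcongr; exact hφV.trans this
          _ = _ := by field_simp) (by positivity) hN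
    rw [integral_biasedLaw hm h.nonneg h.integrable, ← hS] at h1
    refine le_trans (measure_mono fun ω hω => ?_)
      (h1.trans (ENNReal.ofReal_le_ofReal (le_of_eq ?_)))
    · simp only [Set.mem_ofPred_eq] at hω ⊢
      rw [div_le_iff₀ hS0]
      refine hω.trans (le_of_eq ?_)
      rw [← abs_of_pos hS0, ← abs_mul, abs_of_pos hS0]
      congr 1
      field_simp
    · field_simp
  have hc₁ := hcheb φ₁ ((hw.mul (hm.sub_const a)).mul ht) hi₁ hV₁
  have hc₂ := hcheb φ₂ hw hi₂ (hV₂.trans (by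
    gcongr
    have h1 : 1 ≤ Real.exp 4 := Real.one_le_exp (by norm_num)
    have h2 : 1 ≤ A₂ := by linarith
    nlinarith))
  set E := rejectionError b r δ A₁ A₂ with hE
  have hb₁ := h.abs_integral_sub_le hδ hδ1 hA₁ hA₂ ha ha0 hu
  have hb₂ := h.abs_integral_weight_sub_le hδ hδ1 hA₁ hA₂ ha ha0
  set I := ∫ x, tilt u x * H x ∂stdGaussian (EuclideanSpace ℝ (Fin d)) with hI
  have hI0 : 0 ≤ I := integral_nonneg fun x => mul_nonneg (tilt_pos u x).le (h.H_nonneg x)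
  have hIb : I ≤ b := h.integral_H_le u hu
  refine (measure_mono (t := {ω | τ ≤ |S * (∑ n ∈ Finset.range N, φ₁ (Y n ω)) / N -
        ∫ x, G x * φ₁ x ∂stdGaussian (EuclideanSpace ℝ (Fin d))|} ∪
      {ω | τ ≤ |S * (∑ n ∈ Finset.range N, φ₂ (Y n ω)) / N -
        ∫ x, G x * φ₂ x ∂stdGaussian (EuclideanSpace ℝ (Fin d))|}) fun ω hω => ?_).trans ?_
  · by_contra hcon
    simp only [Set.mem_union, Set.mem_ofPred_eq, not_or, not_le] at hcon hω
    refine absurd ?_ (not_le.2 hω)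
    have h1 : |S * (∑ n ∈ Finset.range N, φ₁ (Y n ω)) / N - (C₀ - a + I)| ≤ τ + (E + r) := by
      refine (_root_.abs_sub_le _ _ _).trans (add_le_add hcon.1.le hb₁)
    have h2 : |S * (∑ n ∈ Finset.range N, φ₂ (Y n ω)) / N - 1| ≤ τ + E / A₁ :=
      (_root_.abs_sub_le _ _ _).trans (add_le_add hcon.2.le hb₂)
    have h3 : |C₀ - a + I| ≤ 2 * A₁ := by
      have := abs_le.1 ha
      rw [abs_le]; constructor <;> linarith
    have h4 := abs_div_sub_le h1 h2 hsmall h3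
    have h5 : empirical δ A₂ a N (fun n => Y n ω) (fun n => G (Y n ω)) u =
        S * (∑ n ∈ Finset.range N, φ₁ (Y n ω)) / N /
          (S * (∑ n ∈ Finset.range N, φ₂ (Y n ω)) / N) := by
      rw [div_div_div_cancel_right₀ hN'.ne', mul_div_mul_left _ _ hS0.ne']
      rfl
    rw [h5]
    refine h4.trans ?_
    have h6 : 2 * A₁ * (τ + E / A₁) = 2 * A₁ * τ + 2 * E := by field_simp
    rw [h6]
    have h7 : τ ≤ A₁ * τ := le_mul_of_one_le_left hτ.le hA₁
    have h8 : 0 ≤ r := by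
      refine le_trans ?_ (h.integral_ρ_le u hu)
      exact integral_nonneg fun x => mul_nonneg (tilt_pos u x).le (h.ρ_nonneg x)
    linarith
  · refine (measure_union_le _ _).trans ((add_le_add hc₁ hc₂).trans (le_of_eq ?_))
    rw [← ENNReal.ofReal_add (by positivity) (by positivity)]
    congr 1; ring

/-- A label is admissible as a reference label with high probability. -/
theorem biasedLaw_reference_le (h : IsPerturbation G C₀ H ρ κ b r) {β A₁ : ℝ} (hβ : 0 ≤ β)
    (hA₁ : 1 ≤ A₁) :
    (biasedLaw G).real {x | ¬ (|G x - C₀| ≤ A₁ ∧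
      β * ∫ x, G x ∂stdGaussian (EuclideanSpace ℝ (Fin d)) ≤ G x)} ≤
      2 * b * (2 * r + 4 / A₁ * b) + β := by
  set S := ∫ x, G x ∂stdGaussian (EuclideanSpace ℝ (Fin d)) with hS
  have hS0 : 0 < S := h.integral_pos
  have hA0 : 0 < A₁ := by linarith
  have hb0 : 0 < b := zero_lt_one.trans_le h.one_le
  have hm := h.measurable
  have hA : MeasurableSet {x | ¬ (|G x - C₀| ≤ A₁ ∧ β * S ≤ G x)} :=
    ((measurableSet_le (hm.sub_const C₀).norm measurable_const).inter
      (measurableSet_le measurable_const hm)).compl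
  rw [biasedLaw_real_apply hm h.nonneg h.integrable hA, ← hS, div_le_iff₀ hS0]
  -- on the bad event, the label is small or the perturbation is large
  set q : EuclideanSpace ℝ (Fin d) → ℝ := fun x => 2 * ρ x + 4 / A₁ * H x ^ 2 with hq
  have hρ : Integrable ρ (stdGaussian (EuclideanSpace ℝ (Fin d))) := by
    simpa [tilt_zero] using h.integrable_ρ 0
  have hH2 : Integrable (fun x => H x ^ 2) (stdGaussian (EuclideanSpace ℝ (Fin d))) := by
    simpa [tilt_zero] using h.integrable_sq 0
  have hqi : Integrable q (stdGaussian (EuclideanSpace ℝ (Fin d))) :=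
    (hρ.const_mul 2).add (hH2.const_mul _)
  have hqle : ∫ x, q x ∂stdGaussian (EuclideanSpace ℝ (Fin d)) ≤ 2 * r + 4 / A₁ * b := by
    have h1 := h.integral_ρ_le 0 (by simp)
    have h2 := h.integral_sq_le 0 (by simp)
    simp only [tilt_zero, one_mul] at h1 h2
    rw [hq, integral_add (hρ.const_mul 2) (hH2.const_mul _), integral_const_mul, integral_const_mul]
    gcongr
  have hq0 : 0 ≤ ∫ x, q x ∂stdGaussian (EuclideanSpace ℝ (Fin d)) :=
    integral_nonneg fun x => by
      have := h.ρ_nonneg x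
      simp only [hq, Pi.zero_apply]; positivity
  have hpt : ∀ x, ({x | ¬ (|G x - C₀| ≤ A₁ ∧ β * S ≤ G x)}.indicator G) x ≤
      (C₀ + 1) * q x + β * S := by
    intro x
    have h1 := h.ρ_nonneg x
    have h2 : 0 ≤ q x := by simp only [hq]; positivity
    have hC := h.const_nonneg
    have h3 : 0 ≤ β * S := by positivity
    by_cases hx : |G x - C₀| ≤ A₁
    · by_cases hx' : β * S ≤ G x
      · rw [Set.indicator_of_notMem (by simp [hx, hx'])]; positivity
      · refine (Set.indicator_le_self' (fun _ _ => h.nonneg _) x).trans ?_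
        push Not at hx'
        nlinarith
    · push Not at hx
      refine (Set.indicator_le_self' (fun _ _ => h.nonneg _) x).trans ?_
      have h4 := abs_le.1 (h.abs_sub_le x)
      have h5 := h.H_nonneg x
      have h6 : |G x - C₀| ≤ H x + ρ x := by
        rw [abs_le]; constructor <;> linarith
      have h7 := h.add_le hA0 (x := x) (hx.trans_le h6)
      have h8 : 1 ≤ q x := by
        simp only [hq]; linarith
      have h9 : G x ≤ C₀ + q x := by
        simp only [hq]; linarith
      nlinarith
  have hint : ∫ x, (C₀ + 1) * q x + β * S ∂stdGaussian (EuclideanSpace ℝ (Fin d)) =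
      (C₀ + 1) * ∫ x, q x ∂stdGaussian (EuclideanSpace ℝ (Fin d)) + β * S := by
    rw [integral_add (hqi.const_mul _) (integrable_const _), integral_const_mul]
    simp
  refine (integral_mono_of_nonneg
    (.of_forall fun x => Set.indicator_nonneg (fun _ _ => h.nonneg _) x)
    ((hqi.const_mul _).add (integrable_const _)) (.of_forall hpt)).trans ?_
  simp only [Pi.add_apply]
  rw [hint, add_mul (2 * b * (2 * r + 4 / A₁ * b)) β S]
  refine add_le_add_left ?_ (β * S)
  have h1 := h.le_integral
  have h2 : 1 ≤ b * S := by
    have : b * (1 / b) ≤ b * S := by gcongr; linarith [h.const_nonneg]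
    rwa [mul_one_div_cancel hb0.ne'] at this
  have h3 : C₀ + 1 ≤ 2 * b * S := by
    have h4 : C₀ ≤ S := by linarith [one_div_pos.2 hb0]
    nlinarith [h.one_le]
  calc (C₀ + 1) * ∫ x, q x ∂stdGaussian (EuclideanSpace ℝ (Fin d))
      ≤ (2 * b * S) * (2 * r + 4 / A₁ * b) := by gcongr
    _ = _ := by ring

end IsPerturbation

end Concentration


/-! ### The network has the required form -/

section Network

open scoped Matrix.Norms.L2Operator

variable {d : ℕ}

theorem exp_six_le {L : ℝ} (hL : 128 ≤ L) : Real.exp 6 ≤ L ^ 2 := by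
  have h1 : Real.exp 1 ≤ 3 := Real.exp_one_lt_d9.le.trans (by norm_num)
  calc Real.exp 6 = Real.exp 1 ^ 6 := by rw [← Real.exp_nat_mul]; norm_num
    _ ≤ 3 ^ 6 := by gcongr
    _ ≤ 128 ^ 2 := by norm_num
    _ ≤ L ^ 2 := by gcongr

/-- The network is a perturbation of a sum of exponentials: a single exponential with coefficient at
least `1 / L` bounds the sum from below, and the bound `b = L ^ 6` is a power of `L` because `d`,
the coefficients and `e ^ 6` are dominated by powers of `L`. -/
theorem network_isPerturbation {t K L : ℝ} {W : Matrix (Fin d) (Fin d) ℝ}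
    {c : Finset (Fin d) → ℝ} (i₀ : Fin d) (hL : 128 ≤ L) (hdL : d ≤ L) (hK : 1 ≤ K)
    (hKL : Real.exp (4 * K + K ^ 2) ≤ L)
    (hrow : ∀ i, ‖(WithLp.toLp 2 (W i) : EuclideanSpace ℝ (Fin d))‖ = 1) (hW : IsUnit W.det)
    (hWK : ‖W‖ ≤ K) (hc : ∀ i, 1 / L ≤ c {i} ∧ c {i} ≤ L)
    (hcS : ∀ S : Finset (Fin d), 1 < S.card → |c S| ≤ L) (hf : ∀ x, 0 ≤ network t W c x)
    (ht : L ^ 7 * Real.exp (-t) ≤ 1) :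
    IsPerturbation (fun x => Real.exp t * network t W c x) (Real.exp t * c ∅)
      (rowLaplace W fun i => c {i}) (remainder t W L) (fun x => L * Real.exp (-W.mulVec x.ofLp i₀))
      (L ^ 6) (L ^ 5 * Real.exp (-t)) := by
  have hL0 : 0 < L := by linarith
  have hL1 : 1 ≤ L := by linarith
  have hpow : ∀ n, 1 ≤ L ^ n := fun n => one_le_pow₀ hL1
  have hc0 : ∀ i, 0 ≤ c {i} := fun i => le_trans (by positivity) (hc i).1
  have he6 := exp_six_le hL
  have hcont := continuous_network t W c
  have hGi : Integrable (fun x => Real.exp t * network t W c x)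
      (stdGaussian (EuclideanSpace ℝ (Fin d))) := by
    refine Integrable.const_mul ?_ _
    exact (integrable_const (∑ S, |c S|)).mono' hcont.aestronglyMeasurable
      (.of_forall fun x => abs_network_le t W c x)
  have hdecomp := abs_exp_mul_network_sub_le (t := t) (M := L) (W := W)
    (fun i => ⟨hc0 i, (hc i).2⟩) hcS
  have hHi := fun u => integrable_tilt_mul_rowLaplace W (fun i => c {i}) u
  have hRi := fun u => integrable_tilt_mul_remainder t W L u
  have hexpi := fun u i => integrable_tilt_mul_exp_row W u i 2
  have hκ : ∀ u, (fun x : EuclideanSpace ℝ (Fin d) =>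
      tilt u x * (L * Real.exp (-W.mulVec x.ofLp i₀))) =
      fun x => L * (tilt u x * Real.exp ((-1) * W.mulVec x.ofLp i₀)) := fun u => by
    ext x; rw [neg_one_mul]; ring
  have hsq : ∀ u x, tilt u x * rowLaplace W (fun i => c {i}) x ^ 2 ≤
      d * L ^ 2 * ∑ i, tilt u x * Real.exp (2 * W.mulVec x.ofLp i) := fun u x => by
    rw [← Finset.mul_sum, mul_left_comm]
    exact mul_le_mul_of_nonneg_left (sq_rowLaplace_le W (fun i => ⟨hc0 i, (hc i).2⟩) x)
      (tilt_pos u x).le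
  have hsqi : ∀ u, Integrable (fun x : EuclideanSpace ℝ (Fin d) =>
      d * L ^ 2 * ∑ i, tilt u x * Real.exp (2 * W.mulVec x.ofLp i))
        (stdGaussian (EuclideanSpace ℝ (Fin d))) := fun u =>
    (integrable_finsetSum _ fun i _ => hexpi u i).const_mul _
  have hHcont : Continuous (rowLaplace W fun i => c {i}) := by
    unfold rowLaplace Matrix.mulVec dotProduct
    fun_prop
  have hr : ∀ u : EuclideanSpace ℝ (Fin d), ‖u‖ ≤ 2 →
      ∫ x, tilt u x * remainder t W L x ∂stdGaussian (EuclideanSpace ℝ (Fin d)) ≤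
        L ^ 5 * Real.exp (-t) := by
    intro u hu
    refine (integral_tilt_mul_remainder_le hrow hK hWK hL0.le ?_ hu).trans ?_
    · have h1 : Real.exp (2 * K + K ^ 2 / 2 - t) ≤ L * Real.exp (-t) := by
        rw [sub_eq_add_neg, Real.exp_add]
        gcongr
        refine le_trans (Real.exp_le_exp.2 ?_) hKL
        nlinarith
      calc d * Real.exp (2 * K + K ^ 2 / 2 - t) ≤ L * (L * Real.exp (-t)) := by gcongr
        _ = L ^ 2 * Real.exp (-t) := by ring
        _ ≤ L ^ 7 * Real.exp (-t) := by gcongr; norm_num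
        _ ≤ 1 := ht
    · gcongr
      calc L * (d * Real.exp 6 + d ^ 2 * Real.exp (4 * K + K ^ 2)) ≤
            L * (L * L ^ 2 + L ^ 2 * L) := by gcongr
        _ = 2 * L ^ 4 := by ring
        _ ≤ L * L ^ 4 := by gcongr; linarith
        _ = L ^ 5 := by ring
  refine
    { measurable := (hcont.const_mul _ |>.measurable)
      nonneg := fun x => mul_nonneg (Real.exp_pos _).le (hf x)
      const_nonneg := mul_nonneg (Real.exp_pos _).le (constantTerm_nonneg hW hf)
      integrable := hGi
      H_nonneg := fun x => Finset.sum_nonneg fun i _ => mul_nonneg (hc0 i) (Real.exp_pos _).le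
      κ_nonneg := fun x => by positivity
      abs_sub_le := hdecomp
      one_le_mul := fun x => ?_
      integrable_H := hHi
      integrable_sq := fun u => ?_
      integrable_ρ := hRi
      integrable_κ := fun u => ?_
      one_le := hpow 6
      integral_H_le := fun u hu => ?_
      integral_sq_le := fun u hu => ?_
      integral_κ_le := fun u hu => ?_
      integral_ρ_le := hr
      le_integral := ?_ }
  · have h1 : 1 / L * Real.exp (W.mulVec x.ofLp i₀) ≤ rowLaplace W (fun i => c {i}) x := by
      refine le_trans ?_ (Finset.single_le_sum (f := fun i => c {i} * Real.exp (W.mulVec x.ofLp i))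
        (fun i _ => mul_nonneg (hc0 i) (Real.exp_pos _).le) (Finset.mem_univ i₀))
      exact mul_le_mul_of_nonneg_right (hc i₀).1 (Real.exp_pos _).le
    calc (1 : ℝ) = 1 / L * Real.exp (W.mulVec x.ofLp i₀) *
          (L * Real.exp (-W.mulVec x.ofLp i₀)) := by
          rw [Real.exp_neg]
          have := Real.exp_pos (W.mulVec x.ofLp i₀)
          field_simp
      _ ≤ _ := by gcongr
  · refine (hsqi u).mono' (((continuous_tilt u).mul (hHcont.pow 2)).aestronglyMeasurable)
      (.of_forall fun x => ?_)
    rw [Real.norm_of_nonneg (mul_nonneg (tilt_pos u x).le (sq_nonneg _))]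
    exact hsq u x
  · rw [hκ]
    exact (integrable_tilt_mul_exp_row W u i₀ (-1)).const_mul L
  · rw [integral_tilt_mul_rowLaplace hrow, rowLaplace, Finset.mul_sum]
    calc ∑ i, Real.exp (1 / 2) * (c {i} * Real.exp (W.mulVec u.ofLp i))
        ≤ ∑ _i : Fin d, L * Real.exp 6 := by
          refine Finset.sum_le_sum fun i _ => ?_
          have h1 : Real.exp (1 / 2) * Real.exp (W.mulVec u.ofLp i) ≤ Real.exp 6 := by
            rw [← Real.exp_add]
            have := (abs_le.1 ((abs_mulVec_le_norm hrow u i).trans hu)).2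
            gcongr; linarith
          calc _ = c {i} * (Real.exp (1 / 2) * Real.exp (W.mulVec u.ofLp i)) := by ring
            _ ≤ _ := mul_le_mul (hc i).2 h1 (by positivity) hL0.le
      _ = d * (L * Real.exp 6) := by simp
      _ ≤ L * (L * L ^ 2) := by gcongr
      _ = L ^ 4 := by ring
      _ ≤ _ := pow_le_pow_right₀ hL1 (by norm_num)
  · refine (integral_mono_of_nonneg (.of_forall fun x => mul_nonneg (tilt_pos u x).le (sq_nonneg _))
      (hsqi u) (.of_forall (hsq u))).trans ?_
    rw [integral_const_mul, integral_finsetSum _ fun i _ => hexpi u i]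
    calc _ ≤ d * L ^ 2 * ∑ _i : Fin d, Real.exp 6 := by
          gcongr with i
          refine (integral_tilt_mul_exp_row_le hrow hu i 2).trans (le_of_eq ?_)
          norm_num
      _ = d * L ^ 2 * (d * Real.exp 6) := by simp
      _ ≤ L * L ^ 2 * (L * L ^ 2) := by gcongr
      _ = _ := by ring
  · rw [hκ, integral_const_mul]
    calc _ ≤ L * Real.exp 6 := by
          gcongr
          refine (integral_tilt_mul_exp_row_le hrow hu i₀ (-1)).trans ?_
          norm_num
      _ ≤ L * L ^ 2 := by gcongr
      _ = L ^ 3 := by ring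
      _ ≤ _ := pow_le_pow_right₀ hL1 (by norm_num)
  · have hH0 := hHi 0
    have hR0 := hRi 0
    have hr0 := hr 0 (by simp)
    have hH := integral_tilt_mul_rowLaplace hrow (fun i => c {i}) 0
    simp only [tilt_zero, one_mul] at hH0 hR0 hr0 hH
    have h1 : ∫ x, (Real.exp t * c ∅ + rowLaplace W (fun i => c {i}) x) - remainder t W L x
        ∂stdGaussian (EuclideanSpace ℝ (Fin d)) ≤
        ∫ x, Real.exp t * network t W c x ∂stdGaussian (EuclideanSpace ℝ (Fin d)) := by
      refine integral_mono (((integrable_const _).add hH0).sub hR0) hGi fun x => ?_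
      have := (abs_le.1 (hdecomp x)).1
      dsimp only
      linarith
    have h2 : ∫ x, (Real.exp t * c ∅ + rowLaplace W (fun i => c {i}) x) - remainder t W L x
        ∂stdGaussian (EuclideanSpace ℝ (Fin d)) =
        Real.exp t * c ∅ + Real.exp (1 / 2) * rowLaplace W (fun i => c {i}) 0 -
          ∫ x, remainder t W L x ∂stdGaussian (EuclideanSpace ℝ (Fin d)) := by
      rw [integral_sub (by exact (integrable_const _).add hH0) hR0,
        integral_add (integrable_const _) hH0, hH]
      simp
    have h3 : 1 / L ≤ Real.exp (1 / 2) * rowLaplace W (fun i => c {i}) 0 := by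
      have h4 : 1 / L ≤ rowLaplace W (fun i => c {i}) 0 := by
        refine (hc i₀).1.trans ?_
        have := Finset.single_le_sum (f := fun i => c {i} * Real.exp (W.mulVec 0 i))
          (fun i _ => mul_nonneg (hc0 i) (Real.exp_pos _).le) (Finset.mem_univ i₀)
        simpa [rowLaplace] using this
      have h5 : 1 ≤ Real.exp (1 / 2) := Real.one_le_exp (by norm_num)
      refine h4.trans (le_mul_of_one_le_left (le_trans (by positivity) h4) h5)
    have h6 : L ^ 5 * Real.exp (-t) ≤ 1 / L ^ 2 := by
      rw [le_div_iff₀ (by positivity)]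
      calc _ = L ^ 7 * Real.exp (-t) := by ring
        _ ≤ 1 := ht
    have h7 : 1 / L ^ 6 ≤ 1 / L ^ 2 :=
      one_div_le_one_div_of_le (by positivity) (pow_le_pow_right₀ hL1 (by norm_num))
    have h8 : 1 / L ^ 2 + 1 / L ^ 2 ≤ 1 / L := by
      rw [← add_div, div_le_div_iff₀ (by positivity) hL0]; nlinarith
    linarith

end Network


/-! ### The random direction -/

section Direction

open scoped Matrix.Norms.L2Operator

variable {d : ℕ}

theorem gaussianReal_abs_ge_le {c : ℝ} (hc : 0 < c) :
    gaussianReal 0 1 {x | c ≤ |x|} ≤ ENNReal.ofReal (1 / c ^ 2) := by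
  have h := meas_ge_le_variance_div_sq (μ := gaussianReal 0 1) (X := id)
    IsGaussian.memLp_two_id hc
  have h1 : variance id (gaussianReal 0 1) = 1 := by simp
  rw [h1] at h
  simpa using h

/-- A small interval has small mass under a centered Gaussian measure. -/
theorem gaussianReal_abs_lt_le {v : NNReal} (hv : v ≠ 0) (τ : ℝ) :
    gaussianReal 0 v {x | |x| < τ} ≤ ENNReal.ofReal (τ / √v) := by
  have hv0 : (0 : ℝ) < v := NNReal.coe_pos.2 (pos_iff_ne_zero.2 hv)
  rw [gaussianReal_apply 0 hv]
  have hset : {x : ℝ | |x| < τ} = Set.Ioo (-τ) τ := by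
    ext x; simp [abs_lt]
  have hpdf : ∀ x, gaussianPDF 0 v x ≤ ENNReal.ofReal (1 / (2 * √v)) := by
    intro x
    unfold gaussianPDF gaussianPDFReal
    refine ENNReal.ofReal_le_ofReal ?_
    have h1 : Real.exp (-(x - 0) ^ 2 / (2 * v)) ≤ 1 := by
      rw [Real.exp_le_one_iff]
      exact div_nonpos_of_nonpos_of_nonneg (by nlinarith [sq_nonneg (x - 0)]) (by positivity)
    have h2 : 2 * √v ≤ √(2 * Real.pi * v) := by
      refine Real.le_sqrt_of_sq_le ?_
      rw [mul_pow, Real.sq_sqrt hv0.le]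
      nlinarith [Real.pi_gt_three]
    calc _ ≤ (√(2 * Real.pi * v))⁻¹ * 1 := by gcongr
      _ ≤ _ := by
        rw [mul_one, ← one_div]
        exact one_div_le_one_div_of_le (by positivity) h2
  calc ∫⁻ x in {x | |x| < τ}, gaussianPDF 0 v x
      ≤ ∫⁻ _x in {x : ℝ | |x| < τ}, ENNReal.ofReal (1 / (2 * √v)) := lintegral_mono hpdf
    _ = ENNReal.ofReal (1 / (2 * √v)) * ENNReal.ofReal (τ - -τ) := by
      rw [setLIntegral_const, hset, Real.volume_Ioo]
    _ = _ := by
      rw [← ENNReal.ofReal_mul (by positivity)]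
      congr 1
      have := Real.sqrt_pos.2 hv0
      field_simp; ring

/-- The rows of a well-conditioned matrix are separated. -/
theorem le_norm_rowCombination_sub {W : Matrix (Fin d) (Fin d) ℝ} {K : ℝ} (hW : IsUnit W.det)
    (hWK : ‖W⁻¹‖ ≤ K) {i j : Fin d} (hij : i ≠ j) :
    1 ≤ K * ‖rowCombination W (Pi.single i 1) - rowCombination W (Pi.single j 1)‖ := by
  set b : Fin d → ℝ := Pi.single i 1 - Pi.single j 1 with hb
  have h1 : rowCombination W (Pi.single i 1) - rowCombination W (Pi.single j 1) =
      WithLp.toLp 2 (W.transpose.mulVec b) := by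
    rw [rowCombination, rowCombination, ← WithLp.toLp_sub, ← Matrix.mulVec_sub]
  have h2 : W⁻¹.transpose.mulVec (W.transpose.mulVec b) = b := by
    rw [Matrix.mulVec_mulVec, ← Matrix.transpose_mul, Matrix.mul_nonsing_inv _ hW,
      Matrix.transpose_one, Matrix.one_mulVec]
  have h3 := Matrix.norm_toLp_mulVec_le W⁻¹.transpose (W.transpose.mulVec b)
  rw [h2, Matrix.l2_opNorm_transpose, ← h1] at h3
  have h4 : 1 ≤ ‖(WithLp.toLp 2 b : EuclideanSpace ℝ (Fin d))‖ := by
    have := PiLp.norm_apply_le (WithLp.toLp 2 b : EuclideanSpace ℝ (Fin d)) i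
    simpa [hb, hij] using this
  exact h4.trans (h3.trans (by gcongr))

variable {Ω : Type*} [MeasurableSpace Ω] {μ : Measure Ω} {g : Fin d → Ω → ℝ}

theorem measure_norm_gt_le (hg : ∀ j, Measurable (g j))
    (hlaw : ∀ j, μ.map (g j) = gaussianReal 0 1) {R : ℝ} (hR : 0 < R) :
    μ {ω | ¬ ‖(WithLp.toLp 2 (fun j => g j ω / R) : EuclideanSpace ℝ (Fin d))‖ ≤ 1} ≤
      ENNReal.ofReal (d ^ 3 / R ^ 2) := by
  rcases Nat.eq_zero_or_pos d with rfl | hd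
  · simp [EuclideanSpace.norm_eq]
  have hd' : (0 : ℝ) < d := by exact_mod_cast hd
  refine (measure_mono (t := ⋃ j, {ω | R / d ≤ |g j ω|}) fun ω hω => ?_).trans ?_
  · by_contra hcon
    simp only [Set.mem_iUnion, Set.mem_ofPred_eq, not_exists, not_le] at hcon hω
    refine absurd ?_ (not_le.2 hω)
    refine (EuclideanSpace.norm_toLp_le (ε := 1 / d) fun j => ?_).trans_eq (by field_simp)
    rw [abs_div, abs_of_pos hR, div_le_div_iff₀ hR hd']
    have := (lt_div_iff₀ hd').1 (hcon j)
    linarith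
  · refine (measure_iUnion_le _).trans ?_
    rw [tsum_fintype]
    have h1 : ∀ j, μ {ω | R / d ≤ |g j ω|} ≤ ENNReal.ofReal (d ^ 2 / R ^ 2) := fun j => by
      have h2 := gaussianReal_abs_ge_le (div_pos hR hd')
      have hs : MeasurableSet {x : ℝ | R / d ≤ |x|} :=
        measurableSet_le measurable_const measurable_norm
      rw [← hlaw j, Measure.map_apply (hg j) hs] at h2
      refine h2.trans (ENNReal.ofReal_le_ofReal (le_of_eq ?_))
      field_simp
    refine (Finset.sum_le_sum fun j _ => h1 j).trans (le_of_eq ?_)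
    rw [Finset.sum_const, Finset.card_univ, Fintype.card_fin, nsmul_eq_mul,
      ← ENNReal.ofReal_natCast, ← ENNReal.ofReal_mul (by positivity)]
    congr 1; ring

/-- A random direction separates the rows of a well-conditioned matrix. -/
theorem measure_gap_le [IsProbabilityMeasure μ] (hg : ∀ j, Measurable (g j)) (hind : iIndepFun g μ)
    (hlaw : ∀ j, μ.map (g j) = gaussianReal 0 1) {W : Matrix (Fin d) (Fin d) ℝ} {K : ℝ}
    (hW : IsUnit W.det) (hWK : ‖W⁻¹‖ ≤ K) {R τ : ℝ} (hR : 0 < R) (hτ : 0 ≤ τ) :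
    μ {ω | ¬ ∀ i j, i ≠ j → τ ≤ |W.mulVec (fun j => g j ω / R) i -
      W.mulVec (fun j => g j ω / R) j|} ≤ ENNReal.ofReal (d ^ 2 * (τ * R * K)) := by
  have hK : 0 ≤ K := (norm_nonneg _).trans hWK
  set X : Ω → EuclideanSpace ℝ (Fin d) := fun ω => WithLp.toLp 2 (fun j => g j ω) with hX
  have hmapX : μ.map X = stdGaussian (EuclideanSpace ℝ (Fin d)) := by
    have h1 := (iIndepFun_iff_map_fun_eq_pi_map fun j => (hg j).aemeasurable).1 hind
    simp only [hlaw] at h1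
    rw [← map_pi_eq_stdGaussian, ← h1, Measure.map_map (by fun_prop) (by fun_prop)]
    rfl
  have hXm : Measurable X := by fun_prop
  set q : Fin d → Fin d → EuclideanSpace ℝ (Fin d) := fun i j =>
    rowCombination W (Pi.single i 1) - rowCombination W (Pi.single j 1) with hq
  have hinner : ∀ i j ω, inner ℝ (q i j) (X ω) = R * (W.mulVec (fun j => g j ω / R) i -
      W.mulVec (fun j => g j ω / R) j) := by
    intro i j ω
    have h1 : (fun j => g j ω / R) = R⁻¹ • (X ω).ofLp := by
      ext k; simp [hX, div_eq_inv_mul]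
    rw [hq, inner_sub_left, inner_rowCombination_single, inner_rowCombination_single, h1,
      Matrix.mulVec_smul]
    simp only [one_mul, Pi.smul_apply, smul_eq_mul]
    field_simp
  have hpair : ∀ i j, i ≠ j → μ {ω | |inner ℝ (q i j) (X ω)| < τ * R} ≤
      ENNReal.ofReal (τ * R * K) := by
    intro i j hij
    have h1 := le_norm_rowCombination_sub hW hWK hij
    have hq0 : 0 < ‖q i j‖ := by
      by_contra! h
      have h2 : ‖q i j‖ = 0 := le_antisymm h (norm_nonneg _)
      simp only [hq] at h2
      rw [h2] at h1
      norm_num at h1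
    have hv : Real.toNNReal (‖q i j‖ ^ 2) ≠ 0 := by
      rw [Ne, Real.toNNReal_eq_zero, not_le]; positivity
    have h2 := gaussianReal_abs_lt_le hv (τ * R)
    have hme : Measurable fun x : EuclideanSpace ℝ (Fin d) => inner ℝ (q i j) x := by fun_prop
    have hs : MeasurableSet {x : ℝ | |x| < τ * R} :=
      measurableSet_lt measurable_norm measurable_const
    rw [← map_inner_stdGaussian, ← hmapX, Measure.map_map hme hXm,
      Measure.map_apply (hme.comp hXm) hs] at h2
    refine h2.trans (ENNReal.ofReal_le_ofReal ?_)
    rw [Real.coe_toNNReal _ (by positivity), Real.sqrt_sq hq0.le, div_le_iff₀ hq0, mul_assoc]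
    exact le_mul_of_one_le_right (by positivity) h1
  refine (measure_mono (t := ⋃ i, ⋃ j, {ω | i ≠ j ∧ |inner ℝ (q i j) (X ω)| < τ * R})
    fun ω hω => ?_).trans ?_
  · simp only [Set.mem_ofPred_eq, not_forall, not_le] at hω
    obtain ⟨i, j, hij, h⟩ := hω
    simp only [Set.mem_iUnion, Set.mem_ofPred_eq]
    refine ⟨i, j, hij, ?_⟩
    rw [hinner, abs_mul, abs_of_pos hR, mul_comm]
    gcongr
  · have h1 : ∀ i j, μ {ω | i ≠ j ∧ |inner ℝ (q i j) (X ω)| < τ * R} ≤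
        ENNReal.ofReal (τ * R * K) := fun i j => by
      by_cases hij : i = j
      · simp [hij]
      · exact (measure_mono fun ω hω => hω.2).trans (hpair i j hij)
    refine (measure_iUnion_le _).trans ?_
    rw [tsum_fintype]
    refine (Finset.sum_le_sum fun i _ => (measure_iUnion_le _).trans ?_).trans
      (b := ∑ _i : Fin d, ∑ _j : Fin d, ENNReal.ofReal (τ * R * K)) ?_
    · rw [tsum_fintype]
      exact Finset.sum_le_sum fun j _ => h1 i j
    · simp only [Finset.sum_const, Finset.card_univ, Fintype.card_fin, nsmul_eq_mul]
      rw [← ENNReal.ofReal_natCast, ← ENNReal.ofReal_mul (by positivity),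
        ← ENNReal.ofReal_mul (by positivity)]
      refine ENNReal.ofReal_le_ofReal (le_of_eq (by ring))

end Direction

/-! ### Independence of the two blocks of draws -/

/-- An event that depends on two independent variables is unlikely, if it is unlikely for every
admissible value of the first one. -/
theorem measure_le_of_indepFun {Ω α β : Type*} [MeasurableSpace Ω] [MeasurableSpace α]
    [MeasurableSpace β] {μ : Measure Ω} [IsProbabilityMeasure μ] {X : Ω → α} {Y : Ω → β}
    (hX : Measurable X) (hY : Measurable Y) (hXY : IndepFun X Y μ) {A : Set α}
    (hA : MeasurableSet A) {B : Set (α × β)} (hB : MeasurableSet B) {ε : ENNReal}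
    (h : ∀ x ∈ A, μ {ω | (x, Y ω) ∈ B} ≤ ε) :
    μ {ω | X ω ∈ A ∧ (X ω, Y ω) ∈ B} ≤ ε := by
  have h1 := (indepFun_iff_map_prod_eq_prod_map_map hX.aemeasurable hY.aemeasurable).1 hXY
  have hB' : MeasurableSet ((Prod.fst ⁻¹' A) ∩ B) := (measurable_fst hA).inter hB
  have h2 : μ {ω | X ω ∈ A ∧ (X ω, Y ω) ∈ B} =
      μ.map (fun ω => (X ω, Y ω)) ((Prod.fst ⁻¹' A) ∩ B) := by
    rw [Measure.map_apply (hX.prodMk hY) hB']; rfl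
  have : IsProbabilityMeasure (μ.map X) := Measure.isProbabilityMeasure_map hX.aemeasurable
  have : IsProbabilityMeasure (μ.map Y) := Measure.isProbabilityMeasure_map hY.aemeasurable
  rw [h2, h1, Measure.prod_apply hB']
  calc _ ≤ ∫⁻ _x, ε ∂μ.map X := by
        refine lintegral_mono fun x => ?_
        by_cases hx : x ∈ A
        · rw [Measure.map_apply hY (measurable_prodMk_left hB')]
          exact (measure_mono fun ω hω => hω.2).trans (h x hx)
        · have : Prod.mk x ⁻¹' (Prod.fst ⁻¹' A ∩ B) = ∅ := by
            ext y; simp [hx]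
          rw [this, measure_empty]
          exact bot_le
    _ = ε := by simp


/-! ### Accuracy of the learned Laplace transform -/

section Law

variable {d : ℕ}

theorem biasedLaw_const_mul {f : EuclideanSpace ℝ (Fin d) → ℝ} (hf : Measurable f) {s : ℝ}
    (hs : 0 < s) : biasedLaw (fun x => s * f x) = biasedLaw f := by
  have h1 : (fun x => ENNReal.ofReal (s * f x)) =
      ENNReal.ofReal s • fun x => ENNReal.ofReal (f x) := by
    ext x; simp [ENNReal.ofReal_mul hs.le]
  have hs1 : ENNReal.ofReal s ≠ 0 := by simpa using hs
  unfold biasedLaw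
  rw [h1, withDensity_smul _ (by fun_prop), smul_smul]
  congr 1
  have h2 : ∫⁻ x, (ENNReal.ofReal s • fun x => ENNReal.ofReal (f x)) x
      ∂stdGaussian (EuclideanSpace ℝ (Fin d)) = ENNReal.ofReal s *
        ∫⁻ x, ENNReal.ofReal (f x) ∂stdGaussian (EuclideanSpace ℝ (Fin d)) := by
    simp only [Pi.smul_apply, smul_eq_mul]
    exact lintegral_const_mul _ (by fun_prop)
  rw [h2, ENNReal.mul_inv (.inl hs1) (.inl ENNReal.ofReal_ne_top),
    mul_right_comm, ENNReal.inv_mul_cancel hs1 ENNReal.ofReal_ne_top, one_mul]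

theorem norm_testPoint_le {h : ℝ} (hh : 0 ≤ h) (hh2 : h ≤ 1 / 2) (σ : Fin 2)
    {v : EuclideanSpace ℝ (Fin d)} (hv : ‖v‖ ≤ 1) (a b : ℕ) :
    ‖testPoint h (σ : ℕ) v a b‖ ≤ 2 := by
  have key : ∀ a : ℕ, ‖(WithLp.toLp 2 fun j : Fin d => (if a = j then (1 : ℝ) else 0) * h :
      EuclideanSpace ℝ (Fin d))‖ ≤ h := by
    intro a
    by_cases ha : a < d
    · have : (WithLp.toLp 2 fun j : Fin d => (if a = j then (1 : ℝ) else 0) * h :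
          EuclideanSpace ℝ (Fin d)) = EuclideanSpace.single ⟨a, ha⟩ h := by
        ext j
        simp [Fin.ext_iff, eq_comm]
      rw [this, PiLp.norm_single, Real.norm_of_nonneg hh]
    · have : (WithLp.toLp 2 fun j : Fin d => (if a = j then (1 : ℝ) else 0) * h :
          EuclideanSpace ℝ (Fin d)) = 0 := by
        ext j
        have : a ≠ (j : ℕ) := fun h => ha (h ▸ j.2)
        simp [this]
      rw [this, norm_zero]; exact hh
  have hsplit : testPoint h (σ : ℕ) v a b = ((σ : ℕ) : ℝ) • v +
      WithLp.toLp 2 (fun j : Fin d => (if a = j then (1 : ℝ) else 0) * h) +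
      WithLp.toLp 2 (fun j : Fin d => (if b = j then (1 : ℝ) else 0) * h) := by
    ext j; simp [testPoint]
  have hσ : ((σ : ℕ) : ℝ) ≤ 1 := by exact_mod_cast Nat.lt_succ_iff.1 σ.2
  rw [hsplit]
  refine (norm_add₃_le).trans ?_
  rw [norm_smul, Real.norm_of_nonneg (by positivity)]
  have : ((σ : ℕ) : ℝ) * ‖v‖ ≤ 1 * 1 := by gcongr
  linarith [key a, key b]

theorem continuous_testPoint (h σ : ℝ) (a b : ℕ) :
    Continuous fun v : EuclideanSpace ℝ (Fin d) => testPoint h σ v a b := by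
  unfold testPoint
  fun_prop

theorem measurable_empirical (δ A : ℝ) (N : ℕ) {G : EuclideanSpace ℝ (Fin d) → ℝ}
    (hG : Measurable G) {α : Type*} [MeasurableSpace α] {a : α → ℝ}
    {y : α → ℕ → EuclideanSpace ℝ (Fin d)} {u : α → EuclideanSpace ℝ (Fin d)} (ha : Measurable a)
    (hy : Measurable y) (hu : Measurable u) :
    Measurable fun z => empirical δ A (a z) N (y z) (fun n => G (y z n)) (u z) := by
  have hyn : ∀ n, Measurable fun z => y z n := fun n => (measurable_pi_apply n).comp hy
  have hGy : ∀ n, Measurable fun z => G (y z n) := fun n => hG.comp (hyn n)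
  have hw : ∀ n, Measurable fun z => weight δ A (a z) (G (y z n)) := fun n =>
    (measurable_weight δ A).comp (ha.prodMk (hGy n))
  have ht : ∀ n, Measurable fun z => tilt (u z) (y z n) := fun n => by
    have hc : Continuous fun q : EuclideanSpace ℝ (Fin d) × EuclideanSpace ℝ (Fin d) =>
        tilt q.1 q.2 := by
      unfold tilt; fun_prop
    exact hc.measurable.comp (hu.prodMk (hyn n))
  unfold empirical
  exact (Finset.measurable_sum _ fun n _ => ((hw n).mul ((hGy n).sub ha)).mul (ht n)).div
    (Finset.measurable_sum _ fun n _ => hw n)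

variable {Ω : Type*} [MeasurableSpace Ω] {μ : Measure Ω}
  {Z : ℕ → Ω → EuclideanSpace ℝ (Fin d) × ℝ} {f : EuclideanSpace ℝ (Fin d) → ℝ}

/-- The reference label and the direction are functions of the draws before those of the samples, so
they are independent of the samples. -/
theorem indepFun_reference_samples (hZ : ∀ i, Measurable (Z i)) (hind : iIndepFun Z μ)
    (p : Exponents) (hf : Measurable f) (t : ℝ) (N : ℕ) :
    IndepFun (fun ω => (refLabel f t fun i => Z i ω, direction p fun i => Z i ω))
      (fun ω n => if n < N then (Z (1 + d + n) ω).1 else 0) μ := by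
  have hdisj : Disjoint (Finset.range (1 + d)) (Finset.Ico (1 + d) (1 + d + N)) := by
    rw [Finset.disjoint_left]
    intro n hn hn'
    simp only [Finset.mem_range, Finset.mem_Ico] at hn hn'
    omega
  have h := iIndepFun.indepFun_finset _ _ hdisj hind hZ
  set χ : (Finset.range (1 + d) → EuclideanSpace ℝ (Fin d) × ℝ) → ℝ × EuclideanSpace ℝ (Fin d) :=
    fun z => (Real.exp t * f (z ⟨0, by simp⟩).1, WithLp.toLp 2 fun j : Fin d =>
      (z ⟨1 + j, by simp⟩).2 / (d : ℝ) ^ p.dir)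
  set ψ : (Finset.Ico (1 + d) (1 + d + N) → EuclideanSpace ℝ (Fin d) × ℝ) →
      ℕ → EuclideanSpace ℝ (Fin d) := fun z n =>
    if hn : n < N then (z ⟨1 + d + n, by simp [hn]⟩).1 else 0
  have hχ : Measurable χ := by
    have : Measurable fun z : Finset.range (1 + d) → EuclideanSpace ℝ (Fin d) × ℝ =>
        f (z ⟨0, by simp⟩).1 := hf.comp (by fun_prop)
    fun_prop
  have hψ : Measurable ψ := by
    refine measurable_pi_lambda _ fun n => ?_
    by_cases hn : n < N
    · simp only [ψ, hn, dite_true]; fun_prop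
    · simp only [ψ, hn, dite_false]; fun_prop
  have h2 := h.comp hχ hψ
  have h3 : (ψ ∘ fun a (i : Finset.Ico (1 + d) (1 + d + N)) => Z i a) =
      fun ω n => if n < N then (Z (1 + d + n) ω).1 else 0 := by
    funext ω n
    by_cases hn : n < N <;> simp [ψ, hn]
  rw [h3] at h2
  exact h2

theorem map_fst_eq (hZ : ∀ i, Measurable (Z i)) [SFinite (biasedLaw f)]
    (hlaw : ∀ i, μ.map (Z i) = (biasedLaw f).prod (gaussianReal 0 1)) (i : ℕ) :
    μ.map (fun ω => (Z i ω).1) = biasedLaw f := by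
  have : (fun ω => (Z i ω).1) = Prod.fst ∘ Z i := rfl
  rw [this, ← Measure.map_map measurable_fst (hZ i), hlaw, Measure.map_fst_prod]
  simp

theorem map_snd_eq (hZ : ∀ i, Measurable (Z i)) [IsProbabilityMeasure (biasedLaw f)]
    (hlaw : ∀ i, μ.map (Z i) = (biasedLaw f).prod (gaussianReal 0 1)) (i : ℕ) :
    μ.map (fun ω => (Z i ω).2) = gaussianReal 0 1 := by
  have : (fun ω => (Z i ω).2) = Prod.snd ∘ Z i := rfl
  rw [this, ← Measure.map_map measurable_snd (hZ i), hlaw, Measure.map_snd_prod]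
  simp

variable {H ρ κ Ψ : EuclideanSpace ℝ (Fin d) → ℝ} {C₀ b r t : ℝ} {p : Exponents}

/-- If the reference label is admissible and the direction is short, then the learned Laplace
transform is accurate at all test points, with high probability. -/
theorem measure_learnedLaplace_le [IsProbabilityMeasure μ] (hZ : ∀ i, Measurable (Z i))
    (hind : iIndepFun Z μ)
    (hlaw : ∀ i, μ.map (Z i) = (biasedLaw f).prod (gaussianReal 0 1)) (hf : Measurable f)
    (hp : IsPerturbation (fun x => Real.exp t * f x) C₀ H ρ κ b r) (hd : 0 < d)
    (hΨ : Measurable Ψ)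
    (hHΨ : ∀ u, ∫ x, tilt u x * H x ∂stdGaussian (EuclideanSpace ℝ (Fin d)) = Ψ u)
    {β A₁ τ h : ℝ} (hβ : 0 < β) (hA₁ : 1 ≤ A₁) (hb : b ≤ A₁)
    (hA₂ : 3 * A₁ ≤ (d : ℝ) ^ p.clip) (hτ : 0 < τ)
    (hsmall : τ + rejectionError b r (1 / (d : ℝ) ^ p.low) A₁ ((d : ℝ) ^ p.clip) / A₁ ≤ 1 / 2)
    (hh : 0 ≤ h) (hh2 : h ≤ 1 / 2) :
    μ {ω | (|refLabel f t (fun i => Z i ω) - C₀| ≤ A₁ ∧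
        β * ∫ x, Real.exp t * f x ∂stdGaussian (EuclideanSpace ℝ (Fin d)) ≤
          refLabel f t (fun i => Z i ω) ∧ ‖direction p (fun i => Z i ω)‖ ≤ 1) ∧
      ∃ (σ : Fin 2) (a a' : Fin (d + 1)),
        ¬ |learnedLaplace p f t (fun i => Z i ω)
            (testPoint h (σ : ℕ) (direction p fun i => Z i ω) a a') -
          (C₀ - refLabel f t (fun i => Z i ω) +
            Ψ (testPoint h (σ : ℕ) (direction p fun i => Z i ω) a a'))| ≤
          6 * (rejectionError b r (1 / (d : ℝ) ^ p.low) A₁ ((d : ℝ) ^ p.clip) + r + A₁ * τ)} ≤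
      ENNReal.ofReal (2 * (d + 1) ^ 2 *
        (2 * (((d : ℝ) ^ p.clip) ^ 2 * Real.exp 4 / (1 / (d : ℝ) ^ p.low * β)) /
          ((d : ℝ) ^ p.samples * τ ^ 2))) := by
  set G : EuclideanSpace ℝ (Fin d) → ℝ := fun x => Real.exp t * f x with hG
  set δ : ℝ := 1 / (d : ℝ) ^ p.low with hδ
  set A₂ : ℝ := (d : ℝ) ^ p.clip with hA₂'
  set N : ℕ := d ^ p.samples with hN
  set E : ℝ := 6 * (rejectionError b r δ A₁ A₂ + r + A₁ * τ) with hE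
  have hd' : (1 : ℝ) ≤ d := by exact_mod_cast hd
  have hδ0 : 0 < δ := by positivity
  have hδ1 : δ ≤ 1 := by
    rw [hδ, div_le_one (by positivity)]; exact one_le_pow₀ hd'
  have hN0 : 0 < N := by positivity
  have hNr : ((d : ℝ) ^ p.samples) = (N : ℝ) := by push_cast [hN]; rfl
  have hlawG : biasedLaw G = biasedLaw f := biasedLaw_const_mul hf (Real.exp_pos t)
  have hprob : IsProbabilityMeasure (biasedLaw f) := by
    rw [← hlawG]
    exact isProbabilityMeasure_biasedLaw hp.nonneg hp.integrable hp.integral_pos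
  -- the two blocks of draws
  set X : Ω → ℝ × EuclideanSpace ℝ (Fin d) := fun ω =>
    (refLabel f t fun i => Z i ω, direction p fun i => Z i ω) with hX
  set Y : Ω → ℕ → EuclideanSpace ℝ (Fin d) := fun ω n =>
    if n < N then (Z (1 + d + n) ω).1 else 0 with hY
  have hXY : IndepFun X Y μ := indepFun_reference_samples hZ hind p hf t N
  have hXm : Measurable X := by
    have h1 : Measurable fun ω => f (Z 0 ω).1 := hf.comp (measurable_fst.comp (hZ 0))
    have h2 : ∀ j : Fin d, Measurable fun ω => (Z (1 + j) ω).2 := fun j =>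
      measurable_snd.comp (hZ _)
    simp only [hX, refLabel, direction]
    fun_prop
  have hYm : Measurable Y := by
    refine measurable_pi_lambda _ fun n => ?_
    by_cases hn : n < N
    · simp only [hY, hn, if_true]; exact measurable_fst.comp (hZ _)
    · simp only [hY, hn, if_false]; fun_prop
  have hemp : ∀ ω u, learnedLaplace p f t (fun i => Z i ω) u =
      empirical δ A₂ (X ω).1 N (Y ω) (fun n => G (Y ω n)) u := by
    intro ω u
    unfold learnedLaplace empirical
    congr 1
    · refine Finset.sum_congr rfl fun n hn => ?_
      simp only [hY, Finset.mem_range.1 hn, if_true, hG, hX]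
      rfl
    · refine Finset.sum_congr rfl fun n hn => ?_
      simp only [hY, Finset.mem_range.1 hn, if_true, hG, hX]
      rfl
  set A : Set (ℝ × EuclideanSpace ℝ (Fin d)) := {x | |x.1 - C₀| ≤ A₁ ∧
    β * ∫ x, G x ∂stdGaussian (EuclideanSpace ℝ (Fin d)) ≤ x.1 ∧ ‖x.2‖ ≤ 1} with hA
  set F : Fin 2 → Fin (d + 1) → Fin (d + 1) →
      (ℝ × EuclideanSpace ℝ (Fin d)) × (ℕ → EuclideanSpace ℝ (Fin d)) → ℝ := fun σ a a' z =>
    |empirical δ A₂ z.1.1 N z.2 (fun n => G (z.2 n)) (testPoint h (σ : ℕ) z.1.2 a a') -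
      (C₀ - z.1.1 + Ψ (testPoint h (σ : ℕ) z.1.2 a a'))| with hF
  have hFm : ∀ σ a a', Measurable (F σ a a') := by
    intro σ a a'
    have ht : Measurable fun z : (ℝ × EuclideanSpace ℝ (Fin d)) × (ℕ → EuclideanSpace ℝ (Fin d)) =>
        testPoint h (σ : ℕ) z.1.2 a a' :=
      (continuous_testPoint h (σ : ℕ) a a').measurable.comp (measurable_snd.comp measurable_fst)
    have h1 := measurable_empirical δ A₂ N hp.measurable
      (measurable_fst.comp measurable_fst) measurable_snd ht
    have h2 : Measurable fun z : (ℝ × EuclideanSpace ℝ (Fin d)) ×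
        (ℕ → EuclideanSpace ℝ (Fin d)) => C₀ - z.1.1 + Ψ (testPoint h (σ : ℕ) z.1.2 a a') :=
      (measurable_const.sub (measurable_fst.comp measurable_fst)).add (hΨ.comp ht)
    exact (h1.sub h2).norm
  set B : Set ((ℝ × EuclideanSpace ℝ (Fin d)) × (ℕ → EuclideanSpace ℝ (Fin d))) :=
    ⋃ q : Fin 2 × Fin (d + 1) × Fin (d + 1), {z | ¬ F q.1 q.2.1 q.2.2 z ≤ E} with hB
  have hAm : MeasurableSet A := by
    refine (measurableSet_le (measurable_fst.sub_const C₀).norm measurable_const).inter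
      ((measurableSet_le measurable_const measurable_fst).inter
        (measurableSet_le measurable_snd.norm measurable_const))
  have hBm : MeasurableSet B := MeasurableSet.iUnion fun q =>
    (measurableSet_le (hFm _ _ _) measurable_const).compl
  refine (measure_mono (t := {ω | X ω ∈ A ∧ (X ω, Y ω) ∈ B}) fun ω hω => ?_).trans
    (measure_le_of_indepFun hXm hYm hXY hAm hBm fun x hx => ?_)
  · obtain ⟨h1, σ, a, a', h2⟩ := hω
    refine ⟨h1, ?_⟩
    simp only [hB, Set.mem_iUnion]
    refine ⟨(σ, a, a'), ?_⟩
    rw [hemp] at h2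
    exact h2
  -- for a fixed admissible value of the first block
  have hY' : ∀ n, Measurable fun ω => (Z (1 + d + n) ω).1 := fun n => measurable_fst.comp (hZ _)
  have hYind : iIndepFun (fun n ω => (Z (1 + d + n) ω).1) μ :=
    (hind.precomp (add_right_injective (1 + d))).comp (fun _ => Prod.fst) fun _ => measurable_fst
  have hYlaw : ∀ n, μ.map (fun ω => (Z (1 + d + n) ω).1) = biasedLaw G := fun n => by
    rw [hlawG]; exact map_fst_eq hZ hlaw _
  have hone : ∀ q : Fin 2 × Fin (d + 1) × Fin (d + 1),
      μ {ω | ¬ F q.1 q.2.1 q.2.2 (x, Y ω) ≤ E} ≤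
        ENNReal.ofReal (2 * (A₂ ^ 2 * Real.exp 4 / (δ * β)) / (N * τ ^ 2)) := by
    intro q
    have hu := norm_testPoint_le hh hh2 q.1 hx.2.2 (q.2.1 : ℕ) (q.2.2 : ℕ)
    have h1 := hp.measure_empirical_le hY' hYind hYlaw hδ0 hδ1 hβ hA₁ hb hA₂ hx.1 hx.2.1 hτ hsmall
      hN0 hu
    rw [hHΨ] at h1
    refine (measure_mono fun ω hω => ?_).trans h1
    have h2 : empirical δ A₂ x.1 N (Y ω) (fun n => G (Y ω n))
        (testPoint h (q.1 : ℕ) x.2 q.2.1 q.2.2) =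
        empirical δ A₂ x.1 N (fun n => (Z (1 + d + n) ω).1) (fun n => G (Z (1 + d + n) ω).1)
          (testPoint h (q.1 : ℕ) x.2 q.2.1 q.2.2) := by
      unfold empirical
      congr 1 <;>
      · refine Finset.sum_congr rfl fun n hn => ?_
        simp only [hY, Finset.mem_range.1 hn, if_true]
    simp only [hF, Set.mem_ofPred_eq, h2] at hω ⊢
    exact hω
  have hset : {ω | (x, Y ω) ∈ B} = ⋃ q : Fin 2 × Fin (d + 1) × Fin (d + 1),
      {ω | ¬ F q.1 q.2.1 q.2.2 (x, Y ω) ≤ E} := by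
    ext ω; simp [hB]
  rw [hset]
  refine (measure_iUnion_le _).trans ?_
  rw [tsum_fintype]
  refine (Finset.sum_le_sum fun q _ => hone q).trans (le_of_eq ?_)
  rw [Finset.sum_const, Finset.card_univ, nsmul_eq_mul, ← ENNReal.ofReal_natCast,
    ← ENNReal.ofReal_mul (by positivity), hNr]
  congr 1
  simp only [Fintype.card_prod, Fintype.card_fin]
  push_cast
  ring

end Law


/-! ### The choice of the parameters -/

section Parameters

open scoped Matrix.Norms.L2Operator

/-- The exponent of the accuracy that the recovery requires of the moments. -/
def momentExponent (k : ℕ) : ℕ := 2 * (2 * k + 7) + k + 40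

/-- The exponent of the accuracy that is required of the Laplace transform. -/
def laplaceExponent (k : ℕ) : ℕ := 3 * momentExponent k + 9

/-- The exponent of the bound for the distance of an admissible reference label to the constant
term. -/
def referenceExponent (k : ℕ) : ℕ := laplaceExponent k + 9

/-- The exponent of the threshold below which labels are rejected. -/
def lowExponent (k : ℕ) : ℕ := 2 * referenceExponent k + laplaceExponent k + 10

/-- The parameters of the algorithm, as powers of `L = d ^ q`, for the accuracy and the failure
probability `1 / L ^ k`. The direction is shorter than one, except with probability
`1 / L ^ (2 * k + 3)`; with high probability it separates the rows by `1 / L ^ (2 * k + 7)`, which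
fixes the resolution of the scan and of the filter. The remaining exponents are such that every
error is absorbed by the next one. -/
def chosenExponents (q k : ℕ) : Exponents where
  dir := q * (k + 3)
  step := q * (momentExponent k + 4)
  clip := q * (referenceExponent k + 1)
  low := q * lowExponent k
  samples := q * (4 * referenceExponent k + lowExponent k + 2 * k + 2 * laplaceExponent k + 15)
  relax := q * 12
  rounds := q * 19
  mesh := q * (2 * (2 * k + 7) + 6)
  skip := q * (2 * k + 7 + 1)
  power := q * (2 * (2 * k + 7) + 6)

/-- The exponent of the bound for `e^{-t}`: the remainder has to be small in comparison with the
accuracy, even after the division by the smallest label that is not rejected. -/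
def thresholdExponent (k : ℕ) : ℕ := lowExponent k + laplaceExponent k + 8

theorem rejectionError_le {L t : ℝ} (hL : 128 ≤ L) {k : ℕ}
    (ht : L ^ thresholdExponent k * Real.exp (-t) ≤ 1) :
    rejectionError (L ^ 6) (L ^ 5 * Real.exp (-t)) (1 / L ^ lowExponent k)
      (L ^ referenceExponent k) (L ^ (referenceExponent k + 1)) ≤
        11 / L ^ (laplaceExponent k + 2) ∧
    L ^ 5 * Real.exp (-t) ≤ 1 / L ^ (lowExponent k + laplaceExponent k + 3) := by
  have hL0 : 0 < L := by linarith
  have hL1 : 1 ≤ L := by linarith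
  set F := laplaceExponent k with hF
  set y := lowExponent k with hy
  set x := referenceExponent k with hx
  set r := L ^ 5 * Real.exp (-t) with hr
  have hr1 : r ≤ 1 / L ^ (y + F + 3) := by
    rw [le_div_iff₀ (by positivity)]
    calc r * L ^ (y + F + 3) = L ^ (y + F + 8) * Real.exp (-t) := by rw [hr]; ring
      _ ≤ 1 := ht
  have hinv : ∀ a b : ℕ, a ≤ b → 1 / L ^ b ≤ 1 / L ^ a := fun a b h =>
    one_div_le_one_div_of_le (by positivity) (pow_le_pow_right₀ hL1 h)
  refine ⟨?_, hr1⟩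
  unfold rejectionError
  have h1 : 4 * r ≤ 4 * (1 / L ^ (F + 2)) := by
    gcongr
    exact hr1.trans (hinv _ _ (by omega))
  have h2 : 4 / L ^ x * L ^ 6 ≤ 4 * (1 / L ^ (F + 2)) := by
    have : 4 / L ^ x * L ^ 6 = 4 * (1 / L ^ (F + 3)) := by
      rw [hx, referenceExponent, ← hF, show F + 9 = F + 3 + 6 by ring, pow_add L (F + 3)]
      field_simp
    rw [this]
    gcongr 4 * ?_
    exact hinv _ _ (by omega)
  have h3 : L ^ (x + 1) / (1 / L ^ y * L ^ x) * r ≤ 1 / L ^ (F + 2) := by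
    calc L ^ (x + 1) / (1 / L ^ y * L ^ x) * r = L ^ (y + 1) * r := by
          rw [pow_succ, pow_succ]; field_simp
      _ ≤ L ^ (y + 1) * (1 / L ^ (y + F + 3)) := by gcongr
      _ = 1 / L ^ (F + 2) := by
          rw [show y + F + 3 = (y + 1) + (F + 2) by ring, pow_mul_one_div_pow hL0]
  have h4 : L ^ (x + 1) * (2 * (1 / L ^ y) * L ^ x) * L ^ 6 ≤ 2 * (1 / L ^ (F + 2)) := by
    have : L ^ (x + 1) * (2 * (1 / L ^ y) * L ^ x) * L ^ 6 = 2 * (1 / L ^ (F + 3)) := by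
      rw [hy, lowExponent, ← hx, ← hF, show 2 * x + F + 10 = (x + 1 + x + 6) + (F + 3) by ring,
        pow_add L (x + 1 + x + 6), pow_add L (x + 1 + x), pow_add L (x + 1)]
      field_simp
    rw [this]
    gcongr 2 * ?_
    exact hinv _ _ (by omega)
  have h5 : 11 / L ^ (F + 2) = 11 * (1 / L ^ (F + 2)) := by ring
  rw [h5]
  linarith

variable {d : ℕ} {Ω : Type*} [MeasurableSpace Ω] {μ : Measure Ω} [IsProbabilityMeasure μ]
  {Z : ℕ → Ω → EuclideanSpace ℝ (Fin d) × ℝ}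

/-- With the chosen parameters, the outputs of the algorithm are accurate with high probability. -/
theorem measure_learnedVectors_le {t K L : ℝ} {W : Matrix (Fin d) (Fin d) ℝ}
    {c : Finset (Fin d) → ℝ} {q k : ℕ} (hd : 0 < d) (hLq : L = (d : ℝ) ^ q) (hL : 128 ≤ L)
    (hdL : d ≤ L) (hkL : (momentExponent k : ℝ) ≤ L) (hK : 1 ≤ K)
    (hKL : Real.exp (4 * K + K ^ 2) ≤ L)
    (hrow : ∀ i, ‖(WithLp.toLp 2 (W i) : EuclideanSpace ℝ (Fin d))‖ = 1) (hW : IsUnit W.det)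
    (hWK : ‖W‖ ≤ K) (hWK' : ‖W⁻¹‖ ≤ K) (hc : ∀ i, 1 / L ≤ c {i} ∧ c {i} ≤ L)
    (hcS : ∀ S : Finset (Fin d), 1 < S.card → |c S| ≤ L) (hf : ∀ x, 0 ≤ network t W c x)
    (ht : L ^ thresholdExponent k * Real.exp (-t) ≤ 1)
    (hZ : ∀ i, Measurable (Z i)) (hind : iIndepFun Z μ)
    (hlaw : ∀ i, μ.map (Z i) = (biasedLaw (network t W c)).prod (gaussianReal 0 1)) :
    μ {ω | ¬ RecoversColumns (fun i => WithLp.toLp 2 (learnedVectors (chosenExponents q k)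
        (network t W c) t (fun i => Z i ω) i)) (targetMatrix W c) (1 / L ^ k)} ≤
      ENNReal.ofReal (1 / L ^ k) := by
  have hL0 : 0 < L := by linarith
  have hL1 : 1 ≤ L := by linarith
  have hinv : ∀ a b : ℕ, a ≤ b → 1 / L ^ b ≤ 1 / L ^ a := fun a b h =>
    one_div_le_one_div_of_le (by positivity) (pow_le_pow_right₀ hL1 h)
  have hL2 : L ≤ L ^ 2 := le_self_pow₀ hL1 two_ne_zero
  have hKL' : K ≤ L := by
    refine le_trans ?_ hKL
    have := Real.add_one_le_exp (4 * K + K ^ 2)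
    nlinarith
  obtain ⟨hrej, hr⟩ := rejectionError_le hL ht
  set p := chosenExponents q k with hp
  set f := network t W c with hf'
  have hpow : ∀ m, (d : ℝ) ^ (q * m) = L ^ m := fun m => by rw [pow_mul, ← hLq]
  have hdir : (d : ℝ) ^ p.dir = L ^ (k + 3) := hpow _
  have hclip : (d : ℝ) ^ p.clip = L ^ (referenceExponent k + 1) := hpow _
  have hlow : (d : ℝ) ^ p.low = L ^ lowExponent k := hpow _
  have hsam : (d : ℝ) ^ p.samples = L ^ (4 * referenceExponent k + lowExponent k + 2 * k +
    2 * laplaceExponent k + 15) := hpow _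
  have hstep : (d : ℝ) ^ p.step = L ^ (momentExponent k + 4) := hpow _
  set F := laplaceExponent k with hF
  set y := lowExponent k with hy
  set x := referenceExponent k with hx
  have hxF : x = F + 9 := rfl
  have hyx : y = 2 * x + F + 10 := rfl
  have hFk : k + 30 ≤ F := by simp only [hF, laplaceExponent, momentExponent]; omega
  set r := L ^ 5 * Real.exp (-t) with hrdef
  have hr0 : 0 ≤ r := by positivity
  have ht7 : L ^ 7 * Real.exp (-t) ≤ 1 := by
    refine le_trans ?_ ht
    gcongr
    unfold thresholdExponent; omega
  have hpert := network_isPerturbation ⟨0, hd⟩ hL hdL hK hKL hrow hW hWK hc hcS hf ht7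
  have hfm : Measurable f := (continuous_network t W c).measurable
  have hprob : IsProbabilityMeasure (biasedLaw f) := by
    rw [← biasedLaw_const_mul hfm (Real.exp_pos t)]
    exact isProbabilityMeasure_biasedLaw hpert.nonneg hpert.integrable hpert.integral_pos
  set C₀ := Real.exp t * c ∅ with hC₀
  set S := ∫ x, Real.exp t * f x ∂stdGaussian (EuclideanSpace ℝ (Fin d)) with hS
  set Ψ : EuclideanSpace ℝ (Fin d) → ℝ := fun u =>
    Real.exp (1 / 2) * rowLaplace W (fun i => c {i}) u
  have hΨ : Measurable Ψ := by
    refine Continuous.measurable ?_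
    simp only [Ψ]
    unfold rowLaplace Matrix.mulVec dotProduct
    fun_prop
  set A₁ := L ^ x with hA₁
  set β := 1 / L ^ (k + 2) with hβ
  set τ := 1 / L ^ (x + F + 2) with hτ
  set h := 1 / (d : ℝ) ^ p.step with hh
  have hA₁1 : 1 ≤ A₁ := one_le_pow₀ hL1
  have hτ0 : 0 < τ := by positivity
  have hβ0 : 0 < β := by positivity
  have hA₁τ : A₁ * τ = 1 / L ^ (F + 2) := by
    rw [hA₁, hτ, show x + F + 2 = x + (F + 2) by ring, pow_mul_one_div_pow hL0]
  have hsmall1 : ∀ m, 1 / L ^ (m + 1) ≤ 1 / 128 := fun m =>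
    one_div_le_one_div_of_le (by norm_num) (hL.trans (le_self_pow₀ hL1 (by omega)))
  -- the reference label
  have hU₁ : μ {ω | ¬ (|refLabel f t (fun i => Z i ω) - C₀| ≤ A₁ ∧
      β * S ≤ refLabel f t (fun i => Z i ω))} ≤ ENNReal.ofReal (1 / L ^ (k + 1)) := by
    have h1 := hpert.biasedLaw_reference_le hβ0.le hA₁1
    rw [biasedLaw_const_mul hfm (Real.exp_pos t)] at h1
    have hG := hpert.measurable
    have hms : MeasurableSet {x | ¬ (|Real.exp t * f x - C₀| ≤ A₁ ∧ β * S ≤ Real.exp t * f x)} :=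
      ((measurableSet_le (hG.sub_const C₀).norm measurable_const).inter
        (measurableSet_le measurable_const hG)).compl
    have h2 : μ {ω | ¬ (|refLabel f t (fun i => Z i ω) - C₀| ≤ A₁ ∧
        β * S ≤ refLabel f t (fun i => Z i ω))} =
        biasedLaw f {x | ¬ (|Real.exp t * f x - C₀| ≤ A₁ ∧ β * S ≤ Real.exp t * f x)} := by
      have hm0 : Measurable fun ω => (Z 0 ω).1 := measurable_fst.comp (hZ 0)
      rw [← map_fst_eq hZ hlaw 0, Measure.map_apply hm0 hms]
      rfl
    rw [h2, ← ENNReal.ofReal_toReal (measure_ne_top _ _)]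
    refine ENNReal.ofReal_le_ofReal (h1.trans ?_)
    have h3 : L ^ 6 * r ≤ 1 / L ^ (k + 2) := by
      calc L ^ 6 * r ≤ L ^ 6 * (1 / L ^ (y + F + 3)) := by gcongr
        _ = 1 / L ^ (y + F - 3) := by
          rw [show y + F + 3 = 6 + (y + F - 3) by omega, pow_mul_one_div_pow hL0]
        _ ≤ _ := hinv _ _ (by omega)
    have h4 : L ^ 6 * (4 / A₁ * L ^ 6) ≤ 4 * (1 / L ^ (k + 2)) := by
      have : L ^ 6 * (4 / A₁ * L ^ 6) = 4 * (L ^ 12 * (1 / L ^ (12 + (x - 12)))) := by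
        rw [show 12 + (x - 12) = x by omega, hA₁]; ring
      rw [this, pow_mul_one_div_pow hL0]
      gcongr 4 * ?_
      exact hinv _ _ (by omega)
    calc 2 * L ^ 6 * (2 * r + 4 / A₁ * L ^ 6) + β
        = 4 * (L ^ 6 * r) + 2 * (L ^ 6 * (4 / A₁ * L ^ 6)) + 1 / L ^ (k + 2) := by rw [hβ]; ring
      _ ≤ 13 * (1 / L ^ (k + 2)) := by linarith
      _ ≤ L * (1 / L ^ (k + 2)) := by gcongr; linarith
      _ = 1 / L ^ (k + 1) := by
        have := pow_mul_one_div_pow hL0 1 (k + 1)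
        rw [pow_one, show 1 + (k + 1) = k + 2 by ring] at this
        exact this
  -- the direction
  have hgm : ∀ j : Fin d, Measurable fun ω => (Z (1 + j) ω).2 := fun j => measurable_snd.comp (hZ _)
  have hgl : ∀ j : Fin d, μ.map (fun ω => (Z (1 + j) ω).2) = gaussianReal 0 1 := fun j =>
    map_snd_eq hZ hlaw _
  have hgi : iIndepFun (fun (j : Fin d) ω => (Z (1 + j) ω).2) μ :=
    (hind.precomp (g := fun j : Fin d => 1 + (j : ℕ)) fun i j hij =>
      Fin.ext (add_right_injective 1 hij)).comp (fun _ => Prod.snd) fun _ => measurable_snd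
  have hU₂ : μ {ω | ¬ ‖direction p (fun i => Z i ω)‖ ≤ 1} ≤ ENNReal.ofReal (1 / L ^ (k + 1)) := by
    have h1 := measure_norm_gt_le hgm hgl (R := (d : ℝ) ^ p.dir) (by positivity)
    refine h1.trans (ENNReal.ofReal_le_ofReal ?_)
    rw [hdir]
    calc (d : ℝ) ^ 3 / (L ^ (k + 3)) ^ 2 ≤ L ^ 3 / (L ^ (k + 3)) ^ 2 := by gcongr
      _ = L ^ 3 * (1 / L ^ (3 + (2 * k + 3))) := by
        rw [← pow_mul, show (k + 3) * 2 = 3 + (2 * k + 3) by ring]; ring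
      _ = 1 / L ^ (2 * k + 3) := pow_mul_one_div_pow hL0 _ _
      _ ≤ _ := hinv _ _ (by omega)
  have hU₃ : μ {ω | ¬ ∀ i j, i ≠ j → 1 / L ^ (2 * k + 7) ≤
      |W.mulVec (direction p fun i => Z i ω).ofLp i -
        W.mulVec (direction p fun i => Z i ω).ofLp j|} ≤
        ENNReal.ofReal (1 / L ^ (k + 1)) := by
    have h1 := measure_gap_le hgm hgi hgl hW hWK' (R := (d : ℝ) ^ p.dir) (τ := 1 / L ^ (2 * k + 7))
      (by positivity) (by positivity)
    refine h1.trans (ENNReal.ofReal_le_ofReal ?_)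
    rw [hdir]
    calc (d : ℝ) ^ 2 * (1 / L ^ (2 * k + 7) * L ^ (k + 3) * K)
        ≤ L ^ 2 * (1 / L ^ (2 * k + 7) * L ^ (k + 3) * L) := by gcongr
      _ = L ^ (k + 6) * (1 / L ^ ((k + 6) + (k + 1))) := by
        rw [show (k + 6) + (k + 1) = 2 * k + 7 by ring]; ring
      _ = _ := pow_mul_one_div_pow hL0 _ _
  -- the Laplace transform
  have hsmall : τ + rejectionError (L ^ 6) r (1 / (d : ℝ) ^ p.low) A₁ ((d : ℝ) ^ p.clip) / A₁ ≤
      1 / 2 := by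
    rw [hlow, hclip]
    have h1 := hsmall1 (x + F + 1)
    have h2 := hsmall1 (F + 1)
    have h3 : rejectionError (L ^ 6) r (1 / L ^ y) A₁ (L ^ (x + 1)) / A₁ ≤ 11 / L ^ (F + 2) := by
      refine div_le_of_le_mul₀ (by linarith) (by positivity) (hrej.trans ?_)
      exact le_mul_of_one_le_right (by positivity) hA₁1
    have h4 : 11 / L ^ (F + 2) = 11 * (1 / L ^ (F + 2)) := by ring
    rw [h4] at h3
    simp only [hτ]
    linarith
  have hU₄ := measure_learnedLaplace_le (p := p) hZ hind hlaw hfm hpert hd hΨ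
    (fun u => integral_tilt_mul_rowLaplace hrow (fun i => c {i}) u) hβ0 hA₁1
    (pow_le_pow_right₀ hL1 (by omega)) (by
      rw [hclip, pow_succ, mul_comm]
      gcongr
      linarith) hτ0 hsmall (h := h) (by positivity) (by
      rw [hh, hstep]
      refine (hsmall1 _).trans (by norm_num))
  have hE : 6 * (rejectionError (L ^ 6) r (1 / (d : ℝ) ^ p.low) A₁ ((d : ℝ) ^ p.clip) + r +
      A₁ * τ) ≤ 1 / L ^ F := by
    rw [hlow, hclip, hA₁τ]
    have h1 : r ≤ 1 / L ^ (F + 2) := hr.trans (hinv _ _ (by omega))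
    calc _ ≤ 6 * (11 / L ^ (F + 2) + 1 / L ^ (F + 2) + 1 / L ^ (F + 2)) := by gcongr
      _ = 78 * (1 / L ^ (F + 2)) := by ring
      _ ≤ L ^ 2 * (1 / L ^ (2 + F)) := by
        rw [add_comm 2 F]
        exact mul_le_mul_of_nonneg_right (by linarith) (by positivity)
      _ = _ := pow_mul_one_div_pow hL0 _ _
  have hV : 2 * ((d : ℝ) + 1) ^ 2 * (2 * (((d : ℝ) ^ p.clip) ^ 2 * Real.exp 4 /
      (1 / (d : ℝ) ^ p.low * β)) / ((d : ℝ) ^ p.samples * τ ^ 2)) ≤ 1 / L ^ (k + 1) := by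
    have hd' : (1 : ℝ) ≤ d := by exact_mod_cast hd
    have he4 : Real.exp 4 ≤ L ^ 2 := (Real.exp_le_exp.2 (by norm_num)).trans (exp_six_le hL)
    rw [hlow, hclip, hsam]
    set n := 4 * x + y + 2 * k + 2 * F + 15 with hn
    calc 2 * ((d : ℝ) + 1) ^ 2 * (2 * ((L ^ (x + 1)) ^ 2 * Real.exp 4 /
          (1 / L ^ y * β)) / (L ^ n * τ ^ 2))
        ≤ 2 * (L + L) ^ 2 * (2 * ((L ^ (x + 1)) ^ 2 * L ^ 2 /
          (1 / L ^ y * β)) / (L ^ n * τ ^ 2)) := by gcongr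
      _ = 16 * (L ^ (4 * x + y + k + 2 * F + 12) *
          (1 / L ^ ((4 * x + y + k + 2 * F + 12) + (k + 3)))) := by
        rw [show (4 * x + y + k + 2 * F + 12) + (k + 3) = n by omega, hβ, hτ,
          show 4 * x + y + k + 2 * F + 12 =
            (x + 1) + (x + 1) + y + (k + 2) + (x + F + 2) + (x + F + 2) + 4 by omega]
        simp only [pow_add]
        field_simp
        ring
      _ = 16 * (1 / L ^ (k + 3)) := by rw [pow_mul_one_div_pow hL0]
      _ ≤ L ^ 2 * (1 / L ^ (2 + (k + 1))) := by
        rw [show 2 + (k + 1) = k + 3 by ring]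
        exact mul_le_mul_of_nonneg_right (by linarith) (by positivity)
      _ = _ := pow_mul_one_div_pow hL0 _ _
  replace hU₄ := hU₄.trans (ENNReal.ofReal_le_ofReal hV)
  -- the union of the exceptional events
  refine (measure_mono (t := ({ω | ¬ (|refLabel f t (fun i => Z i ω) - C₀| ≤ A₁ ∧
      β * S ≤ refLabel f t (fun i => Z i ω))} ∪ {ω | ¬ ‖direction p (fun i => Z i ω)‖ ≤ 1}) ∪
      ({ω | ¬ ∀ i j, i ≠ j → 1 / L ^ (2 * k + 7) ≤
        |W.mulVec (direction p fun i => Z i ω).ofLp i -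
          W.mulVec (direction p fun i => Z i ω).ofLp j|} ∪ _)) fun ω hω => ?_).trans
    ((measure_union_le _ _).trans ((add_le_add ((measure_union_le _ _).trans (add_le_add hU₁ hU₂))
      ((measure_union_le _ _).trans (add_le_add hU₃ hU₄))).trans ?_))
  · by_contra hcon
    simp only [Set.mem_union, Set.mem_ofPred_eq, not_or, not_not] at hcon
    obtain ⟨⟨href, hnorm⟩, hgap, hlap⟩ := hcon
    have hlap' := fun v a a' => not_lt.1 fun hlt =>
      hlap ⟨⟨href.1, href.2, hnorm⟩, v, a, a', not_le.2 hlt⟩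
    refine hω (recoversColumns_of_laplace (s := 2 * k + 7) (e := momentExponent k)
      (b := C₀ - refLabel f t (fun i => Z i ω)) hL hdL rfl hkL (hpow _) (hpow _) (hpow _) (hpow _)
      (hpow _) hstep hrow hW (hWK.trans hKL') (hWK'.trans hKL') hc hnorm hgap ?_)
    intro v hv a a' ha ha'
    rcases hv with rfl | rfl
    · have h1 := hlap' 0 ⟨a, by omega⟩ ⟨a', by omega⟩
      simp only [Fin.val_zero, Nat.cast_zero] at h1
      rw [RealRAM.testPoint_zero] at h1
      exact h1.trans hE
    · have h1 := hlap' 1 ⟨a, by omega⟩ ⟨a', by omega⟩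
      simp only [Fin.val_one, Nat.cast_one] at h1
      exact h1.trans hE
  · rw [← ENNReal.ofReal_add (by positivity) (by positivity),
      ← ENNReal.ofReal_add (by positivity) (by positivity)]
    refine ENNReal.ofReal_le_ofReal ?_
    calc _ = 4 * (1 / L ^ (1 + k)) := by rw [add_comm 1 k]; ring
      _ ≤ L ^ 1 * (1 / L ^ (1 + k)) := by rw [pow_one]; gcongr; linarith
      _ = _ := pow_mul_one_div_pow hL0 _ _

end Parameters

end

/-- The program is `RealRAM.learner`, with a power `L = d ^ q` of the dimension that dominates all
constants of the problem. -/
theorem mainTheorem10 (cmin cmax K : ℝ) (hcmin : 0 < cmin) (k : ℕ) :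
    ∃ C : ℝ, 0 < C ∧ ∃ (prog : RealRAM.Program) (A B : ℕ),
      ∀ d : ℕ, 2 ≤ d → ∀ t : ℝ, C * Real.log d ≤ t →
      ∀ (W : Matrix (Fin d) (Fin d) ℝ) (c : Finset (Fin d) → ℝ),
        (∀ i, ‖(WithLp.toLp 2 (W i) : EuclideanSpace ℝ (Fin d))‖ = 1) →
        IsUnit W.det → condNumber W ≤ K →
        (∀ i, cmin ≤ c {i} ∧ c {i} ≤ cmax) →
        (∀ S : Finset (Fin d), 1 < S.card → |c S| ≤ cmax) →
        (∀ x, 0 ≤ network t W c x) →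
        (∀ ω : ℕ → EuclideanSpace ℝ (Fin d) × ℝ, ∃ (n : ℕ) (s : RealRAM.State),
          n ≤ A * d ^ B ∧ RealRAM.Exec (network t W c) ω prog (RealRAM.init d t) n s) ∧
        ∀ (Ω : Type) [MeasurableSpace Ω] (μ : Measure Ω) [IsProbabilityMeasure μ]
          (Z : ℕ → Ω → EuclideanSpace ℝ (Fin d) × ℝ),
          (∀ i, Measurable (Z i)) → iIndepFun Z μ →
          (∀ i, μ.map (Z i) = (biasedLaw (network t W c)).prod (gaussianReal 0 1)) →
          μ {a | ¬ ∃ (n : ℕ) (s : RealRAM.State),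
              RealRAM.Exec (network t W c) (fun i => Z i a) prog (RealRAM.init d t) n s ∧
              RecoversColumns (s.output d) (targetMatrix W c) (1 / (d : ℝ) ^ k)}
            ≤ ENNReal.ofReal (1 / (d : ℝ) ^ k) := by
  -- `L = d ^ q ≥ 2 ^ q` dominates the number `M`, for all `d ≥ 2`
  set M : ℝ := 128 + |cmax| + 1 / cmin + Real.exp (4 * K + K ^ 2) + momentExponent k with hM
  have hMpos : 0 < 1 / cmin := by positivity
  obtain ⟨q, hq⟩ := pow_unbounded_of_one_lt M (one_lt_two (α := ℝ))
  have hq0 : q ≠ 0 := by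
    rintro rfl
    have := abs_nonneg cmax
    have := Real.exp_pos (4 * K + K ^ 2)
    have : (0 : ℝ) ≤ momentExponent k := Nat.cast_nonneg _
    norm_num at hq
    linarith
  obtain ⟨A, B, hAB⟩ := RealRAM.learner_poly (chosenExponents q k)
  have hT : 0 < thresholdExponent k := by unfold thresholdExponent; omega
  refine ⟨(q * thresholdExponent k : ℕ), by exact_mod_cast Nat.mul_pos (by omega) hT,
    RealRAM.learner (chosenExponents q k), A, B, ?_⟩
  intro d hd t ht W c hrow hW hWK hc hcS hf
  have hd2 : (2 : ℝ) ≤ d := by exact_mod_cast hd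
  have hd1 : (1 : ℝ) ≤ d := by linarith
  obtain ⟨hK, hWn, hWn'⟩ := norm_le_of_condNumber_le (by omega) hrow hW hWK
  refine ⟨fun ω => ?_, fun Ω _ μ _ Z hZ hind hlaw => ?_⟩
  · obtain ⟨n, s, hn, hs, -⟩ := hAB d (by omega) (network t W c) t ω
    exact ⟨n, s, hn, hs⟩
  set L : ℝ := (d : ℝ) ^ q with hL
  have hML : M ≤ L := hq.le.trans (pow_le_pow_left₀ (by norm_num) hd2 q)
  have h1 := abs_nonneg cmax
  have h2 := Real.exp_pos (4 * K + K ^ 2)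
  have h3 : (0 : ℝ) ≤ momentExponent k := Nat.cast_nonneg _
  have hdL : (d : ℝ) ≤ L := le_self_pow₀ hd1 hq0
  have hcmaxL : cmax ≤ L := (le_abs_self _).trans (by linarith)
  have hcminL : 1 / L ≤ cmin := by
    rw [one_div_le (by linarith) hcmin]
    linarith
  have hexp : L ^ thresholdExponent k * Real.exp (-t) ≤ 1 := by
    rw [hL, ← pow_mul, Real.exp_neg, ← div_eq_mul_inv, div_le_one (Real.exp_pos t),
      ← Real.log_le_iff_le_exp (by positivity), Real.log_pow]
    exact ht
  have hLk : 1 / L ^ k ≤ 1 / (d : ℝ) ^ k :=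
    one_div_le_one_div_of_le (by positivity) (pow_le_pow_left₀ (by linarith) hdL k)
  refine (measure_mono fun a ha => ?_).trans ((measure_learnedVectors_le (q := q) (k := k) (t := t)
    (by omega) hL (by linarith) hdL (by linarith) hK (by linarith) hrow hW hWn hWn'
    (fun i => ⟨hcminL.trans (hc i).1, (hc i).2.trans hcmaxL⟩)
    (fun S hS => (hcS S hS).trans hcmaxL) hf hexp hZ hind hlaw).trans
    (ENNReal.ofReal_le_ofReal hLk))
  rintro ⟨π, hπ⟩
  obtain ⟨n, s, -, hs, hout⟩ := hAB d (by omega) (network t W c) t (fun i => Z i a)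
  refine ha ⟨n, s, hs, π, fun i => ?_⟩
  rw [hout i]
  exact (hπ i).trans hLk
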